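/- **Setting.** Let $m\ge1$, $0<\alpha\le1$, and let $\Omega\subset\mathbb R^3$ be a bounded domain with $\partial\Omega\in C^{1,\alpha}$ and $\overline\Omega$ convex; $n=(n_1,n_2,n_3)$ is the exterior unit normal. Consider the Dirichlet problem for $u:\overline\Omega\to\mathbb R^m$, $$V_1=f(V_2,\dots,V_{10},X)\ \text{ on }\overline\Omega,\qquad u=A_1\ \text{ on }\partial\Omega ,$$ where $V_1,\dots,V_{10}\in\mathbb R^m$ together are a fixed permutation of the $10m$ components of $(u,u_x,u_y,u_z,u_{xx},u_{xy},u_{xz},u_{yy},u_{yz},u_{zz})$, $f$ is continuous on $\mathbb R^{9m}\times\overline\Omega$, and $A_1$ is the restriction of a $C^2$ function on $\mathbb R^3$, also written $A_1$. Put $Z_1=(V_2,\dots,V_{10})\in\mathbb R^{9m}$, fix a real $m\times 9m$ matrix $C$, and put $\psi(Z_1)=f(Z_1,X)-CZ_1$, so that the equation reads $V_1=CZ_1+S$, $S=\psi(Z_1)$. Each block $u,u_x,\dots,u_{zz}$ is then a constant matrix $A_0,A_{01},A_{02},A_{03},A_{11},A_{12},A_{13},A_{22},A_{23},A_{33}$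 times $(Z_1,S)$. Let $B$ be the $9m\times10m$ matrix with row blocks $i\xi_jA_0-A_{0j}$ ($1\le j\le 3$), then $i\xi_j\,i\xi_kA_0-A_{jk}$ ($1\le j\le k\le 3$, lexicographic order), and write $B=(B_1,-B_2)$ with $B_1$ of size $9m\times9m$. Assume that there is a polynomial $a_1\neq0$ in $i\xi_1,i\xi_2,i\xi_3$ such that $a_1B_1^{-1}$ is a polynomial matrix, and that, with $a$ the maximum of the degrees of the entries of $a_1B_1^{-1}$ and $a_1B_1^{-1}B_2$, $$(1+|\xi|^2)^{-a-3}B_1^{-1},\ (1+|\xi|^2)^{-a-3}B_1^{-1}B_2\in L^1(\mathbb R^3).$$ Put $m_1=6+2a$. *Boundary terms.* Let $h(X)=\frac1{4\pi|X|}$, and let $\psi_1(Z_1)=-(u_{xx}+u_{yy}+u_{zz})$ expressed through $Z_1$ (each component that belongs to $V_1$ is replaced by the corresponding component of $f(Z_1,X)$). Let $g_{01}(X)=\int_{\partial\Omega}\big(\nabla h(X-P)\cdot n_P\big)A_1(P)\,dS_P$ and $g_{02}(P_0)=\lim_{t\to0+}n_{P_0}\cdot\nabla g_{01}(P_0-t\,n_{P_0})$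 for $P_0\in\partial\Omega$. Let $A_5=A_5(Z_1)\in C(\partial\Omega)$ be the solution of $$\tfrac12A_5(P_0)=\int_{\partial\Omega}\big(\nabla h(P_0-P)\cdot n_{P_0}\big)A_5(P)\,dS_P+g_{02}(P_0)+\int_{\overline\Omega}\big(\nabla h(P_0-Y)\cdot n_{P_0}\big)\psi_1(Z_1)(Y)\,dY ,\quad P_0\in\partial\Omega,$$ and $A_{j+1}=\partial_jA_1+(A_5-\partial A_1/\partial n)\,n_j$ for $j=1,2,3$. Put $g_j(\xi)=\int_{\partial\Omega}A_1n_je^{-iX\cdot\xi}dS$, $g_{kj}(\xi)=\int_{\partial\Omega}A_{k+1}n_je^{-iX\cdot\xi}dS$, and let $\beta_1=\beta_1(Z_1)$ be the vector with blocks $-g_j$ ($1\le j\le3$), then $-g_{kj}-i\xi_jg_k$ ($1\le j\le k\le3$, lexicographic order in $(j,k)$). *Operators.* With $F\varphi(\xi)=\int\varphi e^{-iX\cdot\xi}dX$ and $\delta_\epsilon(X)=(\pi\epsilon)^{-3/2}e^{-|X|^2/\epsilon}$, let $$T_0(Z_1)=F^{-1}\big(B_1^{-1}\beta_1+B_1^{-1}B_2\,F(\psi(Z_1)I_{\overline\Omega})\big)$$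 (a tempered distribution), and $$T_{0\epsilon}(Z_1)=F^{-1}\big(F(\delta_\epsilon)B_1^{-1}\beta_1\big)+F^{-1}\big(F(\delta_\epsilon)B_1^{-1}B_2\big)*\big(\psi(Z_1)I_{\overline\Omega}\big).$$ *Norms.* For $M>0$ let $\Omega_M=\{Z_1\in C(\overline\Omega;\mathbb R^{9m}):\|Z_1\|_\infty<M\}$. For a functional $L$ on $C_0^\infty(\Omega)$ let $\|L\|_{-m_1}=\sup_{\varphi\in C_0^\infty(\Omega)}|\langle L,\varphi\rangle|/\|\varphi\|_{m_1}$, where $\|\varphi\|_{m_1}^2=\int_\Omega\sum_{|\gamma|\le m_1}|\partial^\gamma\varphi|^2dX$; $H^{-m_1}(\Omega)$ is the space of distributions on $\Omega$ with finite norm. Locally integrable functions act by $\langle z,\varphi\rangle=\int_\Omega z\varphi\,dX$. For vectors, $\|\cdot\|_{-m_1}$ and $\|\cdot\|_{L^\infty}$ are the maxima over the $9m$ components. **Theorem 4.2.** (1) Let $\epsilon_k>0$, $\epsilon_k\to0$, and let $Z_{1\epsilon_k}\in\Omega_M$ satisfy $Z_{1\epsilon_k}=T_{0\epsilon_k}(Z_{1\epsilon_k})$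 on $\overline\Omega$ for all $k$. Then there are a subsequence $(n_k)$ and $Z_1^*$ with components in $H^{-m_1}(\Omega)$ such that $$\lim_{k\to\infty}\|Z_{1\epsilon_{n_k}}-Z_1^*\|_{-m_1}=0,\qquad \lim_{k\to\infty}\|Z_{1\epsilon_{n_k}}-T_0(Z_{1\epsilon_{n_k}})\|_{-m_1}=0,$$ and every component of $Z_1^*$ that is a locally integrable function on $\Omega$ has $L^\infty$ norm at most $M$; in particular, if $Z_1^*$ is locally integrable, then $\|Z_1^*\|_{L^\infty}\le M$. (2) Let $\epsilon_k>0$, $\epsilon_k\to0$, and let $Z_{1\epsilon_k}\in\Omega_M$ satisfy $Z_{1\epsilon_k}=T_{0\epsilon_k}(Z_{1\epsilon_k})$ on $\overline\Omega$ for all $k$. If $\lim_{k}Z_{1\epsilon_k}$ exists almost everywhere on $\overline\Omega$, then the limit $Z_1^*$ belongs to $L^\infty(\overline\Omega)$, $\|Z_1^*\|_{L^\infty}\le M$, and $Z_1^*=T_0(Z_1^*)$ as distributions on $\Omega$. -/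

import Mathlib

open MeasureTheory Filter Topology Set Asymptotics
open scoped NNReal ENNReal RealInnerProductSpace Distributions

noncomputable section

namespace DirichletSystem

/-- Euclidean three-space. -/
abbrev E3 := EuclideanSpace ℝ (Fin 3)

/-- The `j`-th unit coordinate vector. -/
def basisVec (j : Fin 3) : E3 := EuclideanSpace.single j 1

/-! ### Domains of class `C^{1,α}` and the exterior normal -/

/-- Forget the `i`-th coordinate. -/
def dropCoord (i : Fin 3) (P : E3) : EuclideanSpace ℝ (Fin 2) :=
  WithLp.toLp 2 fun j => P (i.succAbove j)

/-- `∂Ω ∈ C^{1,α}`: near each boundary point, `∂Ω` is the graph of a `C^{1,α}` function of two of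
the three coordinates, and `Ω` lies on one side of the graph. -/
def IsC1HolderDomain (α : ℝ≥0) (Ω : Set E3) : Prop :=
  ∀ P₀ ∈ frontier Ω, ∃ (i : Fin 3) (s δ : ℝ) (γ : EuclideanSpace ℝ (Fin 2) → ℝ) (K : ℝ≥0),
    (s = 1 ∨ s = -1) ∧ 0 < δ ∧
    ContDiffOn ℝ 1 γ (Metric.ball (dropCoord i P₀) δ) ∧
    HolderOnWith K α (fderiv ℝ γ) (Metric.ball (dropCoord i P₀) δ) ∧
    ∀ P ∈ Metric.ball P₀ δ,
      (P ∈ Ω ↔ s * (P i - γ (dropCoord i P)) < 0) ∧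
      (P ∈ frontier Ω ↔ P i = γ (dropCoord i P))

/-- `ν` is the exterior unit normal to `∂Ω` at `P`: it is orthogonal to `∂Ω` at `P` to first order,
points out of `closure Ω`, and `-ν` points into `Ω`. -/
def IsExteriorNormal (Ω : Set E3) (P ν : E3) : Prop :=
  ‖ν‖ = 1 ∧
  (fun Q : E3 => ⟪ν, Q - P⟫) =o[𝓝[frontier Ω] P] (fun Q : E3 => Q - P) ∧
  ∀ᶠ t : ℝ in 𝓝[>] 0, P + t • ν ∉ closure Ω ∧ P - t • ν ∈ Ω

/-- The exterior unit normal field (at boundary points where there is one, it is unique). -/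
def normal (Ω : Set E3) (P : E3) : E3 := Classical.epsilon (IsExteriorNormal Ω P)

/-! ### Fourier transforms -/

/-- `F g (ξ) = ∫ g(X) e^{-i X·ξ} dX`. -/
def fourier (g : E3 → ℂ) (ξ : E3) : ℂ := ∫ X : E3, g X * Complex.exp (-Complex.I * (⟪X, ξ⟫ : ℝ))

/-- `F⁻¹ g (X) = (2π)⁻³ ∫ g(ξ) e^{i X·ξ} dξ`. -/
def fourierInv (g : E3 → ℂ) (X : E3) : ℂ :=
  ((2 * Real.pi) ^ 3 : ℝ)⁻¹ * ∫ ξ : E3, g ξ * Complex.exp (Complex.I * (⟪X, ξ⟫ : ℝ))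

/-- Fourier transform of the surface density `b` on `∂Ω`: `∫_{∂Ω} b(P) e^{-i P·ξ} dS_P`. -/
def surfaceFourier (Ω : Set E3) (b : E3 → ℝ) (ξ : E3) : ℂ :=
  ∫ P in frontier Ω, (b P : ℂ) * Complex.exp (-Complex.I * (⟪P, ξ⟫ : ℝ)) ∂μHE[2]

/-- The Gaussian mollifier `δ_ε(X) = (πε)^{-3/2} e^{-|X|²/ε}`. -/
def gaussian (ε : ℝ) (X : E3) : ℝ := 1 / (Real.sqrt (Real.pi * ε)) ^ 3 * Real.exp (-‖X‖ ^ 2 / ε)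

/-- `h(X) = 1 / (4π|X|)`. -/
def newton (X : E3) : ℝ := 1 / (4 * Real.pi * ‖X‖)

/-! ### Negative Sobolev norms -/

/-- `∂_j g`. -/
def pderiv (j : Fin 3) (g : E3 → ℝ) : E3 → ℝ := fun X => fderiv ℝ g X (basisVec j)

/-- `∂^α g` for a multi-index `α`. -/
def multiDeriv (α : Fin 3 → ℕ) (g : E3 → ℝ) : E3 → ℝ :=
  (pderiv 0)^[α 0] ((pderiv 1)^[α 1] ((pderiv 2)^[α 2] g))

/-- `‖φ‖_n = (∫_Ω ∑_{|α| ≤ n} |∂^α φ|²)^{1/2}`. -/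
def sobolevNorm (Ω : TopologicalSpace.Opens E3) (n : ℕ) (φ : 𝓓(Ω, ℝ)) : ℝ :=
  Real.sqrt (∫ X in (Ω : Set E3),
    ∑ k ∈ Finset.range (n + 1), ∑ α ∈ Finset.piAntidiag (Finset.univ : Finset (Fin 3)) k,
      |multiDeriv α φ X| ^ 2)

/-- `‖L‖_{-n} = sup_{φ ∈ C_0^∞(Ω)} |⟨L, φ⟩| / ‖φ‖_n` (possibly `∞`) of a functional on test
functions. For `φ = 0` the quotient is `0` as soon as `⟨L, 0⟩ = 0`. -/
def negNorm {F : Type*} [NormedAddCommGroup F] (Ω : TopologicalSpace.Opens E3) (n : ℕ)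
    (L : 𝓓(Ω, ℝ) → F) : ℝ≥0∞ :=
  ⨆ φ : 𝓓(Ω, ℝ), ‖L φ‖ₑ / ENNReal.ofReal (sobolevNorm Ω n φ)

/-- `‖(L_i)_i‖_{-n} = max_i ‖L_i‖_{-n}`. -/
def vecNegNorm {F ι : Type*} [NormedAddCommGroup F] (Ω : TopologicalSpace.Opens E3) (n : ℕ)
    (L : ι → 𝓓(Ω, ℝ) → F) : ℝ≥0∞ :=
  ⨆ i, negNorm Ω n (L i)

/-- `H^{-n}(Ω)`: the distributions on `Ω` with finite `‖·‖_{-n}`, i.e. the dual of `H_0^n(Ω)`. -/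
def HNeg (Ω : TopologicalSpace.Opens E3) (n : ℕ) : Set 𝓓'(Ω, ℝ) :=
  {T | negNorm Ω n (fun φ => T φ) < ∞}

/-- `⟨z, φ⟩ = ∫_Ω z φ` for a function `z`. -/
def pairing (Ω : TopologicalSpace.Opens E3) (z : E3 → ℝ) (φ : 𝓓(Ω, ℝ)) : ℝ :=
  ∫ X in (Ω : Set E3), z X * φ X

/-! ### The system -/

/-- Index set of `Z₁ = (V_2, …, V_10)`, i.e. of `v_{m+1}, …, v_{10m}`: `(l, k)` is the `k`-th
component of the block `V_{l+2}` (`l = 0, …, 8`). -/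
abbrev Idx (m : ℕ) := Fin 9 × Fin m

/-- The data of the Dirichlet problem. The jet `(u, ∂u, ∂²u)` is indexed by `Fin 10 × Fin m`, the
first index running through `u, u_x, u_y, u_z, u_xx, u_xy, u_xz, u_yy, u_yz, u_zz`. -/
structure Problem (m : ℕ) where
  /-- the domain -/
  Ω : TopologicalSpace.Opens E3
  /-- the permutation: the `k`-th component of `V_{p+1}` is the jet component `v (p, k)` -/
  v : Equiv.Perm (Fin 10 × Fin m)
  /-- the nonlinearity in `V_1 = f(Z₁, X)` -/
  f : (Idx m → ℝ) → E3 → Fin m → ℝ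
  /-- the constant matrix `(C_1, …, C_9)` -/
  c : Matrix (Fin m) (Idx m) ℝ
  /-- the boundary data `A_1 = u|_{∂Ω}`, given as a function on space -/
  A : E3 → Fin m → ℝ

namespace Problem

variable {m : ℕ} (D : Problem m)

/-- The entries of `A_0, A_01, …, A_33` in the columns of `Z₁`: `Z = (Z₁, S)` and
`V_1 = (C_1, …, C_9) Z₁ + S`. -/
def jetZ (q : Fin 10 × Fin m) : Idx m → ℝ :=
  Fin.cases (motive := fun _ => Idx m → ℝ) (D.c (D.v.symm q).2)
    (fun l => Pi.single (l, (D.v.symm q).2) 1) (D.v.symm q).1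

/-- The entries of `A_0, A_01, …, A_33` in the columns of `S`. -/
def jetS (q : Fin 10 × Fin m) : Fin m → ℝ :=
  Fin.cases (motive := fun _ => Fin m → ℝ) (Pi.single (D.v.symm q).2 1) (fun _ => 0)
    (D.v.symm q).1

/-- The symbols of `∂_x, ∂_y, ∂_z, ∂_xx, ∂_xy, ∂_xz, ∂_yy, ∂_yz, ∂_zz`, as polynomials in the
variables `iξ_1, iξ_2, iξ_3`. -/
def symb : Fin 9 → MvPolynomial (Fin 3) ℂ :=
  ![.X 0, .X 1, .X 2, .X 0 * .X 0, .X 0 * .X 1, .X 0 * .X 2, .X 1 * .X 1, .X 1 * .X 2,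
    .X 2 * .X 2]

/-- The polynomial matrix `B_1`: the first `9m` columns of `B`, whose row block belonging to the
derivative `∂` is `symb(∂) A_0 - A_∂`. -/
def B₁ : Matrix (Idx m) (Idx m) (MvPolynomial (Fin 3) ℂ) := fun r i =>
  symb r.1 * MvPolynomial.C (D.jetZ (0, r.2) i : ℂ) - MvPolynomial.C (D.jetZ (r.1.succ, r.2) i : ℂ)

/-- The polynomial matrix `B_2`, where `-B_2` is the last `m` columns of `B`. -/
def B₂ : Matrix (Idx m) (Fin m) (MvPolynomial (Fin 3) ℂ) := fun r j =>
  -(symb r.1 * MvPolynomial.C (D.jetS (0, r.2) j : ℂ) -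
    MvPolynomial.C (D.jetS (r.1.succ, r.2) j : ℂ))

/-- Evaluation of a polynomial in `iξ_1, iξ_2, iξ_3` at `ξ`. -/
def atFreq {ι κ : Type*} (Q : Matrix ι κ (MvPolynomial (Fin 3) ℂ)) (ξ : E3) : Matrix ι κ ℂ :=
  Q.map (MvPolynomial.eval fun j => Complex.I * (ξ j : ℂ))

/-- `B_1(ξ)⁻¹`. -/
def B₁inv (ξ : E3) : Matrix (Idx m) (Idx m) ℂ := (atFreq D.B₁ ξ)⁻¹

/-- `B_1(ξ)⁻¹ B_2(ξ)`. -/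
def B₁invB₂ (ξ : E3) : Matrix (Idx m) (Fin m) ℂ := D.B₁inv ξ * atFreq D.B₂ ξ

/-- With `P = a_1 B_1⁻¹`: `a = max (∂(a_1 B_1⁻¹), ∂(a_1 B_1⁻¹ B_2))`, the highest degree. -/
def deg (P : Matrix (Idx m) (Idx m) (MvPolynomial (Fin 3) ℂ)) : ℕ :=
  max (Finset.univ.sup fun i => Finset.univ.sup fun j => (P i j).totalDegree)
    (Finset.univ.sup fun i => Finset.univ.sup fun j => ((P * D.B₂) i j).totalDegree)

/-- `S = ψ(Z₁) = f(Z₁, X) - ∑ C_l V_{l+1}`. -/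
def psi (X : E3) (z : Idx m → ℝ) (j : Fin m) : ℝ := D.f z X j - ∑ i, D.c j i * z i

/-- The jet component `q` as a function of `Z₁`: a component of `V_1` is replaced by
`f(Z₁, X)`. -/
def jetValue (X : E3) (z : Idx m → ℝ) (q : Fin 10 × Fin m) : ℝ :=
  Fin.cases (motive := fun _ => ℝ) (D.f z X (D.v.symm q).2) (fun l => z (l, (D.v.symm q).2))
    (D.v.symm q).1

/-- `ψ_1(Z₁) = -Δu = -(u_xx + u_yy + u_zz)` expressed through `Z₁`. -/
def psi₁ (X : E3) (z : Idx m → ℝ) (k : Fin m) : ℝ :=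
  -(D.jetValue X z (4, k) + D.jetValue X z (7, k) + D.jetValue X z (9, k))

/-! ### Boundary terms -/

/-- Exterior unit normal to `∂Ω`. -/
def nrm (P : E3) : E3 := normal (D.Ω : Set E3) P

/-- The double layer potential
`g_01(M) = ∫_{∂Ω} [∇_M h(M - P) · n_P] A_1(P) dS_P`. -/
def g01 (k : Fin m) (M : E3) : ℝ :=
  ∫ P in frontier (D.Ω : Set E3), fderiv ℝ newton (M - P) (D.nrm P) * D.A P k ∂μHE[2]

/-- `g_02(P₀)`: the limit of `∂g_01/∂n_{P₀}` at `P₀` along the normal, from inside `Ω`. -/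
def g02 (k : Fin m) (P₀ : E3) : ℝ :=
  limUnder (𝓝[>] (0 : ℝ)) fun t => fderiv ℝ (D.g01 k) (P₀ - t • D.nrm P₀) (D.nrm P₀)

/-- `A` is a continuous solution on `∂Ω` of the Fredholm equation
`A/2 = ∂h/∂n_{P₀} *_{∂Ω} A + g_02 + ∂h/∂n_{P₀} * ψ_1(Z₁)` for the normal derivative
`A_5 = ∂u/∂n` on `∂Ω`. -/
def IsNormalDeriv (Z : E3 → Idx m → ℝ) (A : E3 → Fin m → ℝ) : Prop :=
  ContinuousOn A (frontier (D.Ω : Set E3)) ∧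
  ∀ P₀ ∈ frontier (D.Ω : Set E3), ∀ k,
    A P₀ k / 2 =
      (∫ P in frontier (D.Ω : Set E3), fderiv ℝ newton (P₀ - P) (D.nrm P₀) * A P k ∂μHE[2]) +
      D.g02 k P₀ +
      ∫ Y in closure (D.Ω : Set E3), fderiv ℝ newton (P₀ - Y) (D.nrm P₀) * D.psi₁ Y (Z Y) k

open Classical in
/-- `A_5 = A_5(Z₁)`: the solution of the Fredholm equation. -/
def A5 (Z : E3 → Idx m → ℝ) : E3 → Fin m → ℝ :=
  if h : ∃ A, D.IsNormalDeriv Z A then h.choose else 0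

/-- `A_2, A_3, A_4 = u_x, u_y, u_z` on `∂Ω`:
`∂_j u = ∂_j A_1 + (A_5 - ∂A_1/∂n) n_j`. -/
def gradTrace (Z : E3 → Idx m → ℝ) (j : Fin 3) (k : Fin m) (P : E3) : ℝ :=
  fderiv ℝ (fun X => D.A X k) P (basisVec j) +
    (D.A5 Z P k - fderiv ℝ (fun X => D.A X k) P (D.nrm P)) * D.nrm P j

/-- `g_j = ∫_{∂Ω} A_1 n_j e^{-iX·ξ} dS`. -/
def g (j : Fin 3) (k : Fin m) (ξ : E3) : ℂ :=
  surfaceFourier (D.Ω : Set E3) (fun P => D.A P k * D.nrm P j) ξ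

/-- `g_{pq} = ∫_{∂Ω} A_{p+1} n_q e^{-iX·ξ} dS`, with `A_{p+1} = ∂_p u` on `∂Ω`
(`p, q` counted from `1` here and from `0` below). -/
def gg (Z : E3 → Idx m → ℝ) (p q : Fin 3) (k : Fin m) (ξ : E3) : ℂ :=
  surfaceFourier (D.Ω : Set E3) (fun P => D.gradTrace Z p k P * D.nrm P q) ξ

/-- The boundary vector `β_1`, which depends on `Z₁` through `A_5`. -/
def beta (Z : E3 → Idx m → ℝ) (ξ : E3) : Idx m → ℂ := fun r =>
  (![-D.g 0 r.2 ξ,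
     -D.g 1 r.2 ξ,
     -D.g 2 r.2 ξ,
     -D.gg Z 0 0 r.2 ξ - Complex.I * ξ 0 * D.g 0 r.2 ξ,
     -D.gg Z 1 0 r.2 ξ - Complex.I * ξ 0 * D.g 1 r.2 ξ,
     -D.gg Z 2 0 r.2 ξ - Complex.I * ξ 0 * D.g 2 r.2 ξ,
     -D.gg Z 1 1 r.2 ξ - Complex.I * ξ 1 * D.g 1 r.2 ξ,
     -D.gg Z 2 1 r.2 ξ - Complex.I * ξ 1 * D.g 2 r.2 ξ,
     -D.gg Z 2 2 r.2 ξ - Complex.I * ξ 2 * D.g 2 r.2 ξ] : Fin 9 → ℂ) r.1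

/-! ### The operators `T_0` and `T_{0ε}` -/

/-- `FI(ψ(Z₁))`: the Fourier transform of `ψ(Z₁) I_{closure Ω}`. -/
def FIpsi (Z : E3 → Idx m → ℝ) (ξ : E3) (j : Fin m) : ℂ :=
  fourier ((closure (D.Ω : Set E3)).indicator fun Y => (D.psi Y (Z Y) j : ℂ)) ξ

/-- `T_0(Z₁) = F⁻¹(B_1⁻¹ β_1 + B_1⁻¹ B_2 FI(ψ(Z₁)))` (that is, `w_1 + w_2 * ψ(Z₁)`), as a
distribution: `⟨T_0(Z₁), φ⟩ = ⟨F T_0(Z₁), F⁻¹ φ⟩`. -/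
def T0 (Z : E3 → Idx m → ℝ) (i : Idx m) (φ : 𝓓(D.Ω, ℝ)) : ℂ :=
  ∫ ξ : E3, ((D.B₁inv ξ).mulVec (D.beta Z ξ) i + (D.B₁invB₂ ξ).mulVec (D.FIpsi Z ξ) i) *
    fourierInv (fun X => (φ X : ℂ)) ξ

/-- `w_{1ε} = F⁻¹(F(δ_ε) B_1⁻¹ β_1)`. -/
def w1eps (Z : E3 → Idx m → ℝ) (ε : ℝ) (i : Idx m) : E3 → ℂ :=
  fourierInv fun ξ =>
    fourier (fun X => (gaussian ε X : ℂ)) ξ * (D.B₁inv ξ).mulVec (D.beta Z ξ) i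

/-- `w_{2ε} = F⁻¹(F(δ_ε) B_1⁻¹ B_2)`. -/
def w2eps (ε : ℝ) (i : Idx m) (j : Fin m) : E3 → ℂ :=
  fourierInv fun ξ => fourier (fun X => (gaussian ε X : ℂ)) ξ * D.B₁invB₂ ξ i j

/-- `T_{0ε}(Z₁) = w_{1ε} + w_{2ε} * ψ(Z₁ I_{closure Ω})`. -/
def T0eps (ε : ℝ) (Z : E3 → Idx m → ℝ) (X : E3) (i : Idx m) : ℂ :=
  D.w1eps Z ε i X +
    ∑ j, ∫ Y in closure (D.Ω : Set E3), D.w2eps ε i j (X - Y) * (D.psi Y (Z Y) j : ℂ)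

/-- `Ω_M = {Z₁ ∈ C(closure Ω) : ‖Z₁‖_∞ < M}`. As `closure Ω` is compact, the maximum norm is
`< M` iff all values are. -/
def OmegaM (M : ℝ) : Set (E3 → Idx m → ℝ) :=
  {Z | ContinuousOn Z (closure (D.Ω : Set E3)) ∧
    ∀ X ∈ closure (D.Ω : Set E3), ∀ i, |Z X i| < M}

/-- `Z₁ = T_{0ε}(Z₁)` on `closure Ω`. -/
def IsFixed (ε : ℝ) (Z : E3 → Idx m → ℝ) : Prop :=
  ∀ X ∈ closure (D.Ω : Set E3), ∀ i, (Z X i : ℂ) = D.T0eps ε Z X i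

/-- The standing assumptions on the data, with Hölder exponent `α`: `Ω` is a bounded domain with
`C^{1,α}` boundary and convex closure, `f` is continuous, the boundary data are `C²`. -/
structure Standing (α : ℝ≥0) : Prop where
  pos : 0 < m
  alpha_pos : 0 < α
  alpha_le : α ≤ 1
  connected : IsConnected (D.Ω : Set E3)
  bounded : Bornology.IsBounded (D.Ω : Set E3)
  boundary : IsC1HolderDomain α (D.Ω : Set E3)
  convex : Convex ℝ (closure (D.Ω : Set E3))
  f_cont : ContinuousOn (fun p : (Idx m → ℝ) × E3 => D.f p.1 p.2)
    (univ ×ˢ closure (D.Ω : Set E3))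
  data : ContDiff ℝ 2 D.A

/-- The assumptions on the constants `C_1, …, C_9`: there is a polynomial `a_1 ≠ 0` such that
`P = a_1 B_1⁻¹` is a polynomial matrix (so `det B_1 ≠ 0`), and
`(1 + |ξ|²)^{-a-3} B_1⁻¹` and `(1 + |ξ|²)^{-a-3} B_1⁻¹ B_2` are in `L¹(ℝ³)`. -/
structure Parameters (a₁ : MvPolynomial (Fin 3) ℂ)
    (P : Matrix (Idx m) (Idx m) (MvPolynomial (Fin 3) ℂ)) : Prop where
  ne_zero : a₁ ≠ 0
  inverse : D.B₁ * P = a₁ • (1 : Matrix (Idx m) (Idx m) (MvPolynomial (Fin 3) ℂ))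
  integrable_inv : ∀ i j, Integrable fun ξ : E3 =>
    ((((1 + ‖ξ‖ ^ 2) ^ (D.deg P + 3))⁻¹ : ℝ) : ℂ) * D.B₁inv ξ i j
  integrable_invB₂ : ∀ i j, Integrable fun ξ : E3 =>
    ((((1 + ‖ξ‖ ^ 2) ^ (D.deg P + 3))⁻¹ : ℝ) : ℂ) * D.B₁invB₂ ξ i j

/-- The order `m_1 = 6 + 2a`. -/
def m₁ (P : Matrix (Idx m) (Idx m) (MvPolynomial (Fin 3) ℂ)) : ℕ := 6 + 2 * D.deg P

end Problem

end DirichletSystem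

end

/-! Testing the fixed point equation against φ turns it into an identity on the Fourier side: ⟨Z, φ⟩
is the integral of e^{-ε|ξ|²/4} · `transform Z` · F⁻¹φ, where `transform Z` = B₁⁻¹β₁ + B₁⁻¹B₂
F(ψ(Z)I) (`T0eps_eq`, `pairing_of_isFixed`). ⟨T₀(Z), φ⟩ is the same integral without the Gaussian
factor. Everything therefore rests on a bound of `transform Z` that is uniform in Z with |Z| ≤ M,
and, for part (2), on its continuity under bounded convergence almost everywhere.

The bound. The vector β₁ grows quadratically in ξ, but by the divergence theorem it equals (symbol)
× (transform of A₁ on Ω) plus a bounded vector (`norm_beta_sub_le`). The symbol vector is B applied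
to the jet whose only nonzero entry is the zero-order one, so B₁⁻¹ of it is controlled by 1 +
|B₁⁻¹B₂| (`norm_B₁inv_symb_le`). Hence `transform Z` is at most a constant times `majorant`, which
is integrable after multiplication by (1+|ξ|²)^{-a-3}. Since |F⁻¹φ| ≤ K ‖φ‖_{2N} (1+|ξ|²)^{-N}
(`exists_norm_fourierInv_le`), the choice N = a+3, 2N = m₁ makes all pairings converge absolutely,
with a constant times ‖φ‖_{m₁} as bound.

Part (1). The defect Z − T₀(Z) carries the factor e^{-ε|ξ|²/4} − 1, and dominated convergence makes
it small in the negative norm (`tendsto_defect`). A bounded sequence has an L²-weakly convergent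
subsequence (`exists_weak_limit`). Its Fourier transforms converge pointwise and stay bounded, so
dominated convergence against an integrable weight upgrades this to convergence in the negative
norm. The bound M survives weak limits.

Part (2). Dominated convergence in both sides of the tested equation needs A₅(Z_k) → A₅(Z*). This is
a statement on the boundary integral equation, whose kernel is weakly singular because convexity and
the Hölder normal give |⟨n_P, P−Q⟩| ≤ C|P−Q|^{1+α}. The operator is compact on C(∂Ω), so by the
Fredholm alternative it suffices that the homogeneous equation has only the zero solution
(`eq_zero_of_homogeneous`). On a convex domain the kernel has one sign, and the flux of the
Newtonian field from a boundary point is at most half of the total. Integrating |A| ≤ 2∫|k||A| then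
forces equality, and equality forces A to have opposite signs at points with different normals.
Three pairwise different normals are incompatible with that unless A = 0.

The geometry behind this (`IsC1HolderDomain.holderConvex`, the area formula `volume_image_eq`, the
divergence theorem `integral_fderiv_eq`) is derived for Hausdorff measure on ∂Ω from supporting
planes and coordinate projections. -/

noncomputable section

namespace DirichletSystem


/-! ### Coordinates -/

/-- The plane of the parameters of a graph. -/
abbrev E2 := EuclideanSpace ℝ (Fin 2)

/-- `dropCoord i` as a continuous linear map. -/
def dropL (i : Fin 3) : E3 →L[ℝ] E2 :=
  LinearMap.toContinuousLinearMap
    { toFun := dropCoord i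
      map_add' := fun x y => by ext j; simp [dropCoord]
      map_smul' := fun c x => by ext j; simp [dropCoord] }

@[simp] lemma dropL_apply (i : Fin 3) (x : E3) : dropL i x = dropCoord i x := rfl

@[simp] lemma dropCoord_apply (i : Fin 3) (x : E3) (j : Fin 2) :
    dropCoord i x j = x (i.succAbove j) := rfl

/-- Insert `t` as the `i`-th coordinate. -/
def insCoord (i : Fin 3) (t : ℝ) (y : E2) : E3 :=
  WithLp.toLp 2 (i.insertNth (α := fun _ => ℝ) t fun j => y j)

@[simp] lemma insCoord_same (i : Fin 3) (t : ℝ) (y : E2) : insCoord i t y i = t := by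
  simp [insCoord]

@[simp] lemma insCoord_succAbove (i : Fin 3) (t : ℝ) (y : E2) (j : Fin 2) :
    insCoord i t y (i.succAbove j) = y j := by
  simp [insCoord]

@[simp] lemma dropCoord_insCoord (i : Fin 3) (t : ℝ) (y : E2) :
    dropCoord i (insCoord i t y) = y := by
  ext j; simp

lemma ext_coord (i : Fin 3) {x y : E3} (h : x i = y i) (h' : dropCoord i x = dropCoord i y) :
    x = y := by
  ext k
  rcases Fin.eq_self_or_eq_succAbove i k with rfl | ⟨j, rfl⟩
  · exact h
  · simpa using congrArg (fun z : E2 => z j) h'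

@[simp] lemma insCoord_dropCoord (i : Fin 3) (x : E3) : insCoord i (x i) (dropCoord i x) = x :=
  ext_coord i (by simp) (by simp)

lemma norm_sq_coord (i : Fin 3) (x : E3) : ‖x‖ ^ 2 = x i ^ 2 + ‖dropCoord i x‖ ^ 2 := by
  simp [EuclideanSpace.norm_sq_eq, Fin.sum_univ_succAbove _ i]

lemma inner_coord (i : Fin 3) (x y : E3) :
    ⟪x, y⟫ = x i * y i + ⟪dropCoord i x, dropCoord i y⟫ := by
  simp [PiLp.inner_apply, Fin.sum_univ_succAbove _ i, mul_comm]

lemma norm_dropCoord_le (i : Fin 3) (x : E3) : ‖dropCoord i x‖ ≤ ‖x‖ := by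
  have := norm_sq_coord i x
  nlinarith [sq_nonneg (x i), norm_nonneg x, norm_nonneg (dropCoord i x)]

lemma abs_coord_le (x : E3) (i : Fin 3) : |x i| ≤ ‖x‖ := by
  simpa using PiLp.norm_apply_le x i

lemma dropCoord_sub (i : Fin 3) (x y : E3) :
    dropCoord i (x - y) = dropCoord i x - dropCoord i y := (dropL i).map_sub x y

@[simp] lemma dropCoord_basisVec (i : Fin 3) : dropCoord i (basisVec i) = 0 := by
  ext j; simp [basisVec]

@[simp] lemma basisVec_same (i : Fin 3) : basisVec i i = 1 := by simp [basisVec]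

@[simp] lemma inner_basisVec (x : E3) (i : Fin 3) : ⟪x, basisVec i⟫ = x i := by
  simp [basisVec, EuclideanSpace.inner_single_right]

lemma norm_basisVec (i : Fin 3) : ‖basisVec i‖ = 1 := by simp [basisVec]

/-! ### The exterior normal of a convex domain of class `C^{1,α}` -/

/-- The derivative of `P ↦ s (P_i - γ(P'))` at a point above `y`. -/
def graphForm (i : Fin 3) (s : ℝ) (γ : E2 → ℝ) (y : E2) : E3 →L[ℝ] ℝ :=
  s • (EuclideanSpace.proj (𝕜 := ℝ) i - (fderiv ℝ γ y).comp (dropL i))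

lemma graphForm_apply (i : Fin 3) (s : ℝ) (γ : E2 → ℝ) (y : E2) (v : E3) :
    graphForm i s γ y v = s * (v i - fderiv ℝ γ y (dropCoord i v)) := by
  simp [graphForm]

/-- The vector representing `graphForm`. -/
def graphVec (i : Fin 3) (s : ℝ) (γ : E2 → ℝ) (y : E2) : E3 :=
  (InnerProductSpace.toDual ℝ E3).symm (graphForm i s γ y)

lemma inner_graphVec (i : Fin 3) (s : ℝ) (γ : E2 → ℝ) (y : E2) (v : E3) :
    ⟪graphVec i s γ y, v⟫ = graphForm i s γ y v := by
  simp [graphVec]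

/-- The component along the graph direction is ±1. The lower bound lets normalisation of the vector
preserve Hölder estimates. -/
lemma one_le_norm_graphVec (i : Fin 3) {s : ℝ} (hs : s = 1 ∨ s = -1) (γ : E2 → ℝ) (y : E2) :
    1 ≤ ‖graphVec i s γ y‖ := by
  have h := real_inner_le_norm (graphVec i s γ y) (s • basisVec i)
  rw [inner_graphVec, graphForm_apply, norm_smul, norm_basisVec] at h
  have : dropCoord i (s • basisVec i) = 0 := by
    rw [← dropL_apply, map_smul]; simp
  rw [this] at h
  rcases hs with rfl | rfl <;> simpa using h

/-- A chart of class `C^{1,α}` of the boundary of `Ω` in the ball of radius `δ` about `P₀`. -/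
structure IsGraphChart (Ω : Set E3) (α : ℝ≥0) (P₀ : E3) (i : Fin 3) (s δ : ℝ) (γ : E2 → ℝ)
    (K : ℝ≥0) : Prop where
  sign : s = 1 ∨ s = -1
  pos : 0 < δ
  smooth : ContDiffOn ℝ 1 γ (Metric.ball (dropCoord i P₀) δ)
  holder : HolderOnWith K α (fderiv ℝ γ) (Metric.ball (dropCoord i P₀) δ)
  mem_iff : ∀ P ∈ Metric.ball P₀ δ, P ∈ Ω ↔ s * (P i - γ (dropCoord i P)) < 0
  frontier_iff : ∀ P ∈ Metric.ball P₀ δ, P ∈ frontier Ω ↔ P i = γ (dropCoord i P)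

lemma IsC1HolderDomain.exists_chart {α : ℝ≥0} {Ω : Set E3} (h : IsC1HolderDomain α Ω) {P₀ : E3}
    (hP : P₀ ∈ frontier Ω) : ∃ i s δ γ K, IsGraphChart Ω α P₀ i s δ γ K := by
  obtain ⟨i, s, δ, γ, K, h1, h2, h3, h4, h5⟩ := h P₀ hP
  exact ⟨i, s, δ, γ, K, h1, h2, h3, h4, fun P hP => (h5 P hP).1, fun P hP => (h5 P hP).2⟩

namespace IsGraphChart

variable {Ω : Set E3} {α : ℝ≥0} {P₀ : E3} {i : Fin 3} {s δ : ℝ} {γ : E2 → ℝ} {K : ℝ≥0}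

lemma dropCoord_mem (P₀ : E3) (i : Fin 3) {δ : ℝ} {P : E3} (hP : P ∈ Metric.ball P₀ δ) :
    dropCoord i P ∈ Metric.ball (dropCoord i P₀) δ := by
  rw [Metric.mem_ball, dist_eq_norm, ← dropCoord_sub] at *
  exact (norm_dropCoord_le _ _).trans_lt (by rwa [← dist_eq_norm])

lemma differentiableAt (h : IsGraphChart Ω α P₀ i s δ γ K) {P : E3} (hP : P ∈ Metric.ball P₀ δ) :
    DifferentiableAt ℝ γ (dropCoord i P) :=
  (h.smooth.contDiffAt (Metric.isOpen_ball.mem_nhds (dropCoord_mem P₀ i hP))).differentiableAt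
    (by norm_num)

lemma hasDerivAt_line (h : IsGraphChart Ω α P₀ i s δ γ K) {P : E3} (hP : P ∈ Metric.ball P₀ δ)
    (v : E3) :
    HasDerivAt (fun t : ℝ => s * ((P + t • v) i - γ (dropCoord i (P + t • v))))
      (graphForm i s γ (dropCoord i P) v) 0 := by
  have hG : HasFDerivAt (fun Q : E3 => s * (Q i - γ (dropCoord i Q)))
      (graphForm i s γ (dropCoord i P)) P := by
    have h1 : HasFDerivAt (fun Q : E3 => γ (dropL i Q))
        ((fderiv ℝ γ (dropCoord i P)).comp (dropL i)) P :=
      HasFDerivAt.comp P (h.differentiableAt hP).hasFDerivAt (dropL i).hasFDerivAt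
    have h2 : HasFDerivAt (fun Q : E3 => Q i) (EuclideanSpace.proj (𝕜 := ℝ) i : E3 →L[ℝ] ℝ) P :=
      (EuclideanSpace.proj (𝕜 := ℝ) i : E3 →L[ℝ] ℝ).hasFDerivAt
    exact (h2.sub h1).const_mul s
  have hl : HasDerivAt (fun t : ℝ => P + t • v) v 0 := by
    simpa using ((hasDerivAt_id (0 : ℝ)).smul_const v).const_add P
  have hG' : HasFDerivAt (fun Q : E3 => s * (Q i - γ (dropCoord i Q)))
      (graphForm i s γ (dropCoord i P)) (P + (0 : ℝ) • v) := by simpa using hG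
  exact hG'.comp_hasDerivAt 0 hl

lemma tendsto_line (P v : E3) : Tendsto (fun t : ℝ => P + t • v) (𝓝 0) (𝓝 P) := by
  have : Continuous fun t : ℝ => P + t • v := by fun_prop
  simpa using this.tendsto 0

lemma eventually_mem_ball {P : E3} (hP : P ∈ Metric.ball P₀ δ) (v : E3) :
    ∀ᶠ t : ℝ in 𝓝 0, P + t • v ∈ Metric.ball P₀ δ :=
  (tendsto_line P v).eventually (Metric.isOpen_ball.mem_nhds hP)

end IsGraphChart

lemma eventually_neg_of_hasDerivAt {f : ℝ → ℝ} {f' : ℝ} (hf : HasDerivAt f f' 0) (h0 : f 0 = 0)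
    (h' : f' < 0) : ∀ᶠ t in 𝓝[>] (0 : ℝ), f t < 0 := by
  have h1 := (hasDerivAt_iff_tendsto_slope.1 hf).mono_left
    (nhdsWithin_mono 0 (fun x hx => ne_of_gt hx) : 𝓝[>] (0 : ℝ) ≤ 𝓝[≠] 0)
  filter_upwards [h1.eventually_lt_const h', self_mem_nhdsWithin] with t ht ht0
  rw [slope_def_field, h0, sub_zero, sub_zero] at ht
  have ht0 : 0 < t := ht0
  by_contra hc
  exact absurd ht (not_lt.2 (div_nonneg (not_lt.1 hc) ht0.le))

lemma hasDerivAt_euclideanSpace {k : ℕ} {c : ℝ → EuclideanSpace ℝ (Fin k)}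
    {v : EuclideanSpace ℝ (Fin k)} {t : ℝ} :
    HasDerivAt c v t ↔ ∀ j, HasDerivAt (fun x => c x j) (v j) t := by
  rw [hasDerivAt_iff_hasFDerivAt, ← hasFDerivWithinAt_univ, hasFDerivWithinAt_euclidean]
  refine forall_congr' fun j => ?_
  rw [hasFDerivWithinAt_univ, hasDerivAt_iff_hasFDerivAt]
  congr!

namespace IsGraphChart

variable {Ω : Set E3} {α : ℝ≥0} {P₀ : E3} {i : Fin 3} {s δ : ℝ} {γ : E2 → ℝ} {K : ℝ≥0}

lemma eventually_mem (h : IsGraphChart Ω α P₀ i s δ γ K) {P : E3} (hP : P ∈ Metric.ball P₀ δ)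
    (hPf : P ∈ frontier Ω) {v : E3} (hv : graphForm i s γ (dropCoord i P) v < 0) :
    ∀ᶠ t : ℝ in 𝓝[>] 0, P + t • v ∈ Ω := by
  have h0 := (h.frontier_iff P hP).1 hPf
  filter_upwards [eventually_neg_of_hasDerivAt (h.hasDerivAt_line hP v) (by simp [h0]) hv,
    (eventually_mem_ball hP v).filter_mono nhdsWithin_le_nhds] with t ht htb
  exact (h.mem_iff _ htb).2 ht

lemma eventually_notMem (h : IsGraphChart Ω α P₀ i s δ γ K) {P : E3} (hP : P ∈ Metric.ball P₀ δ)
    (hPf : P ∈ frontier Ω) {v : E3} (hv : 0 < graphForm i s γ (dropCoord i P) v) :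
    ∀ᶠ t : ℝ in 𝓝[>] 0, P + t • v ∉ closure Ω := by
  have h0 := (h.frontier_iff P hP).1 hPf
  filter_upwards [eventually_neg_of_hasDerivAt (h.hasDerivAt_line hP v).neg (by simp [h0])
      (by linarith), (eventually_mem_ball hP v).filter_mono nhdsWithin_le_nhds] with t ht htb
  have ht : 0 < s * ((P + t • v) i - γ (dropCoord i (P + t • v))) := by simpa using ht
  rw [closure_eq_self_union_frontier]
  rintro (hm | hm)
  · exact absurd ((h.mem_iff _ htb).1 hm) (not_lt.2 ht.le)
  · rw [(h.frontier_iff _ htb).1 hm] at ht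
    simp at ht

/-- The unit normal in a chart. -/
def unitVec (i : Fin 3) (s : ℝ) (γ : E2 → ℝ) (y : E2) : E3 :=
  ‖graphVec i s γ y‖⁻¹ • graphVec i s γ y

lemma graphVec_norm_pos (h : IsGraphChart Ω α P₀ i s δ γ K) (y : E2) :
    0 < ‖graphVec i s γ y‖ := zero_lt_one.trans_le (one_le_norm_graphVec i h.sign γ y)

lemma norm_unitVec (h : IsGraphChart Ω α P₀ i s δ γ K) (y : E2) : ‖unitVec i s γ y‖ = 1 := by
  have := h.graphVec_norm_pos y
  rw [unitVec, norm_smul, norm_inv, norm_norm, inv_mul_cancel₀ this.ne']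

lemma inner_unitVec (y : E2) (v : E3) :
    ⟪unitVec i s γ y, v⟫ = ‖graphVec i s γ y‖⁻¹ * graphForm i s γ y v := by
  rw [unitVec, real_inner_smul_left, inner_graphVec]

lemma graphForm_unitVec (h : IsGraphChart Ω α P₀ i s δ γ K) (y : E2) :
    0 < graphForm i s γ y (unitVec i s γ y) := by
  have h1 := inner_unitVec (i := i) (s := s) (γ := γ) y (unitVec i s γ y)
  rw [real_inner_self_eq_norm_sq, h.norm_unitVec] at h1
  have := h.graphVec_norm_pos y
  by_contra hc
  have : ‖graphVec i s γ y‖⁻¹ * graphForm i s γ y (unitVec i s γ y) ≤ 0 :=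
    mul_nonpos_of_nonneg_of_nonpos (by positivity) (not_lt.1 hc)
  linarith

lemma isExteriorNormal (h : IsGraphChart Ω α P₀ i s δ γ K) {P : E3} (hP : P ∈ Metric.ball P₀ δ)
    (hPf : P ∈ frontier Ω) : IsExteriorNormal Ω P (unitVec i s γ (dropCoord i P)) := by
  refine ⟨h.norm_unitVec _, ?_, ?_⟩
  · have h1 : (fun y => γ y - γ (dropCoord i P) - fderiv ℝ γ (dropCoord i P) (y - dropCoord i P))
        =o[𝓝 (dropCoord i P)] fun y => y - dropCoord i P :=
      (h.differentiableAt hP).hasFDerivAt.isLittleO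
    have h2 := h1.comp_tendsto ((dropL i).continuous.tendsto P)
    have h3 : ((fun y => y - dropCoord i P) ∘ fun x : E3 => dropL i x)
        =O[𝓝 P] fun Q : E3 => Q - P := by
      refine IsBigO.of_bound 1 (Eventually.of_forall fun Q => ?_)
      simp only [Function.comp, dropL_apply, one_mul, ← dropCoord_sub]
      exact norm_dropCoord_le _ _
    have h4 := ((h2.trans_isBigO h3).mono
      (nhdsWithin_le_nhds : 𝓝[frontier Ω] P ≤ 𝓝 P)).const_mul_left
      (‖graphVec i s γ (dropCoord i P)‖⁻¹ * s)
    refine h4.congr' ?_ EventuallyEq.rfl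
    filter_upwards [self_mem_nhdsWithin,
      nhdsWithin_le_nhds (Metric.isOpen_ball.mem_nhds hP)] with Q hQ hQb
    rw [inner_unitVec, graphForm_apply]
    simp only [Function.comp, dropL_apply, PiLp.sub_apply]
    rw [(h.frontier_iff Q hQb).1 hQ, (h.frontier_iff P hP).1 hPf, dropCoord_sub]
    ring
  · have h1 := h.eventually_notMem hP hPf (h.graphForm_unitVec _)
    have h2 := h.eventually_mem hP hPf (v := -unitVec i s γ (dropCoord i P))
      (by rw [map_neg]; linarith [h.graphForm_unitVec (dropCoord i P)])
    filter_upwards [h1, h2] with t h1 h2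
    exact ⟨h1, by simpa [sub_eq_add_neg] using h2⟩

/-- Uniqueness of the exterior normal. The part v of ν orthogonal to n is the velocity of a curve on
the boundary, and ν is orthogonal to the boundary to first order, so ⟨ν, v⟩ = 0 and v = 0. This
leaves ν = ±n, and the minus sign contradicts that n points out of the closure while −ν points into
Ω. -/
lemma eq_unitVec (h : IsGraphChart Ω α P₀ i s δ γ K) {P : E3} (hP : P ∈ Metric.ball P₀ δ)
    (hPf : P ∈ frontier Ω) {ν : E3} (hν : IsExteriorNormal Ω P ν) :
    ν = unitVec i s γ (dropCoord i P) := by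
  set n := unitVec i s γ (dropCoord i P) with hn
  have hn1 : ‖n‖ = 1 := h.norm_unitVec _
  set v := ν - ⟪n, ν⟫ • n with hv
  have hnv : ⟪n, v⟫ = 0 := by
    rw [hv, inner_sub_right, real_inner_smul_right, real_inner_self_eq_norm_sq, hn1]; ring
  have hform : graphForm i s γ (dropCoord i P) v = 0 := by
    have h1 := inner_unitVec (i := i) (s := s) (γ := γ) (dropCoord i P) v
    rw [← hn, hnv] at h1
    have := h.graphVec_norm_pos (dropCoord i P)
    rcases mul_eq_zero.1 h1.symm with h2 | h2
    · exact absurd h2 (inv_ne_zero this.ne')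
    · exact h2
  -- a curve on the boundary with velocity `v`
  let c : ℝ → E3 := fun t => insCoord i (γ (dropCoord i P + t • dropCoord i v))
    (dropCoord i P + t • dropCoord i v)
  have hc0 : c 0 = P := by
    simp only [c, zero_smul, add_zero, ← (h.frontier_iff P hP).1 hPf, insCoord_dropCoord]
  have hv1 : v i = fderiv ℝ γ (dropCoord i P) (dropCoord i v) := by
    rw [graphForm_apply] at hform
    rcases mul_eq_zero.1 hform with h2 | h2
    · rcases h.sign with rfl | rfl <;> norm_num at h2
    · linarith
  have hline : HasDerivAt (fun t : ℝ => dropCoord i P + t • dropCoord i v) (dropCoord i v) 0 := by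
    simpa using ((hasDerivAt_id (0 : ℝ)).smul_const (dropCoord i v)).const_add (dropCoord i P)
  have hγ : HasDerivAt (fun t : ℝ => γ (dropCoord i P + t • dropCoord i v)) (v i) 0 := by
    rw [hv1]
    refine HasFDerivAt.comp_hasDerivAt (f := fun t : ℝ => dropCoord i P + t • dropCoord i v)
      (0 : ℝ) ?_ hline
    simpa using (h.differentiableAt hP).hasFDerivAt
  have hc : HasDerivAt c v 0 := by
    rw [hasDerivAt_euclideanSpace]
    intro k
    rcases Fin.eq_self_or_eq_succAbove i k with rfl | ⟨j, rfl⟩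
    · simpa [c] using hγ
    · simpa [c] using (hasDerivAt_euclideanSpace.1 hline j)
  have hcP : Tendsto c (𝓝[>] 0) (𝓝[frontier Ω] P) := by
    have h1 : Tendsto c (𝓝[>] 0) (𝓝 P) := by
      simpa [hc0] using hc.continuousAt.tendsto.mono_left nhdsWithin_le_nhds
    refine tendsto_nhdsWithin_iff.2 ⟨h1, ?_⟩
    filter_upwards [h1.eventually (Metric.isOpen_ball.mem_nhds hP)] with t ht
    exact (h.frontier_iff _ ht).2 (by simp [c])
  have hzero : ⟪ν, v⟫ = 0 := by
    have h1 := hν.2.1.comp_tendsto hcP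
    have h2 : ((fun Q : E3 => Q - P) ∘ c) =O[𝓝[>] (0 : ℝ)] fun t => t := by
      have := hc.isBigO_sub.mono (nhdsWithin_le_nhds : 𝓝[>] (0 : ℝ) ≤ 𝓝 0)
      simpa [hc0, Function.comp_def] using this
    have h3 := (h1.trans_isBigO h2).tendsto_div_nhds_zero
    have h4 : HasDerivAt (fun t => ⟪ν, c t - P⟫) ⟪ν, v⟫ 0 := by
      simpa using (HasDerivAt.inner ℝ (hasDerivAt_const (0 : ℝ) ν) (hc.sub_const P))
    have h5 := (hasDerivAt_iff_tendsto_slope.1 h4).mono_left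
      (nhdsWithin_mono 0 (fun x hx => ne_of_gt hx) : 𝓝[>] (0 : ℝ) ≤ 𝓝[≠] 0)
    refine tendsto_nhds_unique (h5.congr fun t => ?_) h3
    simp [slope_def_field, hc0]
  have hv0 : v = 0 := by
    have : ⟪v, v⟫ = 0 := by
      conv_lhs => rw [hv, inner_sub_left, real_inner_smul_left, hzero, hnv]
      simp
    simpa using this
  have hνn : ν = ⟪n, ν⟫ • n := by rw [← sub_eq_zero]; exact hv0
  have habs : |⟪n, ν⟫| = 1 := by
    have := hν.1
    rw [hνn, norm_smul, hn1, mul_one] at this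
    exact this
  rcases eq_or_eq_neg_of_abs_eq habs with h1 | h1
  · rw [hνn, h1, one_smul]
  · exfalso
    rw [h1] at hνn
    obtain ⟨t, ht1, ht2⟩ := (hν.2.2.and (h.isExteriorNormal hP hPf).2.2).exists
    refine ht1.1 (subset_closure ?_)
    rw [hνn]
    simpa [sub_eq_add_neg] using ht2.2

lemma normal_eq (h : IsGraphChart Ω α P₀ i s δ γ K) {P : E3} (hP : P ∈ Metric.ball P₀ δ)
    (hPf : P ∈ frontier Ω) : normal Ω P = unitVec i s γ (dropCoord i P) :=
  h.eq_unitVec hP hPf (Classical.epsilon_spec ⟨_, h.isExteriorNormal hP hPf⟩)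

lemma inner_normal_pos_iff (h : IsGraphChart Ω α P₀ i s δ γ K) {P : E3}
    (hP : P ∈ Metric.ball P₀ δ) (hPf : P ∈ frontier Ω) (v : E3) :
    0 < ⟪normal Ω P, v⟫ ↔ 0 < graphForm i s γ (dropCoord i P) v := by
  rw [h.normal_eq hP hPf, inner_unitVec,
    mul_pos_iff_of_pos_left (inv_pos.2 (h.graphVec_norm_pos _))]

/-- Normalisation is 2-Lipschitz on vectors of norm at least 1. -/
lemma norm_unitVec_sub_le (h : IsGraphChart Ω α P₀ i s δ γ K) (y z : E2) :
    ‖unitVec i s γ y - unitVec i s γ z‖ ≤ 2 * ‖graphVec i s γ y - graphVec i s γ z‖ := by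
  set a := graphVec i s γ y
  set b := graphVec i s γ z
  have ha : 0 < ‖a‖ := h.graphVec_norm_pos y
  have ha1 : 1 ≤ ‖a‖ := one_le_norm_graphVec i h.sign γ y
  have hb : 0 < ‖b‖ := h.graphVec_norm_pos z
  have e : unitVec i s γ y - unitVec i s γ z
      = ‖a‖⁻¹ • ((a - b) + (‖b‖ - ‖a‖) • (‖b‖⁻¹ • b)) := by
    simp only [unitVec]
    change ‖a‖⁻¹ • a - ‖b‖⁻¹ • b = _
    rw [sub_smul, smul_smul, mul_inv_cancel₀ hb.ne', one_smul, sub_add_sub_cancel, smul_sub,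
      smul_smul ‖a‖⁻¹ ‖a‖, inv_mul_cancel₀ ha.ne', one_smul]
  rw [e, norm_smul, norm_inv, norm_norm]
  have h1 : ‖(a - b) + (‖b‖ - ‖a‖) • (‖b‖⁻¹ • b)‖ ≤ 2 * ‖a - b‖ := by
    refine (norm_add_le _ _).trans ?_
    rw [norm_smul, norm_smul, norm_inv, norm_norm, inv_mul_cancel₀ hb.ne', mul_one, Real.norm_eq_abs]
    have := abs_norm_sub_norm_le b a
    rw [norm_sub_rev] at this
    linarith
  calc ‖a‖⁻¹ * _ ≤ 1 * (2 * ‖a - b‖) := by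
        gcongr
        exact inv_le_one_of_one_le₀ ha1
    _ = _ := one_mul _

lemma norm_graphVec_sub_le (h : IsGraphChart Ω α P₀ i s δ γ K) {P Q : E3}
    (hP : P ∈ Metric.ball P₀ δ) (hQ : Q ∈ Metric.ball P₀ δ) :
    ‖graphVec i s γ (dropCoord i P) - graphVec i s γ (dropCoord i Q)‖
      ≤ K * ‖P - Q‖ ^ (α : ℝ) := by
  have e : graphVec i s γ (dropCoord i P) - graphVec i s γ (dropCoord i Q)
      = (InnerProductSpace.toDual ℝ E3).symm
        (graphForm i s γ (dropCoord i P) - graphForm i s γ (dropCoord i Q)) := by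
    simp [graphVec]
  rw [e, LinearIsometryEquiv.norm_map]
  refine ContinuousLinearMap.opNorm_le_bound _ (by positivity) fun v => ?_
  have hs : |s| = 1 := by rcases h.sign with rfl | rfl <;> simp
  have e2 : (graphForm i s γ (dropCoord i P) - graphForm i s γ (dropCoord i Q)) v
      = -(s * ((fderiv ℝ γ (dropCoord i P) - fderiv ℝ γ (dropCoord i Q)) (dropCoord i v))) := by
    rw [sub_apply, graphForm_apply, graphForm_apply,
      sub_apply]
    ring
  rw [e2, norm_neg, norm_mul, Real.norm_eq_abs, hs, one_mul]
  refine (ContinuousLinearMap.le_opNorm _ _).trans ?_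
  have h1 := h.holder.dist_le (dropCoord_mem P₀ i hP) (dropCoord_mem P₀ i hQ)
  rw [dist_eq_norm, dist_eq_norm, ← dropCoord_sub] at h1
  gcongr
  · refine h1.trans ?_
    gcongr
    exact norm_dropCoord_le _ _
  · exact norm_dropCoord_le _ _

end IsGraphChart

/-- A bounded domain with convex closure and Hölder continuous unit normal `n`. -/
structure HolderConvex (Ω : Set E3) (n : E3 → E3) (α C : ℝ) : Prop where
  isOpen : IsOpen Ω
  bounded : Bornology.IsBounded Ω
  nonempty : Ω.Nonempty
  convex : Convex ℝ (closure Ω)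
  alpha_pos : 0 < α
  alpha_le : α ≤ 1
  const_nonneg : 0 ≤ C
  unit : ∀ Q ∈ frontier Ω, ‖n Q‖ = 1
  support : ∀ Q ∈ frontier Ω, ∀ X ∈ closure Ω, ⟪n Q, X - Q⟫ ≤ 0
  holder : ∀ P ∈ frontier Ω, ∀ Q ∈ frontier Ω, ‖n P - n Q‖ ≤ C * ‖P - Q‖ ^ α
  inward : ∀ Q ∈ frontier Ω, ∀ v, ⟪n Q, v⟫ < 0 → ∀ᶠ t : ℝ in 𝓝[>] 0, Q + t • v ∈ Ω

theorem IsC1HolderDomain.holderConvex {α : ℝ≥0} {Ω : Set E3} (h : IsC1HolderDomain α Ω)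
    (ho : IsOpen Ω) (hb : Bornology.IsBounded Ω) (hne : Ω.Nonempty)
    (hc : Convex ℝ (closure Ω)) (hα : 0 < α) (hα1 : α ≤ 1) :
    ∃ C, HolderConvex Ω (normal Ω) α C := by
  have hunit : ∀ Q ∈ frontier Ω, ‖normal Ω Q‖ = 1 := by
    intro Q hQ
    obtain ⟨i, s, δ, γ, K, hch⟩ := h.exists_chart hQ
    rw [hch.normal_eq (Metric.mem_ball_self hch.pos) hQ, hch.norm_unitVec]
  have hcomp : IsCompact (frontier Ω) :=
    hb.isCompact_closure.of_isClosed_subset isClosed_frontier frontier_subset_closure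
  -- Local bounds around each pair of boundary points combine by compactness of ∂Ω × ∂Ω. Around a
  -- diagonal pair a single chart serves; around any other pair the distance stays bounded below,
  -- while unit normals differ by at most 2.
  obtain ⟨C, hC⟩ : ∃ C : ℝ, ∀ p ∈ frontier Ω ×ˢ frontier Ω,
      ‖normal Ω p.1 - normal Ω p.2‖ ≤ C * ‖p.1 - p.2‖ ^ (α : ℝ) := by
    refine (hcomp.prod hcomp).induction_on
      (p := fun s => ∃ C : ℝ, ∀ p ∈ s, ‖normal Ω p.1 - normal Ω p.2‖ ≤ C * ‖p.1 - p.2‖ ^ (α : ℝ))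
      ⟨0, by simp⟩ (fun s t hst ⟨C, hC⟩ => ⟨C, fun p hp => hC p (hst hp)⟩) ?_ ?_
    · rintro s t ⟨C, hC⟩ ⟨C', hC'⟩
      refine ⟨max C C', fun p hp => ?_⟩
      rcases hp with hp | hp
      · exact (hC p hp).trans (by gcongr; exact le_max_left _ _)
      · exact (hC' p hp).trans (by gcongr; exact le_max_right _ _)
    · rintro ⟨P, Q⟩ ⟨hP, hQ⟩
      by_cases hPQ : P = Q
      · subst hPQ
        obtain ⟨i, s, δ, γ, K, hch⟩ := h.exists_chart hP
        refine ⟨(frontier Ω ×ˢ frontier Ω) ∩ (Metric.ball P δ ×ˢ Metric.ball P δ),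
          inter_mem_nhdsWithin _ ((Metric.isOpen_ball.prod Metric.isOpen_ball).mem_nhds
            ⟨Metric.mem_ball_self hch.pos, Metric.mem_ball_self hch.pos⟩), 2 * K, ?_⟩
        rintro ⟨A, B⟩ ⟨⟨hA, hB⟩, hA', hB'⟩
        simp only at *
        rw [hch.normal_eq hA' hA, hch.normal_eq hB' hB, mul_assoc]
        exact (hch.norm_unitVec_sub_le _ _).trans
          (by gcongr; exact hch.norm_graphVec_sub_le hA' hB')
      · have hd : 0 < ‖P - Q‖ := norm_pos_iff.2 (sub_ne_zero.2 hPQ)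
        have hcont : Continuous fun p : E3 × E3 => ‖p.1 - p.2‖ := by fun_prop
        refine ⟨(frontier Ω ×ˢ frontier Ω) ∩ {p | ‖P - Q‖ / 2 < ‖p.1 - p.2‖},
          inter_mem_nhdsWithin _ ((isOpen_lt continuous_const hcont).mem_nhds (half_lt_self hd)),
          2 / (‖P - Q‖ / 2) ^ (α : ℝ), ?_⟩
        rintro ⟨A, B⟩ ⟨⟨hA, hB⟩, hAB⟩
        simp only [mem_ofPred_eq] at *
        have h1 : ‖normal Ω A - normal Ω B‖ ≤ 2 := by
          refine (norm_sub_le _ _).trans ?_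
          rw [hunit A hA, hunit B hB]; norm_num
        refine h1.trans ?_
        rw [div_mul_eq_mul_div, le_div_iff₀ (by positivity)]
        gcongr
  refine ⟨max C 0, ho, hb, hne, hc, hα, hα1, le_max_right _ _, hunit, ?_, ?_, ?_⟩
  · intro Q hQ X hX
    -- A point beyond the tangent plane would make the segment towards it leave the closure at once,
    -- against convexity.
    by_contra hcon
    obtain ⟨i, s, δ, γ, K, hch⟩ := h.exists_chart hQ
    have hQb := Metric.mem_ball_self (x := Q) hch.pos
    have h1 := hch.eventually_notMem hQb hQ ((hch.inner_normal_pos_iff hQb hQ _).1 (not_le.1 hcon))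
    have h2 : ∀ᶠ t : ℝ in 𝓝[>] 0, t ∈ Ioo (0 : ℝ) 1 := Ioo_mem_nhdsGT one_pos
    obtain ⟨t, ht1, ht2⟩ := (h1.and h2).exists
    exact ht1 (hc.add_smul_sub_mem (frontier_subset_closure hQ) hX ⟨ht2.1.le, ht2.2.le⟩)
  · intro P hP Q hQ
    exact (hC (P, Q) ⟨hP, hQ⟩).trans (by gcongr; exact le_max_left _ _)
  · intro Q hQ v hv
    obtain ⟨i, s, δ, γ, K, hch⟩ := h.exists_chart hQ
    have hQb := Metric.mem_ball_self (x := Q) hch.pos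
    refine hch.eventually_mem hQb hQ ?_
    have h1 := (hch.inner_normal_pos_iff hQb hQ (-v)).1 (by rw [inner_neg_right]; linarith)
    rw [map_neg] at h1
    linarith


/-! ### Comparison of surface and plane area -/

lemma euclideanHausdorff_image_le {X : Type*} [EMetricSpace X] [MeasurableSpace X] [BorelSpace X]
    {Y : Type*} [EMetricSpace Y] [MeasurableSpace Y] [BorelSpace Y] {f : X → Y} {S : Set X}
    {K : ℝ≥0} (hf : LipschitzOnWith K f S) :
    (μHE[2] : Measure Y) (f '' S) ≤ (K : ℝ≥0∞) ^ 2 * (μHE[2] : Measure X) S := by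
  have h := hf.hausdorffMeasure_image_le (d := (2 : ℕ)) (by positivity)
  simp only [Measure.euclideanHausdorffMeasure_def, Measure.smul_apply, ENNReal.smul_def,
    smul_eq_mul]
  rw [ENNReal.rpow_natCast] at h
  calc _ ≤ _ * ((K : ℝ≥0∞) ^ 2 * μH[(2 : ℕ)] S) := by gcongr
    _ = _ := by ring

lemma volume_image_le {f : E3 → E2} {S : Set E3} {K : ℝ≥0}
    (hf : ∀ x ∈ S, ∀ y ∈ S, ‖f x - f y‖ ≤ K * ‖x - y‖) :
    volume (f '' S) ≤ (K : ℝ≥0∞) ^ 2 * μHE[2] S := by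
  rw [← EuclideanSpace.euclideanHausdorffMeasure_eq_volume]
  refine euclideanHausdorff_image_le (LipschitzOnWith.of_dist_le_mul fun x hx y hy => ?_)
  rw [dist_eq_norm, dist_eq_norm]
  exact hf x hx y hy

lemma le_volume_image {f : E3 → E2} {S : Set E3} {K : ℝ≥0}
    (hf : ∀ x ∈ S, ∀ y ∈ S, ‖x - y‖ ≤ K * ‖f x - f y‖) :
    μHE[2] S ≤ (K : ℝ≥0∞) ^ 2 * volume (f '' S) := by
  have hinj : InjOn f S := by
    intro x hx y hy hxy
    have := hf x hx y hy
    rw [hxy, sub_self, norm_zero, mul_zero] at this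
    exact sub_eq_zero.1 (norm_le_zero_iff.1 this)
  have hS : Function.invFunOn f S '' (f '' S) = S := hinj.leftInvOn_invFunOn.image_image
  rw [← EuclideanSpace.euclideanHausdorffMeasure_eq_volume]
  conv_lhs => rw [← hS]
  refine euclideanHausdorff_image_le (LipschitzOnWith.of_dist_le_mul ?_)
  rintro _ ⟨x, hx, rfl⟩ _ ⟨y, hy, rfl⟩
  rw [hinj.leftInvOn_invFunOn hx, hinj.leftInvOn_invFunOn hy, dist_eq_norm, dist_eq_norm]
  exact hf x hx y hy

/-- A linear map of the plane with `|shear p y|² = |y|² + ⟨p, y⟩²`. -/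
def shear (p : E2) : E2 →ₗ[ℝ] E2 :=
  LinearMap.transvection (innerSL ℝ p).toLinearMap ((1 + √(1 + ‖p‖ ^ 2))⁻¹ • p)

lemma shear_apply (p y : E2) : shear p y = y + (⟪p, y⟫ * (1 + √(1 + ‖p‖ ^ 2))⁻¹) • p := by
  simp [shear, LinearMap.transvection, smul_smul]

/-- Adding c⟨p, y⟩p to y changes the squared norm by (2c + c²|p|²)⟨p, y⟩², and c = (1 + √(1+|p|²))⁻¹
is the root of 2c + c²|p|² = 1. Thus the projection followed by `shear p` is an isometry on the
plane v_j = −⟨p, v'⟩. -/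
lemma norm_sq_shear (p y : E2) : ‖shear p y‖ ^ 2 = ‖y‖ ^ 2 + ⟪p, y⟫ ^ 2 := by
  have hr : √(1 + ‖p‖ ^ 2) ^ 2 = 1 + ‖p‖ ^ 2 := Real.sq_sqrt (by positivity)
  have h0 : 0 ≤ √(1 + ‖p‖ ^ 2) := Real.sqrt_nonneg _
  rw [shear_apply]
  generalize √(1 + ‖p‖ ^ 2) = r at hr h0 ⊢
  have h1 : 1 + r ≠ 0 := by positivity
  rw [norm_add_sq_real, real_inner_smul_right, norm_smul, mul_pow, Real.norm_eq_abs,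
    sq_abs, real_inner_comm]
  have : ‖p‖ ^ 2 = r ^ 2 - 1 := by linarith
  rw [this]
  field_simp
  ring

/-- This is the area factor of a plane of slope p over its projection. -/
lemma det_shear (p : E2) : LinearMap.det (shear p) = √(1 + ‖p‖ ^ 2) := by
  have hr : √(1 + ‖p‖ ^ 2) ^ 2 = 1 + ‖p‖ ^ 2 := Real.sq_sqrt (by positivity)
  have h0 : 0 ≤ √(1 + ‖p‖ ^ 2) := Real.sqrt_nonneg _
  rw [shear, LinearMap.transvection.det]
  generalize √(1 + ‖p‖ ^ 2) = r at hr h0 ⊢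
  have h1 : 1 + r ≠ 0 := by positivity
  simp only [ContinuousLinearMap.coe_coe, innerSL_apply_apply, real_inner_smul_right,
    real_inner_self_eq_norm_sq]
  have : ‖p‖ ^ 2 = r ^ 2 - 1 := by linarith
  rw [this]
  field_simp
  ring

/-- The difference of the two squared norms is v_j² − q² with q = ⟨p, v'⟩. Factor both sides and use
|v_j − q| ≤ ‖v‖ + ‖shear p v'‖. The right-hand side measures how far v is from the tangent plane, so
chords of a nearly flat piece are almost preserved. -/
lemma abs_norm_sub_norm_shear_le (j : Fin 3) (p : E2) (v : E3) :
    |‖v‖ - ‖shear p (dropCoord j v)‖| ≤ |v j + ⟪p, dropCoord j v⟫| := by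
  have h1 := norm_sq_coord j v
  have h2 := norm_sq_shear p (dropCoord j v)
  set a := ‖v‖
  set b := ‖shear p (dropCoord j v)‖
  set q := ⟪p, dropCoord j v⟫
  have ha : 0 ≤ a := norm_nonneg _
  have hb : 0 ≤ b := norm_nonneg _
  have hva : |v j| ≤ a := abs_coord_le v j
  have hqb : |q| ≤ b := abs_le_of_sq_le_sq (by nlinarith [norm_nonneg (dropCoord j v)]) hb
  have hprod : (a - b) * (a + b) = (v j + q) * (v j - q) := by nlinarith
  have habs : |a - b| * (a + b) ≤ |v j + q| * (a + b) := by
    rw [← abs_of_nonneg (add_nonneg ha hb), ← abs_mul, hprod, abs_mul, abs_of_nonneg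
      (add_nonneg ha hb)]
    gcongr
    exact (abs_sub _ _).trans (add_le_add hva hqb)
  rcases (add_nonneg ha hb).eq_or_lt' with h | h
  · have : a = 0 := by linarith
    have : b = 0 := by linarith
    simp [*]
  · exact le_of_mul_le_mul_right habs h

lemma exists_disjoint_cover {X : Type*} [TopologicalSpace X] [SecondCountableTopology X]
    [MeasurableSpace X] [BorelSpace X] {A : Set X} (hA : MeasurableSet A) {U : X → Set X}
    (hU : ∀ x ∈ A, IsOpen (U x)) (hxU : ∀ x ∈ A, x ∈ U x) :
    ∃ S : ℕ → Set X, (∀ k, MeasurableSet (S k)) ∧ Pairwise (Function.onFun Disjoint S) ∧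
      ⋃ k, S k = A ∧ ∀ k, (∃ x ∈ A, S k ⊆ U x) ∨ S k = ∅ := by
  rcases A.eq_empty_or_nonempty with rfl | hne
  · exact ⟨fun _ => ∅, by simp, fun i j _ => by simp [Function.onFun], by simp, by simp⟩
  obtain ⟨t, htA, htc, hcov⟩ := TopologicalSpace.countable_cover_nhdsWithin (s := A) (f := U)
    fun x hx => nhdsWithin_le_nhds ((hU x hx).mem_nhds (hxU x hx))
  have htne : t.Nonempty := by
    by_contra h
    rw [not_nonempty_iff_eq_empty] at h
    simp [h, hne.ne_empty] at hcov
  obtain ⟨e, he⟩ := htc.exists_eq_range htne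
  have heA : ∀ k, e k ∈ A := fun k => htA (he ▸ mem_range_self k)
  have hm : ∀ k, MeasurableSet (A ∩ U (e k)) := fun k =>
    hA.inter (hU _ (heA k)).measurableSet
  refine ⟨disjointed fun k => A ∩ U (e k), fun k => MeasurableSet.disjointed hm k,
    disjoint_disjointed _, ?_, fun k => Or.inl ⟨e k, heA k,
      (disjointed_le (fun k => A ∩ U (e k)) k).trans inter_subset_right⟩⟩
  rw [iUnion_disjointed]
  refine Subset.antisymm (iUnion_subset fun k => inter_subset_left) fun x hx => ?_
  have := hcov hx
  rw [he] at this
  simp only [mem_iUnion, mem_range, exists_prop] at this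
  obtain ⟨_, ⟨k, rfl⟩, hk⟩ := this
  exact mem_iUnion.2 ⟨k, hx, hk⟩

namespace HolderConvex

variable {Ω : Set E3} {n : E3 → E3} {α C : ℝ}

lemma continuousOn_normal (h : HolderConvex Ω n α C) : ContinuousOn n (frontier Ω) := by
  intro P hP
  rw [ContinuousWithinAt, tendsto_iff_norm_sub_tendsto_zero]
  have h1 : Tendsto (fun Q : E3 => C * ‖Q - P‖ ^ α) (𝓝[frontier Ω] P) (𝓝 0) := by
    have : Continuous fun Q : E3 => C * ‖Q - P‖ ^ α :=
      continuous_const.mul ((continuous_norm.comp (continuous_id.sub continuous_const)).rpow_const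
        fun _ => Or.inr h.alpha_pos.le)
    have h2 := (this.tendsto P).mono_left (nhdsWithin_le_nhds (s := frontier Ω))
    simpa [Real.zero_rpow h.alpha_pos.ne'] using h2
  refine squeeze_zero' (Eventually.of_forall fun _ => norm_nonneg _) ?_ h1
  filter_upwards [self_mem_nhdsWithin] with Q hQ using h.holder Q hQ P hP

lemma isCompact_frontier (h : HolderConvex Ω n α C) : IsCompact (frontier Ω) :=
  h.bounded.isCompact_closure.of_isClosed_subset isClosed_frontier frontier_subset_closure

/-- Supporting planes replace charts here: ⟨n_Q, P−Q⟩ ≤ 0 allows n_R to be replaced by n_R − n_Q,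
and exchanging P and Q gives the other sign. -/
lemma abs_inner_le (h : HolderConvex Ω n α C) {P Q R : E3} (hP : P ∈ frontier Ω)
    (hQ : Q ∈ frontier Ω) {ε : ℝ} (h1 : ‖n R - n P‖ ≤ ε) (h2 : ‖n R - n Q‖ ≤ ε) :
    |⟪n R, P - Q⟫| ≤ ε * ‖P - Q‖ := by
  have key : ∀ P ∈ frontier Ω, ∀ Q ∈ frontier Ω, ‖n R - n Q‖ ≤ ε →
      ⟪n R, P - Q⟫ ≤ ε * ‖P - Q‖ := by
    intro P hP Q hQ h2
    have e : ⟪n R, P - Q⟫ = ⟪n R - n Q, P - Q⟫ + ⟪n Q, P - Q⟫ := by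
      rw [inner_sub_left]; ring
    have := h.support Q hQ P (frontier_subset_closure hP)
    have h3 := real_inner_le_norm (n R - n Q) (P - Q)
    have : ‖n R - n Q‖ * ‖P - Q‖ ≤ ε * ‖P - Q‖ := by gcongr
    linarith
  rw [abs_le]
  refine ⟨?_, key P hP Q hQ h2⟩
  have := key Q hQ P hP h1
  rw [norm_sub_rev, ← neg_sub P Q, inner_neg_right] at this
  linarith

/-- The gain of α over the trivial estimate is what makes the double layer kernel weakly singular.
-/
lemma abs_inner_self_le (h : HolderConvex Ω n α C) {P Q : E3} (hP : P ∈ frontier Ω)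
    (hQ : Q ∈ frontier Ω) : |⟪n P, P - Q⟫| ≤ C * ‖P - Q‖ ^ α * ‖P - Q‖ :=
  h.abs_inner_le hP hQ (by have := h.const_nonneg; simp; positivity) (h.holder P hP Q hQ)

/-- The part of the boundary on which `s n_j > 0`. -/
def face (Ω : Set E3) (n : E3 → E3) (j : Fin 3) (s : ℝ) : Set E3 :=
  {Q | Q ∈ frontier Ω ∧ 0 < s * n Q j}

lemma measurableSet_face (h : HolderConvex Ω n α C) (j : Fin 3) (s : ℝ) :
    MeasurableSet (face Ω n j s) := by
  have hc : ContinuousOn (fun Q => s * n Q j) (frontier Ω) :=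
    continuousOn_const.mul ((EuclideanSpace.proj (𝕜 := ℝ) j).continuous.comp_continuousOn
      h.continuousOn_normal)
  obtain ⟨u, hu, hu'⟩ := continuousOn_iff'.1 hc (Ioi 0) isOpen_Ioi
  have : face Ω n j s = u ∩ frontier Ω := by
    rw [← hu']; ext Q; simp [face, and_comm]
  rw [this]
  exact hu.measurableSet.inter isClosed_frontier.measurableSet

/-- For two points on a line in direction e_j, the supporting planes at both of them force n_j to
have opposite signs there, unless the points coincide. -/
lemma injOn_face (h : HolderConvex Ω n α C) (j : Fin 3) (s : ℝ) :
    InjOn (dropCoord j) (face Ω n j s) := by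
  intro P hP Q hQ hPQ
  have key : ∀ R, dropCoord j R = 0 → ∀ v, ⟪v, R⟫ = v j * R j := by
    intro R hR v
    rw [inner_coord j, hR, inner_zero_right, add_zero]
  have hz : dropCoord j (Q - P) = 0 := by rw [dropCoord_sub, hPQ, sub_self]
  have h1 := h.support P hP.1 Q (frontier_subset_closure hQ.1)
  have h2 := h.support Q hQ.1 P (frontier_subset_closure hP.1)
  rw [← neg_sub, inner_neg_right, key _ hz] at h2
  rw [key _ hz] at h1
  have hs1 := hP.2
  have hs2 := hQ.2
  refine ext_coord j ?_ hPQ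
  have hd : (Q - P) j = Q j - P j := rfl
  by_contra hne
  have hd0 : (Q - P) j ≠ 0 := by rw [hd]; exact sub_ne_zero.2 (Ne.symm hne)
  have h3 : (s * n P j) * (s * n Q j) * ((Q - P) j) ^ 2 ≤ 0 := by
    have : (n P j * (Q - P) j) * (n Q j * (Q - P) j) ≤ 0 :=
      mul_nonpos_of_nonpos_of_nonneg h1 (by linarith)
    nlinarith [sq_nonneg s]
  have : 0 < (s * n P j) * (s * n Q j) * ((Q - P) j) ^ 2 := by positivity
  linarith

/-- With slope p = n'/n_j at Q₀, the map `shear p` after projection distorts chords of S by at most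
the factor 1 ± τ. It and its inverse are therefore Lipschitz with constants 1+τ and (1−τ)⁻¹. Its
determinant is 1/|n_j| because |n| = 1, which is where the weight |n_j| comes from. -/
lemma volume_image_local (h : HolderConvex Ω n α C) {j : Fin 3} {Q₀ : E3}
    (hQ : Q₀ ∈ frontier Ω) (h0 : n Q₀ j ≠ 0) {τ : ℝ} (hτ : 0 < τ) (hτ1 : τ < 1) {S : Set E3}
    (hS : ∀ Q ∈ S, Q ∈ frontier Ω ∧ ‖n Q₀ - n Q‖ ≤ τ * |n Q₀ j|) :
    volume (dropCoord j '' S) ≤ ENNReal.ofReal ((1 + τ) ^ 2) *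
        (ENNReal.ofReal |n Q₀ j| * μHE[2] S) ∧
      ENNReal.ofReal |n Q₀ j| * μHE[2] S ≤
        ENNReal.ofReal (((1 - τ)⁻¹) ^ 2) * volume (dropCoord j '' S) := by
  set ρ := |n Q₀ j| with hρ
  have hρ0 : 0 < ρ := abs_pos.2 h0
  set p : E2 := (n Q₀ j)⁻¹ • dropCoord j (n Q₀) with hp
  have hdet : LinearMap.det (shear p) = ρ⁻¹ := by
    rw [det_shear, Real.sqrt_eq_iff_mul_self_eq_of_pos (inv_pos.2 hρ0), hp, norm_smul, mul_pow,
      norm_inv, Real.norm_eq_abs]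
    have h1 := norm_sq_coord j (n Q₀)
    rw [h.unit Q₀ hQ, ← sq_abs (n Q₀ j)] at h1
    change ρ⁻¹ * ρ⁻¹ = 1 + ρ⁻¹ ^ 2 * _
    have h1 : ‖dropCoord j (n Q₀)‖ ^ 2 = 1 - ρ ^ 2 := by linarith
    rw [h1]
    field_simp
    ring
  have hdiff : ∀ P ∈ S, ∀ Q ∈ S,
      |‖P - Q‖ - ‖shear p (dropCoord j P) - shear p (dropCoord j Q)‖| ≤ τ * ‖P - Q‖ := by
    intro P hP Q hQ'
    rw [← map_sub, ← dropCoord_sub]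
    refine (abs_norm_sub_norm_shear_le j p (P - Q)).trans ?_
    have h1 := h.abs_inner_le (hS P hP).1 (hS Q hQ').1 (hS P hP).2 (hS Q hQ').2
    have h2 : ⟪n Q₀, P - Q⟫ = n Q₀ j * ((P - Q) j + ⟪p, dropCoord j (P - Q)⟫) := by
      rw [inner_coord j, hp, real_inner_smul_left]
      field_simp
    rw [h2, abs_mul, ← hρ] at h1
    have : ρ * |(P - Q) j + ⟪p, dropCoord j (P - Q)⟫| ≤ ρ * (τ * ‖P - Q‖) := by linarith
    exact le_of_mul_le_mul_left this hρ0
  have himg : (fun Q => shear p (dropCoord j Q)) '' S = shear p '' (dropCoord j '' S) := by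
    rw [image_image]
  have hvol : volume ((fun Q => shear p (dropCoord j Q)) '' S)
      = ENNReal.ofReal ρ⁻¹ * volume (dropCoord j '' S) := by
    rw [himg, Measure.addHaar_image_linearMap, hdet, abs_of_pos (inv_pos.2 hρ0)]
  have hcancel : ENNReal.ofReal ρ * ENNReal.ofReal ρ⁻¹ = 1 := by
    rw [← ENNReal.ofReal_mul hρ0.le, mul_inv_cancel₀ hρ0.ne', ENNReal.ofReal_one]
  constructor
  · have h1 := volume_image_le (f := fun Q => shear p (dropCoord j Q)) (S := S)
      (K := Real.toNNReal (1 + τ)) (fun P hP Q hQ' => by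
        have := (abs_le.1 (hdiff P hP Q hQ')).1
        rw [Real.coe_toNNReal _ (by positivity)]
        linarith)
    rw [hvol] at h1
    change _ ≤ ENNReal.ofReal (1 + τ) ^ 2 * _ at h1
    rw [← ENNReal.ofReal_pow (by positivity)] at h1
    calc volume (dropCoord j '' S)
        = ENNReal.ofReal ρ * (ENNReal.ofReal ρ⁻¹ * volume (dropCoord j '' S)) := by
          rw [← mul_assoc, hcancel, one_mul]
      _ ≤ ENNReal.ofReal ρ * (ENNReal.ofReal ((1 + τ) ^ 2) * μHE[2] S) := by gcongr
      _ = _ := by ring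
  · have h1 := le_volume_image (f := fun Q => shear p (dropCoord j Q)) (S := S)
      (K := Real.toNNReal (1 - τ)⁻¹) (fun P hP Q hQ' => by
        have := (abs_le.1 (hdiff P hP Q hQ')).2
        rw [Real.coe_toNNReal _ (inv_nonneg.2 (by linarith)), inv_mul_eq_div, le_div_iff₀ (by linarith)]
        linarith)
    rw [hvol] at h1
    change _ ≤ ENNReal.ofReal (1 - τ)⁻¹ ^ 2 * _ at h1
    rw [← ENNReal.ofReal_pow (inv_nonneg.2 (by linarith))] at h1
    calc ENNReal.ofReal ρ * μHE[2] S
        ≤ ENNReal.ofReal ρ * (ENNReal.ofReal ((1 - τ)⁻¹ ^ 2) *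
          (ENNReal.ofReal ρ⁻¹ * volume (dropCoord j '' S))) := by gcongr
      _ = (ENNReal.ofReal ρ * ENNReal.ofReal ρ⁻¹) * (ENNReal.ofReal ((1 - τ)⁻¹ ^ 2) *
          volume (dropCoord j '' S)) := by ring
      _ = _ := by rw [hcancel, one_mul]

/-- Cut A into countably many pieces on which the normal varies by at most τ|n_j|, use the local
comparison on each, and add up; injectivity of the projection keeps the images disjoint. Replacing
|n_j| by its value at one point costs another factor 1 ± τ, and τ → 0 gives equality. -/
lemma volume_image_eq (h : HolderConvex Ω n α C) (j : Fin 3) {s : ℝ}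
    {A : Set E3} (hA : MeasurableSet A) (hAf : A ⊆ face Ω n j s) :
    volume (dropCoord j '' A) = ∫⁻ Q in A, ENNReal.ofReal |n Q j| ∂μHE[2] := by
  have hnz : ∀ Q ∈ A, n Q j ≠ 0 := fun Q hQ h0 => by have := (hAf hQ).2; simp [h0] at this
  have main : ∀ τ : ℝ, 0 < τ → τ < 1 →
      volume (dropCoord j '' A) ≤ ENNReal.ofReal ((1 + τ) ^ 2 * (1 - τ)⁻¹) *
        (∫⁻ Q in A, ENNReal.ofReal |n Q j| ∂μHE[2]) ∧
      (∫⁻ Q in A, ENNReal.ofReal |n Q j| ∂μHE[2]) ≤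
        ENNReal.ofReal ((1 + τ) * (1 - τ)⁻¹ ^ 2) * volume (dropCoord j '' A) := by
    intro τ hτ hτ1
    have hτ1' : 0 < 1 - τ := by linarith
    have hUex : ∀ Q₀ ∈ A, ∃ U : Set E3, IsOpen U ∧ Q₀ ∈ U ∧
        ∀ Q ∈ U ∩ frontier Ω, ‖n Q₀ - n Q‖ ≤ τ * |n Q₀ j| := by
      intro Q₀ hQ₀
      have h1 := h.continuousOn_normal Q₀ (hAf hQ₀).1
      have h2 := Metric.tendsto_nhds.1 h1 (τ * |n Q₀ j|)
        (mul_pos hτ (abs_pos.2 (hnz Q₀ hQ₀)))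
      obtain ⟨U, hU, hU1, hU2⟩ := mem_nhdsWithin.1 h2
      exact ⟨U, hU, hU1, fun Q hQ => by
        have := hU2 hQ
        rw [mem_ofPred_eq, dist_eq_norm, norm_sub_rev] at this
        exact this.le⟩
    choose! U hUo hUm hU using hUex
    obtain ⟨S, hSm, hSd, hSA, hSU⟩ := exists_disjoint_cover hA hUo hUm
    have hSsub : ∀ k, S k ⊆ A := fun k => hSA ▸ subset_iUnion S k
    have hk : ∀ k, volume (dropCoord j '' S k) ≤ ENNReal.ofReal ((1 + τ) ^ 2 * (1 - τ)⁻¹) *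
        (∫⁻ Q in S k, ENNReal.ofReal |n Q j| ∂μHE[2]) ∧
      (∫⁻ Q in S k, ENNReal.ofReal |n Q j| ∂μHE[2]) ≤
        ENNReal.ofReal ((1 + τ) * (1 - τ)⁻¹ ^ 2) * volume (dropCoord j '' S k) := by
      intro k
      rcases hSU k with ⟨Q₀, hQ₀, hkU⟩ | hk
      swap
      · simp [hk]
      have hcl : ∀ Q ∈ S k, Q ∈ frontier Ω ∧ ‖n Q₀ - n Q‖ ≤ τ * |n Q₀ j| := fun Q hQ =>
        have hf := (hAf (hSsub k hQ)).1
        ⟨hf, hU Q₀ hQ₀ Q ⟨hkU hQ, hf⟩⟩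
      obtain ⟨h1, h2⟩ := h.volume_image_local (hAf hQ₀).1 (hnz Q₀ hQ₀) hτ hτ1 hcl
      have hval : ∀ Q ∈ S k, (1 - τ) * |n Q₀ j| ≤ |n Q j| ∧ |n Q j| ≤ (1 + τ) * |n Q₀ j| := by
        intro Q hQ
        have h3 := (abs_coord_le (n Q₀ - n Q) j).trans (hcl Q hQ).2
        have h4 := (abs_abs_sub_abs_le (n Q₀ j) (n Q j)).trans h3
        have h5 := abs_le.1 h4
        constructor <;> linarith [h5.1, h5.2]
      have hlow : ENNReal.ofReal ((1 - τ) * |n Q₀ j|) * μHE[2] (S k) ≤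
          ∫⁻ Q in S k, ENNReal.ofReal |n Q j| ∂μHE[2] := by
        rw [← setLIntegral_const]
        exact setLIntegral_mono' (hSm k) fun Q hQ => ENNReal.ofReal_le_ofReal (hval Q hQ).1
      have hup : (∫⁻ Q in S k, ENNReal.ofReal |n Q j| ∂μHE[2]) ≤
          ENNReal.ofReal ((1 + τ) * |n Q₀ j|) * μHE[2] (S k) := by
        rw [← setLIntegral_const]
        exact setLIntegral_mono' (hSm k) fun Q hQ => ENNReal.ofReal_le_ofReal (hval Q hQ).2
      constructor
      · refine h1.trans ?_
        calc ENNReal.ofReal ((1 + τ) ^ 2) * (ENNReal.ofReal |n Q₀ j| * μHE[2] (S k))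
            = ENNReal.ofReal ((1 + τ) ^ 2 * (1 - τ)⁻¹) *
              (ENNReal.ofReal ((1 - τ) * |n Q₀ j|) * μHE[2] (S k)) := by
              rw [← mul_assoc, ← mul_assoc, ← ENNReal.ofReal_mul (by positivity),
                ← ENNReal.ofReal_mul (by positivity)]
              congr 2
              field_simp
          _ ≤ _ := by gcongr
      · refine hup.trans ?_
        calc ENNReal.ofReal ((1 + τ) * |n Q₀ j|) * μHE[2] (S k)
            = ENNReal.ofReal (1 + τ) * (ENNReal.ofReal |n Q₀ j| * μHE[2] (S k)) := by
              rw [ENNReal.ofReal_mul (by positivity), mul_assoc]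
          _ ≤ ENNReal.ofReal (1 + τ) * (ENNReal.ofReal (((1 - τ)⁻¹) ^ 2) *
              volume (dropCoord j '' S k)) := by gcongr
          _ = _ := by rw [← mul_assoc, ← ENNReal.ofReal_mul (by positivity)]
    have hsum : (∫⁻ Q in A, ENNReal.ofReal |n Q j| ∂μHE[2])
        = ∑' k, ∫⁻ Q in S k, ENNReal.ofReal |n Q j| ∂μHE[2] := by
      rw [← hSA, lintegral_iUnion hSm hSd]
    have hinj : ∀ k, InjOn (dropCoord j) (S k) := fun k =>
      (h.injOn_face j s).mono ((hSsub k).trans hAf)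
    have hvsum : volume (dropCoord j '' A) = ∑' k, volume (dropCoord j '' S k) := by
      rw [← hSA, image_iUnion, measure_iUnion]
      · intro k l hkl
        rw [Function.onFun, disjoint_iff_inter_eq_empty,
          ← ((h.injOn_face j s).mono hAf).image_inter (hSsub k) (hSsub l),
          (hSd hkl).inter_eq, image_empty]
      · exact fun k => (hSm k).image_of_continuousOn_injOn (dropL j).continuous.continuousOn (hinj k)
    rw [hsum, hvsum, ← ENNReal.tsum_mul_left, ← ENNReal.tsum_mul_left]
    exact ⟨ENNReal.tsum_le_tsum fun k => (hk k).1, ENNReal.tsum_le_tsum fun k => (hk k).2⟩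
  have hlim : ∀ (f : ℝ → ℝ) (x : ℝ≥0∞), ContinuousAt f 0 → f 0 = 1 →
      Tendsto (fun τ => ENNReal.ofReal (f τ) * x) (𝓝[>] 0) (𝓝 x) := by
    intro f x hf h0
    have h1 : Tendsto (fun τ => ENNReal.ofReal (f τ)) (𝓝[>] 0) (𝓝 1) := by
      have := (ENNReal.continuous_ofReal.tendsto _).comp
        (hf.tendsto.mono_left (nhdsWithin_le_nhds (s := Ioi 0)))
      simpa [h0, Function.comp_def] using this
    simpa using ENNReal.Tendsto.mul_const h1 (Or.inl one_ne_zero)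
  have hev : ∀ᶠ τ : ℝ in 𝓝[>] 0, τ ∈ Ioo (0 : ℝ) 1 := Ioo_mem_nhdsGT one_pos
  have hinv : ContinuousAt (fun τ : ℝ => (1 - τ)⁻¹) 0 :=
    (continuousAt_const.sub continuousAt_id).inv₀ (by norm_num)
  refine le_antisymm ?_ ?_
  · refine ge_of_tendsto (hlim (fun τ => (1 + τ) ^ 2 * (1 - τ)⁻¹) _ ?_ (by norm_num)) ?_
    · exact ContinuousAt.mul (by fun_prop) hinv
    · filter_upwards [hev] with τ hτ using (main τ hτ.1 hτ.2).1
  · refine ge_of_tendsto (hlim (fun τ => (1 + τ) * (1 - τ)⁻¹ ^ 2) _ ?_ (by norm_num)) ?_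
    · exact ContinuousAt.mul (by fun_prop) (hinv.pow 2)
    · filter_upwards [hev] with τ hτ using (main τ hτ.1 hτ.2).2

end HolderConvex


/-! ### The surface measure -/

/-- The surface measure of the boundary. -/
abbrev surf (Ω : Set E3) : Measure E3 := (μHE[2]).restrict (frontier Ω)

namespace HolderConvex

variable {Ω : Set E3} {n : E3 → E3} {α C : ℝ}

lemma abs_coord_normal_le (h : HolderConvex Ω n α C) {P : E3} (hP : P ∈ frontier Ω) (j : Fin 3) :
    |n P j| ≤ 1 := h.unit P hP ▸ abs_coord_le (n P) j

lemma exists_half_le (h : HolderConvex Ω n α C) {P : E3} (hP : P ∈ frontier Ω) :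
    ∃ j, ∃ s ∈ ({1, -1} : Finset ℝ), 1 / 2 ≤ s * n P j := by
  by_contra! hc
  have h1 : ∀ j, (n P j) ^ 2 ≤ 1 / 4 := fun j => by
    have h2 := hc j 1 (by simp)
    have h3 := hc j (-1) (by simp)
    nlinarith
  have h2 := EuclideanSpace.norm_sq_eq (n P)
  rw [h.unit P hP, Fin.sum_univ_three] at h2
  simp only [Real.norm_eq_abs, sq_abs] at h2
  linarith [h1 0, h1 1, h1 2]

/-- The supporting planes at both points bound the height difference by 2d, where d is the distance
of the projections. So |P−Q|² ≤ 5d² ≤ (3d)². -/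
lemma norm_sub_le_of_half_le (h : HolderConvex Ω n α C) {P Q : E3} {j : Fin 3} {s : ℝ}
    (hs : s ∈ ({1, -1} : Finset ℝ)) (hP : P ∈ frontier Ω) (hQ : Q ∈ frontier Ω)
    (hP1 : 1 / 2 ≤ s * n P j) (hQ1 : 1 / 2 ≤ s * n Q j) :
    ‖P - Q‖ ≤ 3 * ‖dropCoord j P - dropCoord j Q‖ := by
  have hss : s * s = 1 := by
    simp only [Finset.mem_insert, Finset.mem_singleton] at hs
    rcases hs with rfl | rfl <;> norm_num
  have key : ∀ P Q : E3, P ∈ frontier Ω → Q ∈ frontier Ω → 1 / 2 ≤ s * n Q j →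
      s * (P j - Q j) ≤ 2 * ‖dropCoord j P - dropCoord j Q‖ := by
    intro P Q hP hQ hQ1
    have h1 := h.support Q hQ P (frontier_subset_closure hP)
    rw [inner_coord j, dropCoord_sub] at h1
    have h2 := abs_le.1 (abs_real_inner_le_norm (dropCoord j (n Q)) (dropCoord j P - dropCoord j Q))
    have h3 : ‖dropCoord j (n Q)‖ ≤ 1 := h.unit Q hQ ▸ norm_dropCoord_le j (n Q)
    have h4 : ‖dropCoord j (n Q)‖ * ‖dropCoord j P - dropCoord j Q‖
        ≤ 1 * ‖dropCoord j P - dropCoord j Q‖ := by gcongr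
    have h5 : (s * n Q j) * (s * (P j - Q j)) ≤ ‖dropCoord j P - dropCoord j Q‖ := by
      have : (s * n Q j) * (s * (P j - Q j)) = (s * s) * (n Q j * (P - Q) j) := by
        simp only [PiLp.sub_apply]; ring
      rw [this, hss, one_mul]
      linarith [h2.1]
    by_cases hc : s * (P j - Q j) ≤ 0
    · exact hc.trans (by positivity)
    · nlinarith
  have h1 := key P Q hP hQ hQ1
  have h2 := key Q P hQ hP hP1
  rw [norm_sub_rev (dropCoord j Q)] at h2
  set d := ‖dropCoord j P - dropCoord j Q‖ with hd
  have hd0 : 0 ≤ d := norm_nonneg _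
  have h3 : (P j - Q j) ^ 2 ≤ (2 * d) ^ 2 := by
    have : (P j - Q j) ^ 2 = (s * (P j - Q j)) ^ 2 := by
      have : (s * (P j - Q j)) ^ 2 = (s * s) * (P j - Q j) ^ 2 := by ring
      rw [this, hss, one_mul]
    rw [this]
    exact sq_le_sq' (by linarith) h1
  have h4 := norm_sq_coord j (P - Q)
  rw [dropCoord_sub, ← hd, PiLp.sub_apply] at h4
  exact abs_le_of_sq_le_sq' (by nlinarith) (by positivity) |>.2

/-- Quadratic growth of the surface measure. -/
lemma surf_closedBall_le (h : HolderConvex Ω n α C) (x : E3) (r : ℝ) :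
    surf Ω (Metric.closedBall x r) ≤ ENNReal.ofReal (54 * Real.pi * r ^ 2) := by
  rcases lt_or_ge r 0 with hr | hr
  · simp [Metric.closedBall_eq_empty.2 hr]
  let piece : Fin 3 → ℝ → Set E3 := fun j s =>
    {P | P ∈ frontier Ω ∧ 1 / 2 ≤ s * n P j} ∩ Metric.closedBall x r
  -- The projection of a piece lies in a disc of area πr² and has a 3-Lipschitz inverse, hence 9πr².
  -- Six pieces cover the boundary, which gives 54.
  have hpiece : ∀ j, ∀ s ∈ ({1, -1} : Finset ℝ),
      μHE[2] (piece j s) ≤ ENNReal.ofReal (9 * Real.pi * r ^ 2) := by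
    intro j s hs
    have h1 := le_volume_image (f := dropCoord j) (S := piece j s) (K := 3) fun P hP Q hQ =>
      h.norm_sub_le_of_half_le hs hP.1.1 hQ.1.1 hP.1.2 hQ.1.2
    have h2 : dropCoord j '' piece j s ⊆ Metric.closedBall (dropCoord j x) r := by
      rintro _ ⟨P, hP, rfl⟩
      have := hP.2
      rw [Metric.mem_closedBall, dist_eq_norm] at this ⊢
      rw [← dropCoord_sub]
      exact (norm_dropCoord_le _ _).trans this
    refine h1.trans ((mul_le_mul_right (measure_mono h2) _).trans ?_)
    rw [EuclideanSpace.volume_closedBall_fin_two, ← ENNReal.ofReal_pow hr]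
    have e1 : ((3 : ℝ≥0) : ℝ≥0∞) ^ 2 = ENNReal.ofReal 9 := by norm_num
    rw [e1, ← ENNReal.ofReal_mul (by positivity), ← ENNReal.ofReal_mul (by positivity)]
    exact ENNReal.ofReal_le_ofReal (by linarith)
  have hcov : Metric.closedBall x r ∩ frontier Ω ⊆
      ⋃ j ∈ (Finset.univ : Finset (Fin 3)), ⋃ s ∈ ({1, -1} : Finset ℝ), piece j s := by
    rintro P ⟨hP, hPf⟩
    obtain ⟨j, s, hs, hjs⟩ := h.exists_half_le hPf
    simp only [mem_iUnion]
    exact ⟨j, Finset.mem_univ j, s, hs, ⟨hPf, hjs⟩, hP⟩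
  rw [Measure.restrict_apply Metric.isClosed_closedBall.measurableSet]
  calc μHE[2] (Metric.closedBall x r ∩ frontier Ω)
      ≤ ∑ j ∈ (Finset.univ : Finset (Fin 3)), ∑ s ∈ ({1, -1} : Finset ℝ), μHE[2] (piece j s) :=
        (measure_mono hcov).trans ((measure_biUnion_finset_le _ _).trans
          (Finset.sum_le_sum fun j _ => measure_biUnion_finset_le _ _))
    _ ≤ ∑ j ∈ (Finset.univ : Finset (Fin 3)), ∑ s ∈ ({1, -1} : Finset ℝ),
          ENNReal.ofReal (9 * Real.pi * r ^ 2) :=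
        Finset.sum_le_sum fun j _ => Finset.sum_le_sum fun s hs => hpiece j s hs
    _ = ENNReal.ofReal (54 * Real.pi * r ^ 2) := by
        have hc : ({1, -1} : Finset ℝ).card = 2 := by
          rw [Finset.card_pair]; norm_num
        rw [Finset.sum_const, Finset.sum_const, hc, Finset.card_univ, Fintype.card_fin, smul_smul,
          nsmul_eq_mul, ← ENNReal.ofReal_natCast, ← ENNReal.ofReal_mul (by positivity)]
        congr 1
        push_cast
        ring

lemma isFiniteMeasure_surf (h : HolderConvex Ω n α C) : IsFiniteMeasure (surf Ω) := by
  obtain ⟨R, hR⟩ := h.isCompact_frontier.isBounded.subset_closedBall 0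
  refine ⟨?_⟩
  have : surf Ω univ = surf Ω (Metric.closedBall 0 R) := by
    rw [Measure.restrict_apply_univ,
      Measure.restrict_apply Metric.isClosed_closedBall.measurableSet, inter_eq_self_of_subset_right hR]
  rw [this]
  exact (h.surf_closedBall_le 0 R).trans_lt ENNReal.ofReal_lt_top

/-- An interior point can still be moved a little along n_Q, so the supporting inequality is strict.
-/
lemma inner_sub_neg (h : HolderConvex Ω n α C) {Q X : E3} (hQ : Q ∈ frontier Ω) (hX : X ∈ Ω) :
    ⟪n Q, X - Q⟫ < 0 := by
  have h1 : ∀ᶠ t : ℝ in 𝓝 0, X + t • n Q ∈ Ω :=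
    (IsGraphChart.tendsto_line X (n Q)).eventually (h.isOpen.mem_nhds hX)
  obtain ⟨t, ht, ht0⟩ := ((h1.filter_mono nhdsWithin_le_nhds).and
    (self_mem_nhdsWithin : Ioi (0 : ℝ) ∈ 𝓝[>] 0)).exists
  have h2 := h.support Q hQ _ (subset_closure ht)
  have e : X + t • n Q - Q = (X - Q) + t • n Q := by abel
  rw [e, inner_add_right, real_inner_smul_right, real_inner_self_eq_norm_sq, h.unit Q hQ] at h2
  have : (0 : ℝ) < t := ht0
  linarith

lemma inner_insCoord_sub (j : Fin 3) (s t : ℝ) (y : E2) (v : E3) :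
    ⟪v, insCoord j s y - insCoord j t y⟫ = v j * (s - t) := by
  rw [inner_coord j, dropCoord_sub]
  simp

lemma continuous_insCoord (j : Fin 3) : Continuous fun p : ℝ × E2 => insCoord j p.1 p.2 := by
  refine (PiLp.continuous_toLp 2 _).comp (continuous_pi fun k => ?_)
  rcases Fin.eq_self_or_eq_succAbove j k with rfl | ⟨l, rfl⟩
  · simpa using continuous_fst
  · simp only [Fin.insertNth_apply_succAbove]
    fun_prop

/-- The lines parallel to a coordinate axis meet the domain in intervals with end points on the
boundary. -/
lemma exists_fibre (h : HolderConvex Ω n α C) (j : Fin 3) {y : E2} (hy : y ∈ dropCoord j '' Ω) :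
    ∃ a b : ℝ, a < b ∧ insCoord j a y ∈ face Ω n j (-1) ∧ insCoord j b y ∈ face Ω n j 1 ∧
      ∀ t, insCoord j t y ∈ Ω ↔ t ∈ Ioo a b := by
  have hcont : Continuous fun t : ℝ => insCoord j t y :=
    (continuous_insCoord j).comp (Continuous.prodMk_left y)
  set T : Set ℝ := {t | insCoord j t y ∈ Ω} with hT
  have hTo : IsOpen T := h.isOpen.preimage hcont
  obtain ⟨X, hX, hXy⟩ := hy
  have hcT : X j ∈ T := by
    change insCoord j (X j) y ∈ Ω
    rwa [← hXy, insCoord_dropCoord]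
  set c := X j
  obtain ⟨R, hR⟩ := h.bounded.subset_closedBall 0
  have hTR : ∀ t ∈ T, |t| ≤ R := by
    intro t ht
    have h1 := hR ht
    rw [mem_closedBall_zero_iff] at h1
    simpa using (abs_coord_le (insCoord j t y) j).trans h1
  have hbd : BddAbove T := ⟨R, fun t ht => (abs_le.1 (hTR t ht)).2⟩
  have hbd' : BddBelow T := ⟨-R, fun t ht => (abs_le.1 (hTR t ht)).1⟩
  have hne : T.Nonempty := ⟨c, hcT⟩
  have hb : sSup T ∉ T := fun hm => by
    obtain ⟨ε, hε, hball⟩ := Metric.isOpen_iff.1 hTo _ hm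
    have : sSup T + ε / 2 ∈ T := hball (by simp [abs_of_pos hε, hε])
    linarith [le_csSup hbd this]
  have ha : sInf T ∉ T := fun hm => by
    obtain ⟨ε, hε, hball⟩ := Metric.isOpen_iff.1 hTo _ hm
    have : sInf T - ε / 2 ∈ T := hball (by simp [abs_of_pos hε, hε])
    linarith [csInf_le hbd' this]
  have hfr : ∀ t ∈ closure T, t ∉ T → insCoord j t y ∈ frontier Ω := by
    intro t ht htn
    rw [h.isOpen.frontier_eq]
    exact ⟨map_mem_closure (f := fun t => insCoord j t y) hcont ht fun s hs => hs, htn⟩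
  have hbf := hfr _ (csSup_mem_closure hne hbd) hb
  have haf := hfr _ (csInf_mem_closure hne hbd') ha
  have hcb : c < sSup T := lt_of_le_of_ne (le_csSup hbd hcT) fun e => hb (e ▸ hcT)
  have hac : sInf T < c := lt_of_le_of_ne (csInf_le hbd' hcT) fun e => ha (e ▸ hcT)
  have hnb := h.inner_sub_neg hbf hcT
  have hna := h.inner_sub_neg haf hcT
  rw [inner_insCoord_sub] at hnb hna
  refine ⟨sInf T, sSup T, hac.trans hcb, ⟨haf, by nlinarith⟩, ⟨hbf, by nlinarith⟩, fun t => ?_⟩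
  constructor
  · intro ht
    exact ⟨lt_of_le_of_ne (csInf_le hbd' ht) fun e => ha (e ▸ ht),
      lt_of_le_of_ne (le_csSup hbd ht) fun e => hb (e ▸ ht)⟩
  · rintro ⟨hat, htb⟩
    by_contra hcon
    have hcl : insCoord j t y ∈ closure Ω := by
      have hseg := h.convex (frontier_subset_closure haf) (frontier_subset_closure hbf)
        (a := (sSup T - t) / (sSup T - sInf T)) (b := (t - sInf T) / (sSup T - sInf T))
        (div_nonneg (by linarith) (by linarith)) (div_nonneg (by linarith) (by linarith))
        (by rw [← add_div, div_eq_one_iff_eq (by linarith)]; ring)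
      have hpos : sSup T - sInf T ≠ 0 := by linarith
      convert hseg using 1
      refine ext_coord j ?_ ?_
      · simp only [insCoord_same, PiLp.add_apply, PiLp.smul_apply, smul_eq_mul]
        field_simp
        ring
      · rw [← dropL_apply j (_ + _), map_add, map_smul, map_smul]
        simp only [dropL_apply, dropCoord_insCoord, ← add_smul, ← add_div]
        have : (sSup T - t + (t - sInf T)) / (sSup T - sInf T) = 1 := by
          rw [div_eq_one_iff_eq hpos]; ring
        rw [this, one_smul]
    -- Only the closure is known to be convex, so a boundary point strictly between the ends must be
    -- excluded. Its supporting plane has both ends on one side, which forces n_j = 0; but then it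
    -- also contains the interior point of the fibre.
    have hf : insCoord j t y ∈ frontier Ω := by
      rw [h.isOpen.frontier_eq]; exact ⟨hcl, hcon⟩
    have h1 := h.support _ hf _ (frontier_subset_closure haf)
    have h2 := h.support _ hf _ (frontier_subset_closure hbf)
    have h3 := h.inner_sub_neg hf hcT
    rw [inner_insCoord_sub] at h1 h2 h3
    have h4 : n (insCoord j t y) j = 0 := by
      refine le_antisymm ?_ ?_
      · by_contra hc'; nlinarith
      · by_contra hc'; nlinarith
    rw [h4, zero_mul] at h3
    exact lt_irrefl _ h3

lemma image_face (h : HolderConvex Ω n α C) (j : Fin 3) {s : ℝ} (hs : s = 1 ∨ s = -1) :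
    dropCoord j '' face Ω n j s = dropCoord j '' Ω := by
  refine Subset.antisymm ?_ ?_
  · rintro _ ⟨Q, hQ, rfl⟩
    have h1 := h.inward Q hQ.1 (-s • basisVec j) (by
      rw [real_inner_smul_right, inner_basisVec]; linarith [hQ.2])
    obtain ⟨t, ht⟩ := h1.exists
    refine ⟨_, ht, ?_⟩
    rw [← dropL_apply, map_add, map_smul, map_smul]
    simp
  · intro y hy
    obtain ⟨a, b, -, ha, hb, -⟩ := h.exists_fibre j hy
    rcases hs with rfl | rfl
    · exact ⟨_, hb, by simp⟩
    · exact ⟨_, ha, by simp⟩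

lemma isOpen_shadow (h : HolderConvex Ω n α C) (j : Fin 3) : IsOpen (dropCoord j '' Ω) :=
  (dropL j).isOpenMap (fun y => ⟨insCoord j 0 y, dropCoord_insCoord j 0 y⟩) Ω h.isOpen

/-- Boundary points near `Q` cover the shadow near the shadow of `Q`; in particular the surface
measure charges every neighbourhood of a boundary point. -/
lemma surf_ball_pos (h : HolderConvex Ω n α C) {Q : E3} (hQ : Q ∈ frontier Ω) {r : ℝ}
    (hr : 0 < r) : 0 < surf Ω (Metric.ball Q r) := by
  obtain ⟨j, s, hs, hjs⟩ := h.exists_half_le hQ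
  have hs' : s = 1 ∨ s = -1 := by simpa using hs
  have hss : s * s = 1 := by rcases hs' with rfl | rfl <;> norm_num
  have hin := h.inward Q hQ (-s • basisVec j) (by
      rw [real_inner_smul_right, inner_basisVec]; linarith)
  have hsm : ∀ᶠ t : ℝ in 𝓝[>] 0, t ∈ Ioo (0 : ℝ) (r / 4) := Ioo_mem_nhdsGT (by positivity)
  obtain ⟨t, htΩ, ht0, htr⟩ := (hin.and hsm).exists
  set X := Q + t • (-s • basisVec j) with hX
  have hXd : dropCoord j X = dropCoord j Q := by
    rw [hX, ← dropL_apply, map_add, map_smul, map_smul]; simp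
  have hXj : X j = Q j - t * s := by simp [hX]; ring
  obtain ⟨δ, hδ, hball⟩ := Metric.isOpen_iff.1 h.isOpen X htΩ
  set δ' := min δ (r / 8)
  have hδ' : 0 < δ' := lt_min hδ (by positivity)
  -- X lies in Ω just below Q in direction s e_j, and nearby fibres also meet Ω at the height of X.
  -- Such a fibre leaves Ω at a height c: the supporting plane at Q keeps c from being far above Q,
  -- and passing the height of X keeps it from being far below.
  have hsub : Metric.ball (dropCoord j Q) δ' ⊆
      dropCoord j '' (face Ω n j s ∩ Metric.ball Q r) := by
    intro y hy
    rw [Metric.mem_ball, dist_eq_norm] at hy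
    have hXy : insCoord j (X j) y ∈ Ω := by
      refine hball ?_
      rw [Metric.mem_ball, dist_eq_norm]
      have h1 := norm_sq_coord j (insCoord j (X j) y - X)
      rw [dropCoord_sub, dropCoord_insCoord, PiLp.sub_apply, insCoord_same, sub_self, hXd] at h1
      have h2 : ‖insCoord j (X j) y - X‖ = ‖y - dropCoord j Q‖ := by
        rw [← sq_eq_sq₀ (norm_nonneg _) (norm_nonneg _)]; linarith
      rw [h2]
      exact hy.trans_le (min_le_left _ _)
    obtain ⟨a, b, hab, ha, hb, hmem⟩ := h.exists_fibre (y := y) j ⟨_, hXy, dropCoord_insCoord _ _ _⟩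
    have hXab := (hmem _).1 hXy
    obtain ⟨c, hc, hcX⟩ : ∃ c, insCoord j c y ∈ face Ω n j s ∧ 0 < s * (c - X j) := by
      rcases hs' with rfl | rfl
      · exact ⟨b, hb, by linarith [hXab.2]⟩
      · exact ⟨a, ha, by linarith [hXab.1]⟩
    refine ⟨_, ⟨hc, ?_⟩, dropCoord_insCoord _ _ _⟩
    have hsup := h.support Q hQ _ (frontier_subset_closure hc.1)
    rw [inner_coord j, dropCoord_sub, dropCoord_insCoord, PiLp.sub_apply, insCoord_same] at hsup
    have h2 := abs_le.1 (abs_real_inner_le_norm (dropCoord j (n Q)) (y - dropCoord j Q))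
    have h3 : ‖dropCoord j (n Q)‖ ≤ 1 := h.unit Q hQ ▸ norm_dropCoord_le j (n Q)
    have h4 : ‖dropCoord j (n Q)‖ * ‖y - dropCoord j Q‖ ≤ 1 * ‖y - dropCoord j Q‖ := by gcongr
    have h5 : (s * n Q j) * (s * (c - Q j)) ≤ ‖y - dropCoord j Q‖ := by
      have : (s * n Q j) * (s * (c - Q j)) = (s * s) * (n Q j * (c - Q j)) := by ring
      rw [this, hss, one_mul]
      linarith [h2.1]
    have hy8 : ‖y - dropCoord j Q‖ < r / 8 := hy.trans_le (min_le_right _ _)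
    have hup : s * (c - Q j) ≤ r / 4 := by
      by_contra hcon
      nlinarith
    have hlow : -(r / 4) ≤ s * (c - Q j) := by
      have : s * (c - X j) = s * (c - Q j) + t * (s * s) := by rw [hXj]; ring
      rw [hss] at this
      linarith
    have habs : (c - Q j) ^ 2 ≤ (r / 4) ^ 2 := by
      have : (c - Q j) ^ 2 = (s * (c - Q j)) ^ 2 := by
        have : (s * (c - Q j)) ^ 2 = (s * s) * (c - Q j) ^ 2 := by ring
        rw [this, hss, one_mul]
      rw [this]
      exact sq_le_sq' hlow hup
    rw [Metric.mem_ball, dist_eq_norm]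
    have h6 := norm_sq_coord j (insCoord j c y - Q)
    rw [dropCoord_sub, dropCoord_insCoord, PiLp.sub_apply, insCoord_same] at h6
    have h7 : ‖y - dropCoord j Q‖ ^ 2 ≤ (r / 8) ^ 2 := by
      gcongr
    exact lt_of_pow_lt_pow_left₀ 2 hr.le (by nlinarith)
  have hm : MeasurableSet (face Ω n j s ∩ Metric.ball Q r) :=
    (h.measurableSet_face j s).inter Metric.isOpen_ball.measurableSet
  have h1 := h.volume_image_eq j hm inter_subset_left
  have h2 : 0 < volume (dropCoord j '' (face Ω n j s ∩ Metric.ball Q r)) :=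
    (Metric.measure_ball_pos volume _ hδ').trans_le (measure_mono hsub)
  have h3 : (∫⁻ P in face Ω n j s ∩ Metric.ball Q r, ENNReal.ofReal |n P j| ∂μHE[2])
      ≤ surf Ω (Metric.ball Q r) := by
    rw [Measure.restrict_apply Metric.isOpen_ball.measurableSet]
    calc _ ≤ ∫⁻ P in face Ω n j s ∩ Metric.ball Q r, 1 ∂μHE[2] :=
          setLIntegral_mono' hm fun P hP =>
            ENNReal.ofReal_le_one.2 (h.abs_coord_normal_le hP.1.1 j)
      _ = μHE[2] (face Ω n j s ∩ Metric.ball Q r) := by simp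
      _ ≤ _ := measure_mono (show face Ω n j s ∩ Metric.ball Q r ⊆ Metric.ball Q r ∩ frontier Ω from
          fun P hP => ⟨hP.2, hP.1.1⟩)
  exact (h1 ▸ h2).trans_le h3

end HolderConvex


/-! ### The divergence theorem -/

/-- Space as a product of a coordinate axis and the orthogonal plane. -/
def splitEquiv (j : Fin 3) : E3 ≃ᵐ ℝ × E2 :=
  (MeasurableEquiv.toLp 2 (Fin 3 → ℝ)).symm.trans
    ((MeasurableEquiv.piFinSuccAbove (fun _ => ℝ) j).trans
      ((MeasurableEquiv.refl ℝ).prodCongr (MeasurableEquiv.toLp 2 (Fin 2 → ℝ))))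

lemma splitEquiv_symm_apply (j : Fin 3) (p : ℝ × E2) :
    (splitEquiv j).symm p = insCoord j p.1 p.2 := rfl

lemma measurePreserving_splitEquiv (j : Fin 3) : MeasurePreserving (splitEquiv j) := by
  refine MeasurePreserving.trans (PiLp.volume_preserving_ofLp (Fin 3)) ?_
  refine MeasurePreserving.trans (volume_preserving_piFinSuccAbove (fun _ => ℝ) j) ?_
  exact (MeasurePreserving.id volume).prod (PiLp.volume_preserving_toLp (Fin 2))

namespace HolderConvex

variable {Ω : Set E3} {n : E3 → E3} {α C : ℝ} {V : Type*} [NormedAddCommGroup V] [NormedSpace ℝ V]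

/-- The weighted surface measure on the part of the boundary with `s n_j > 0`. -/
def faceMeasure (Ω : Set E3) (n : E3 → E3) (j : Fin 3) (s : ℝ) : Measure E3 :=
  ((μHE[2]).restrict (face Ω n j s)).withDensity fun P => ENNReal.ofReal |n P j|

lemma faceMeasure_apply (h : HolderConvex Ω n α C) (j : Fin 3) (s : ℝ) {T : Set E2}
    (hT : MeasurableSet T) :
    faceMeasure Ω n j s (dropCoord j ⁻¹' T) = volume (dropCoord j '' face Ω n j s ∩ T) := by
  have hT' : MeasurableSet (dropCoord j ⁻¹' T) := (dropL j).measurable hT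
  have e : dropCoord j '' face Ω n j s ∩ T =
      dropCoord j '' (dropCoord j ⁻¹' T ∩ face Ω n j s) := by
    rw [inter_comm, image_preimage_inter]
  rw [faceMeasure, withDensity_apply _ hT', Measure.restrict_restrict hT', e,
    h.volume_image_eq j (hT'.inter (h.measurableSet_face j s)) inter_subset_right]

lemma map_faceMeasure (h : HolderConvex Ω n α C) (j : Fin 3) {s : ℝ} (hs : s = 1 ∨ s = -1) :
    (faceMeasure Ω n j s).map (dropCoord j) = volume.restrict (dropCoord j '' Ω) := by
  ext T hT
  rw [Measure.map_apply (f := dropCoord j) (dropL j).measurable hT, h.faceMeasure_apply j s hT,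
    Measure.restrict_apply hT, h.image_face j hs, inter_comm]

lemma measurableEmbedding_face (h : HolderConvex Ω n α C) (j : Fin 3) (s : ℝ) :
    MeasurableEmbedding fun x : face Ω n j s => dropCoord j x :=
  ContinuousOn.measurableEmbedding (h.measurableSet_face j s) (dropL j).continuous.continuousOn
    (h.injOn_face j s)

/-- On the subtype the projection is a measurable embedding, so integrals can be transported without
any measurability of the integrand. -/
lemma restrict_shadow_eq_map (h : HolderConvex Ω n α C) (j : Fin 3) {s : ℝ}
    (hs : s = 1 ∨ s = -1) :
    (volume.restrict (dropCoord j '' Ω) : Measure E2) =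
      ((faceMeasure Ω n j s).comap ((↑) : face Ω n j s → E3)).map
        (fun x : face Ω n j s => dropCoord j x) := by
  have hm := h.measurableSet_face j s
  have e : (faceMeasure Ω n j s).restrict (face Ω n j s) = faceMeasure Ω n j s := by
    rw [faceMeasure, restrict_withDensity hm, Measure.restrict_restrict hm, inter_self]
  rw [← h.map_faceMeasure j hs]
  conv_lhs => rw [← e, ← map_comap_subtype_coe hm]
  rw [Measure.map_map (g := dropCoord j) (dropL j).measurable measurable_subtype_coe]
  rfl

lemma aemeasurable_abs_coord (h : HolderConvex Ω n α C) (j : Fin 3) (s : ℝ) :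
    AEMeasurable (fun P => ENNReal.ofReal |n P j|) ((μHE[2]).restrict (face Ω n j s)) := by
  have h1 : ContinuousOn (fun P => |n P j|) (frontier Ω) :=
    ((EuclideanSpace.proj (𝕜 := ℝ) j).continuous.comp_continuousOn h.continuousOn_normal).abs
  have h2 := h1.aemeasurable (μ := μHE[2]) isClosed_frontier.measurableSet
  exact (h2.mono_measure (Measure.restrict_mono (fun P hP => hP.1) le_rfl)).ennreal_ofReal

lemma integral_face (h : HolderConvex Ω n α C) (j : Fin 3) {s : ℝ} (hs : s = 1 ∨ s = -1)
    {F : E3 → V} {G : E2 → V} (hFG : ∀ P ∈ face Ω n j s, G (dropCoord j P) = F P) :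
    ∫ y in dropCoord j '' Ω, G y = ∫ P in face Ω n j s, |n P j| • F P ∂μHE[2] := by
  have hm := h.measurableSet_face j s
  rw [h.restrict_shadow_eq_map j hs, (h.measurableEmbedding_face j s).integral_map]
  have e : ∀ x : face Ω n j s, G (dropCoord j x) = F x := fun x => hFG x x.2
  simp_rw [e]
  rw [integral_subtype_comap hm, faceMeasure, restrict_withDensity hm,
    Measure.restrict_restrict hm, inter_self,
    integral_withDensity_eq_integral_toReal_smul₀ (h.aemeasurable_abs_coord j s)
      (ae_of_all _ fun P => ENNReal.ofReal_lt_top)]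
  simp

lemma integrableOn_face (h : HolderConvex Ω n α C) (j : Fin 3) {s : ℝ} (hs : s = 1 ∨ s = -1)
    {F : E3 → V} (hF : Continuous F) {G : E2 → V}
    (hFG : ∀ P ∈ face Ω n j s, G (dropCoord j P) = F P) :
    IntegrableOn G (dropCoord j '' Ω) := by
  have hm := h.measurableSet_face j s
  have := h.isFiniteMeasure_surf
  rw [IntegrableOn, h.restrict_shadow_eq_map j hs,
    (h.measurableEmbedding_face j s).integrable_map_iff]
  have e : G ∘ (fun x : face Ω n j s => dropCoord j x) = F ∘ ((↑) : face Ω n j s → E3) :=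
    funext fun x => hFG x x.2
  rw [e, ← (MeasurableEmbedding.subtype_coe hm).integrable_map_iff, map_comap_subtype_coe hm,
    faceMeasure, restrict_withDensity hm, Measure.restrict_restrict hm, inter_self,
    integrable_withDensity_iff_integrable_smul₀' (h.aemeasurable_abs_coord j s)
      (ae_of_all _ fun P => ENNReal.ofReal_lt_top)]
  have hcont : ContinuousOn (fun P => |n P j| • F P) (frontier Ω) :=
    ((EuclideanSpace.proj (𝕜 := ℝ) j).continuous.comp_continuousOn
      h.continuousOn_normal).abs.smul hF.continuousOn
  have hint : IntegrableOn (fun P => |n P j| • F P) (frontier Ω) (μHE[2]) := by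
    have hfin : (μHE[2] : Measure E3) (frontier Ω) < ∞ := by
      have := measure_lt_top (surf Ω) univ
      rwa [Measure.restrict_apply_univ] at this
    obtain ⟨B, hB⟩ := h.isCompact_frontier.exists_bound_of_continuousOn hcont
    exact IntegrableOn.of_bound hfin
      (hcont.aestronglyMeasurable_of_isCompact h.isCompact_frontier
        isClosed_frontier.measurableSet) B
      ((ae_restrict_iff' isClosed_frontier.measurableSet).2 (ae_of_all _ hB))
  refine (hint.mono_set fun P hP => hP.1).congr (ae_of_all _ fun P => ?_)
  simp

/-- The divergence theorem on a convex domain with Hölder continuous normal. -/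
theorem integral_fderiv_eq (h : HolderConvex Ω n α C) [CompleteSpace V] (j : Fin 3) {F : E3 → V}
    (hF : ContDiff ℝ 1 F) :
    ∫ X in Ω, fderiv ℝ F X (basisVec j) = ∫ P in frontier Ω, n P j • F P ∂μHE[2] := by
  classical
  choose! a b hab ha hb hmem using fun y hy => h.exists_fibre j (y := y) hy
  set W := dropCoord j '' Ω with hW
  have hder : Continuous fun X => fderiv ℝ F X (basisVec j) :=
    (hF.continuous_fderiv one_ne_zero).clm_apply continuous_const
  have hWm : MeasurableSet W := (h.isOpen_shadow j).measurableSet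
  have hinj := h.injOn_face j
  have htop : ∀ P ∈ face Ω n j 1, insCoord j (b (dropCoord j P)) (dropCoord j P) = P := by
    intro P hP
    have hPW : dropCoord j P ∈ W :=
      (h.image_face j (Or.inl rfl)).subset (mem_image_of_mem _ hP)
    exact hinj 1 (hb _ hPW) hP (by simp)
  have hbot : ∀ P ∈ face Ω n j (-1), insCoord j (a (dropCoord j P)) (dropCoord j P) = P := by
    intro P hP
    have hPW : dropCoord j P ∈ W :=
      (h.image_face j (Or.inr rfl)).subset (mem_image_of_mem _ hP)
    exact hinj (-1) (ha _ hPW) hP (by simp)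
  have hint : Integrable (Ω.indicator fun X => fderiv ℝ F X (basisVec j)) := by
    rw [integrable_indicator_iff h.isOpen.measurableSet]
    exact (hder.continuousOn.integrableOn_compact h.bounded.isCompact_closure).mono_set
      subset_closure
  have hmp := (measurePreserving_splitEquiv j).symm
  have hline : ∀ y t, HasDerivAt (fun t => F (insCoord j t y))
      (fderiv ℝ F (insCoord j t y) (basisVec j)) t := by
    intro y t
    have h1 : HasDerivAt (fun t => insCoord j t y) (basisVec j) t := by
      rw [hasDerivAt_euclideanSpace]
      intro k
      rcases Fin.eq_self_or_eq_succAbove j k with rfl | ⟨l, rfl⟩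
      · simpa using hasDerivAt_id' t
      · simpa [basisVec] using hasDerivAt_const t (y l)
    exact ((hF.differentiable one_ne_zero) _).hasFDerivAt.comp_hasDerivAt t h1
  have hfib : ∀ y, ∫ t, Ω.indicator (fun X => fderiv ℝ F X (basisVec j)) (insCoord j t y) =
      W.indicator (fun y => F (insCoord j (b y) y) - F (insCoord j (a y) y)) y := by
    intro y
    by_cases hy : y ∈ W
    · have e : (fun t => Ω.indicator (fun X => fderiv ℝ F X (basisVec j)) (insCoord j t y)) =
          (Ioo (a y) (b y)).indicator fun t => fderiv ℝ F (insCoord j t y) (basisVec j) := by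
        funext t
        simp only [indicator, hmem y hy t]
      have hc : Continuous fun t => fderiv ℝ F (insCoord j t y) (basisVec j) :=
        hder.comp ((continuous_insCoord j).comp (Continuous.prodMk_left y))
      rw [e, integral_indicator measurableSet_Ioo, ← integral_Ioc_eq_integral_Ioo,
        ← intervalIntegral.integral_of_le (hab y hy).le,
        intervalIntegral.integral_eq_sub_of_hasDerivAt (fun t _ => hline y t)
          (hc.intervalIntegrable _ _), indicator_of_mem hy]
    · rw [indicator_of_notMem hy]
      have : ∀ t, insCoord j t y ∉ Ω := fun t ht => hy ⟨_, ht, by simp⟩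
      simp [this]
  have hleft : ∫ X in Ω, fderiv ℝ F X (basisVec j) =
      ∫ y in W, (F (insCoord j (b y) y) - F (insCoord j (a y) y)) := by
    rw [← integral_indicator h.isOpen.measurableSet, ← hmp.integral_comp',
      Measure.volume_eq_prod, integral_prod_symm]
    · simp_rw [splitEquiv_symm_apply]
      rw [← integral_indicator hWm]
      exact integral_congr_ae (ae_of_all _ hfib)
    · exact (hmp.integrable_comp_emb (splitEquiv j).symm.measurableEmbedding).2 hint
  have hGt : ∀ P ∈ face Ω n j 1,
      (fun y => F (insCoord j (b y) y)) (dropCoord j P) = F P := fun P hP => by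
    simp only [htop P hP]
  have hGb : ∀ P ∈ face Ω n j (-1),
      (fun y => F (insCoord j (a y) y)) (dropCoord j P) = F P := fun P hP => by
    simp only [hbot P hP]
  rw [hleft, integral_sub (h.integrableOn_face j (Or.inl rfl) hF.continuous hGt)
    (h.integrableOn_face j (Or.inr rfl) hF.continuous hGb), h.integral_face j (Or.inl rfl) hGt,
    h.integral_face j (Or.inr rfl) hGb]
  have hm := h.measurableSet_face j
  have hsub : ∀ s, face Ω n j s ⊆ frontier Ω := fun s P hP => hP.1
  have h1 : ∀ s : ℝ, ∫ P in face Ω n j s, |n P j| • F P ∂μHE[2] =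
      ∫ P in frontier Ω, (face Ω n j s).indicator (fun P => |n P j| • F P) P ∂μHE[2] := by
    intro s
    rw [setIntegral_indicator (hm s), inter_eq_self_of_subset_right (hsub s)]
  have hfi : ∀ s : ℝ, IntegrableOn ((face Ω n j s).indicator fun P => |n P j| • F P) (frontier Ω)
      (μHE[2]) := by
    intro s
    have := h.isFiniteMeasure_surf
    have hcont : ContinuousOn (fun P => |n P j| • F P) (frontier Ω) :=
      ((EuclideanSpace.proj (𝕜 := ℝ) j).continuous.comp_continuousOn
        h.continuousOn_normal).abs.smul hF.continuous.continuousOn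
    obtain ⟨B, hB⟩ := h.isCompact_frontier.exists_bound_of_continuousOn hcont
    refine Integrable.indicator ?_ (hm s)
    exact Integrable.of_bound (hcont.aestronglyMeasurable_of_isCompact h.isCompact_frontier
        isClosed_frontier.measurableSet) B
      ((ae_restrict_iff' isClosed_frontier.measurableSet).2 (ae_of_all _ hB))
  rw [h1, h1, ← integral_sub (hfi 1) (hfi (-1))]
  -- Upper ends of fibres form the face n_j > 0 and lower ends the face n_j < 0, so the signs of the
  -- fundamental theorem of calculus turn |n_j| into n_j. Points with n_j = 0 lie on neither face
  -- and carry no weight.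
  refine setIntegral_congr_fun isClosed_frontier.measurableSet fun P hP => ?_
  rcases lt_trichotomy (n P j) 0 with hn | hn | hn
  · have h2 : P ∉ face Ω n j 1 := fun hc => by have := hc.2; linarith
    have h3 : P ∈ face Ω n j (-1) := ⟨hP, by linarith⟩
    simp [h2, h3, abs_of_neg hn]
  · have h2 : P ∉ face Ω n j 1 := fun hc => by have := hc.2; linarith
    have h3 : P ∉ face Ω n j (-1) := fun hc => by have := hc.2; linarith
    simp [h2, h3, hn]
  · have h2 : P ∈ face Ω n j 1 := ⟨hP, by linarith⟩
    have h3 : P ∉ face Ω n j (-1) := fun hc => by have := hc.2; linarith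
    simp [h2, h3, abs_of_pos hn]

end HolderConvex


/-! ### Weakly singular kernels -/

/-- At the origin the formula is a matter of default values: 1/(4π|x|) is unbounded there, hence not
differentiable, so the derivative is 0, and the quotient is 0 as well. -/
lemma fderiv_newton (x v : E3) :
    fderiv ℝ newton x v = -(⟪x, v⟫ / (4 * Real.pi * ‖x‖ ^ 3)) := by
  by_cases hx : x = 0
  · subst hx
    have hnd : ¬ DifferentiableAt ℝ newton (0 : E3) := by
      intro hd
      have h1 : Tendsto (fun x : E3 => ‖x‖ * newton x) (𝓝[≠] 0) (𝓝 (‖(0 : E3)‖ * newton 0)) :=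
        ((continuous_norm.tendsto 0).mul hd.continuousAt.tendsto).mono_left nhdsWithin_le_nhds
      have h2 : Tendsto (fun x : E3 => ‖x‖ * newton x) (𝓝[≠] 0) (𝓝 (1 / (4 * Real.pi))) := by
        refine tendsto_const_nhds.congr' ?_
        filter_upwards [self_mem_nhdsWithin] with x hx
        have : ‖x‖ ≠ 0 := norm_ne_zero_iff.2 hx
        rw [newton]
        field_simp
      have h3 := tendsto_nhds_unique h1 h2
      rw [norm_zero, zero_mul] at h3
      have : (0 : ℝ) < 1 / (4 * Real.pi) := by positivity
      linarith
    rw [fderiv_zero_of_not_differentiableAt hnd]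
    simp
  · have hx0 : ‖x‖ ≠ 0 := norm_ne_zero_iff.2 hx
    have h1 : HasFDerivAt (fun y : E3 => ‖y‖ ^ 2) (2 • innerSL ℝ x) x :=
      (hasStrictFDerivAt_norm_sq x).hasFDerivAt
    have h2 := (h1.sqrt (pow_ne_zero 2 hx0)).const_mul (4 * Real.pi)
    have h3 := (hasDerivAt_inv (x := 4 * Real.pi * √(‖x‖ ^ 2)) (by
      rw [Real.sqrt_sq (norm_nonneg x)]; positivity)).comp_hasFDerivAt x h2
    have h4 : newton = fun y : E3 => (4 * Real.pi * √(‖y‖ ^ 2))⁻¹ := by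
      funext y
      rw [newton, one_div, Real.sqrt_sq (norm_nonneg y)]
    have h5 := h3.fderiv
    simp only [Function.comp_def] at h5
    rw [h4, h5, Real.sqrt_sq (norm_nonneg x)]
    simp only [smul_apply, smul_eq_mul, nsmul_eq_mul, innerSL_apply_apply]
    push_cast
    field_simp

/-- The kernel of the normal derivative at `P` of the Newton potential. -/
def kern (n : E3 → E3) (P Y : E3) : ℝ := fderiv ℝ newton (P - Y) (n P)

lemma kern_eq (n : E3 → E3) (P Y : E3) :
    kern n P Y = -(⟪P - Y, n P⟫ / (4 * Real.pi * ‖P - Y‖ ^ 3)) := fderiv_newton _ _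

lemma measurable_kern (n : E3 → E3) (P : E3) : Measurable (kern n P) := by
  have : kern n P = fun Y => -(⟪P - Y, n P⟫ / (4 * Real.pi * ‖P - Y‖ ^ 3)) :=
    funext fun Y => kern_eq n P Y
  rw [this]
  have h1 : Measurable fun Y : E3 => P - Y := measurable_const.sub measurable_id
  exact ((h1.inner measurable_const).div ((h1.norm.pow_const 3).const_mul _)).neg

/-- A measure which grows at most like the `d`-th power of the radius. -/
def HasGrowth (μ : Measure E3) (K d : ℝ) : Prop :=
  ∀ x r, 0 < r → μ (Metric.closedBall x r) ≤ ENNReal.ofReal (K * r ^ d)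

/-- Decompose into dyadic shells: on the shell between radii ρ/2 and ρ the integrand is at most
(ρ/2)^(a−d), and the ball of radius ρ has measure at most Kρ^d. The result is a geometric series of
ratio 2^(−a). -/
lemma lintegral_rpow_closedBall_le {μ : Measure E3} {K d a : ℝ} (hμ : HasGrowth μ K d)
    (hK : 0 ≤ K) (ha : 0 < a) (had : a < d) (x : E3) {r : ℝ} (hr : 0 < r) :
    ∫⁻ y in Metric.closedBall x r, ENNReal.ofReal (‖x - y‖ ^ (a - d)) ∂μ ≤
      ENNReal.ofReal (K * 2 ^ (d - a) * (1 - 2 ^ (-a))⁻¹ * r ^ a) := by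
  have hρ : (2 : ℝ) ^ (-a) < 1 := Real.rpow_lt_one_of_one_lt_of_neg (by norm_num) (by linarith)
  have hρ0 : (0 : ℝ) < 2 ^ (-a) := by positivity
  set ρ : ℕ → ℝ := fun k => r * (1 / 2) ^ k with hρk
  have hρpos : ∀ k, 0 < ρ k := fun k => by positivity
  have hpt : ∀ y ∈ Metric.closedBall x r, ENNReal.ofReal (‖x - y‖ ^ (a - d)) ≤
      ∑' k, (Metric.closedBall x (ρ k)).indicator
        (fun _ => ENNReal.ofReal ((ρ (k + 1)) ^ (a - d))) y := by
    intro y hy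
    by_cases hxy : x = y
    · subst hxy
      -- The centre lies in no shell, but zero to a nonzero power is zero, so it needs no separate
      -- null set argument.
      rw [sub_self, norm_zero, Real.zero_rpow (by linarith), ENNReal.ofReal_zero]
      exact zero_le
    have hd : 0 < ‖x - y‖ := norm_pos_iff.2 (sub_ne_zero.2 hxy)
    rw [Metric.mem_closedBall, dist_comm, dist_eq_norm] at hy
    obtain ⟨k, hk1, hk2⟩ := exists_nat_pow_near_of_lt_one (x := ‖x - y‖ / r) (y := (1 / 2 : ℝ))
      (by positivity) (by rwa [div_le_one hr]) (by norm_num) (by norm_num)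
    rw [lt_div_iff₀ hr] at hk1
    rw [div_le_iff₀ hr] at hk2
    refine le_trans ?_ (ENNReal.le_tsum k)
    rw [indicator_of_mem (by
      rw [Metric.mem_closedBall, dist_comm, dist_eq_norm]; simp only [hρk]; linarith)]
    refine ENNReal.ofReal_le_ofReal ?_
    refine Real.rpow_le_rpow_of_nonpos (hρpos _) ?_ (by linarith)
    simp only [hρk]; linarith
  have hm : ∀ k, MeasurableSet (Metric.closedBall x (ρ k)) := fun k =>
    Metric.isClosed_closedBall.measurableSet
  calc ∫⁻ y in Metric.closedBall x r, ENNReal.ofReal (‖x - y‖ ^ (a - d)) ∂μ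
      ≤ ∫⁻ y in Metric.closedBall x r, ∑' k, (Metric.closedBall x (ρ k)).indicator
        (fun _ => ENNReal.ofReal ((ρ (k + 1)) ^ (a - d))) y ∂μ :=
        setLIntegral_mono' Metric.isClosed_closedBall.measurableSet hpt
    _ ≤ ∫⁻ y, ∑' k, (Metric.closedBall x (ρ k)).indicator
        (fun _ => ENNReal.ofReal ((ρ (k + 1)) ^ (a - d))) y ∂μ :=
        lintegral_mono' Measure.restrict_le_self le_rfl
    _ = ∑' k, ENNReal.ofReal ((ρ (k + 1)) ^ (a - d)) * μ (Metric.closedBall x (ρ k)) := by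
        rw [lintegral_tsum fun k => (measurable_const.indicator (hm k)).aemeasurable]
        refine tsum_congr fun k => ?_
        rw [lintegral_indicator_const (hm k)]
    _ ≤ ∑' k, ENNReal.ofReal (K * 2 ^ (d - a) * r ^ a * (2 ^ (-a)) ^ k) := by
        refine ENNReal.tsum_le_tsum fun k => ?_
        refine (mul_le_mul_right (hμ x (ρ k) (hρpos k)) _).trans ?_
        rw [← ENNReal.ofReal_mul (by have := hρpos (k + 1); positivity)]
        refine ENNReal.ofReal_le_ofReal (le_of_eq ?_)
        have e1 : ρ (k + 1) = ρ k * 2⁻¹ := by simp only [hρk]; ring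
        have e2 : (ρ k) ^ (a - d) * (ρ k) ^ d = (ρ k) ^ a := by
          rw [← Real.rpow_add (hρpos k)]; congr 1; ring
        have e3 : (2⁻¹ : ℝ) ^ (a - d) = 2 ^ (d - a) := by
          rw [Real.inv_rpow (by norm_num), ← Real.rpow_neg (by norm_num)]; congr 1; ring
        have e4 : (ρ k) ^ a = r ^ a * (2 ^ (-a)) ^ k := by
          simp only [hρk]
          rw [Real.mul_rpow hr.le (by positivity), Real.rpow_neg (by norm_num),
            ← Real.inv_rpow (by norm_num), ← Real.rpow_natCast, ← Real.rpow_natCast,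
            ← Real.rpow_mul (by norm_num), ← Real.rpow_mul (by norm_num), mul_comm a,
            one_div]
        rw [e1, Real.mul_rpow (hρpos k).le (by norm_num), e3]
        calc ρ k ^ (a - d) * 2 ^ (d - a) * (K * ρ k ^ d)
            = K * 2 ^ (d - a) * (ρ k ^ (a - d) * ρ k ^ d) := by ring
          _ = _ := by rw [e2, e4]; ring
    _ = ENNReal.ofReal (K * 2 ^ (d - a) * (1 - 2 ^ (-a))⁻¹ * r ^ a) := by
        rw [← ENNReal.ofReal_tsum_of_nonneg (fun k => by positivity)
          ((summable_geometric_of_lt_one hρ0.le hρ).mul_left _), tsum_mul_left,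
          tsum_geometric_of_lt_one hρ0.le hρ]
        congr 1
        ring

/-- A kernel on `S` which is weakly singular with respect to `μ`. -/
structure WeaklySingular (S : Set E3) (μ : Measure E3) (κ : E3 → E3 → ℝ) (K d a b : ℝ) : Prop where
  growth : HasGrowth μ K d
  const_nonneg : 0 ≤ K
  pos : 0 < a
  lt : a < d
  bound_nonneg : 0 ≤ b
  meas : ∀ P ∈ S, Measurable (κ P)
  bound : ∀ P ∈ S, ∀ᵐ Y ∂μ, |κ P Y| ≤ b * ‖P - Y‖ ^ (a - d)
  cont : ∀ P ∈ S, ∀ Y, Y ≠ P → ContinuousWithinAt (fun Q => κ Q Y) S P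

namespace WeaklySingular

variable {S : Set E3} {μ : Measure E3} {κ : E3 → E3 → ℝ} {K d a b : ℝ}

/-- The constant in the bound of the integral of the kernel over a ball. -/
def ballConst (K d a b : ℝ) : ℝ := b * (K * 2 ^ (d - a) * (1 - 2 ^ (-a))⁻¹)

lemma ballConst_nonneg (h : WeaklySingular S μ κ K d a b) : 0 ≤ ballConst K d a b := by
  have hρ : (2 : ℝ) ^ (-a) < 1 :=
    Real.rpow_lt_one_of_one_lt_of_neg (by norm_num) (by linarith [h.pos])
  have := h.const_nonneg
  have := h.bound_nonneg
  have : 0 ≤ (1 - (2 : ℝ) ^ (-a))⁻¹ := inv_nonneg.2 (by linarith)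
  unfold ballConst
  positivity

lemma lintegral_closedBall_le (h : WeaklySingular S μ κ K d a b) {P : E3} (hP : P ∈ S) {r : ℝ}
    (hr : 0 < r) :
    ∫⁻ Y in Metric.closedBall P r, ‖κ P Y‖ₑ ∂μ ≤ ENNReal.ofReal (ballConst K d a b * r ^ a) := by
  have h1 : ∫⁻ Y in Metric.closedBall P r, ‖κ P Y‖ₑ ∂μ ≤
      ∫⁻ Y in Metric.closedBall P r, ENNReal.ofReal b * ENNReal.ofReal (‖P - Y‖ ^ (a - d)) ∂μ := by
    refine lintegral_mono_ae (ae_restrict_of_ae ?_)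
    filter_upwards [h.bound P hP] with Y hY
    rw [← ENNReal.ofReal_mul h.bound_nonneg, Real.enorm_eq_ofReal_abs]
    exact ENNReal.ofReal_le_ofReal hY
  refine h1.trans ?_
  rw [lintegral_const_mul' _ _ ENNReal.ofReal_ne_top]
  refine (mul_le_mul_right
    (lintegral_rpow_closedBall_le h.growth h.const_nonneg h.pos h.lt P hr) _).trans ?_
  rw [← ENNReal.ofReal_mul h.bound_nonneg, ballConst]
  refine ENNReal.ofReal_le_ofReal (le_of_eq (by ring))

lemma abs_le_of_le (h : WeaklySingular S μ κ K d a b) {P : E3} (hP : P ∈ S) {r : ℝ}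
    (hr : 0 < r) : ∀ᵐ Y ∂μ, r ≤ ‖P - Y‖ → |κ P Y| ≤ b * r ^ (a - d) := by
  filter_upwards [h.bound P hP] with Y hY hr'
  refine hY.trans (mul_le_mul_of_nonneg_left ?_ h.bound_nonneg)
  exact Real.rpow_le_rpow_of_nonpos hr hr' (by linarith [h.lt])

/-- A bound of `∫ |κ P Y| dμ(Y)`. -/
def totalConst (μ : Measure E3) (K d a b : ℝ) : ℝ := ballConst K d a b + b * μ.real univ

lemma lintegral_le (h : WeaklySingular S μ κ K d a b) [IsFiniteMeasure μ] {P : E3} (hP : P ∈ S) :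
    ∫⁻ Y, ‖κ P Y‖ₑ ∂μ ≤ ENNReal.ofReal (totalConst μ K d a b) := by
  rw [← lintegral_add_compl _ (Metric.isClosed_closedBall (x := P) (ε := 1)).measurableSet,
    totalConst, ENNReal.ofReal_add h.ballConst_nonneg
      (mul_nonneg h.bound_nonneg measureReal_nonneg)]
  refine add_le_add ?_ ?_
  · simpa using h.lintegral_closedBall_le hP one_pos
  · calc ∫⁻ Y in (Metric.closedBall P 1)ᶜ, ‖κ P Y‖ₑ ∂μ
        ≤ ∫⁻ Y in (Metric.closedBall P 1)ᶜ, ENNReal.ofReal b ∂μ := by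
          refine lintegral_mono_ae ((ae_restrict_iff'
            (Metric.isClosed_closedBall.measurableSet.compl)).2 ?_)
          filter_upwards [h.abs_le_of_le hP one_pos] with Y hY hYm
          rw [mem_compl_iff, Metric.mem_closedBall, dist_comm, dist_eq_norm, not_le] at hYm
          rw [Real.enorm_eq_ofReal_abs]
          exact ENNReal.ofReal_le_ofReal (by simpa using hY hYm.le)
      _ ≤ ENNReal.ofReal b * μ univ := by
          rw [setLIntegral_const]; gcongr; exact subset_univ _
      _ = _ := by
          rw [ENNReal.ofReal_mul h.bound_nonneg, measureReal_def,
            ENNReal.ofReal_toReal (measure_ne_top _ _)]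

lemma integrable (h : WeaklySingular S μ κ K d a b) [IsFiniteMeasure μ] {P : E3} (hP : P ∈ S) :
    Integrable (κ P) μ :=
  ⟨(h.meas P hP).aestronglyMeasurable, (h.lintegral_le hP).trans_lt ENNReal.ofReal_lt_top⟩

/-- Weakly singular kernels depend continuously on the first variable in `L¹`. -/
lemma tendsto_lintegral_sub (h : WeaklySingular S μ κ K d a b) [IsFiniteMeasure μ] {P₀ : E3}
    (hP₀ : P₀ ∈ S) :
    Tendsto (fun P => ∫⁻ Y, ‖κ P Y - κ P₀ Y‖ₑ ∂μ) (𝓝[S] P₀) (𝓝 0) := by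
  have hball : ∀ r : ℝ, 0 < r → ∀ᶠ P in 𝓝[S] P₀, P ∈ S ∧ ‖P - P₀‖ < r := by
    intro r hr
    filter_upwards [self_mem_nhdsWithin, nhdsWithin_le_nhds (Metric.ball_mem_nhds P₀ hr)] with P h1 h2
    exact ⟨h1, by rwa [Metric.mem_ball, dist_eq_norm] at h2⟩
  rw [ENNReal.tendsto_nhds_zero]
  intro ε hε
  -- the part near the singularity
  obtain ⟨r, hr, hrε⟩ : ∃ r : ℝ, 0 < r ∧
      ENNReal.ofReal (ballConst K d a b * (2 * r) ^ a) + ENNReal.ofReal (ballConst K d a b * r ^ a)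
        < ε / 2 := by
    have hc : Continuous fun r : ℝ => ENNReal.ofReal (ballConst K d a b * (2 * r) ^ a) +
        ENNReal.ofReal (ballConst K d a b * r ^ a) := by
      have h1 : Continuous fun r : ℝ => r ^ a := Real.continuous_rpow_const h.pos.le
      exact (ENNReal.continuous_ofReal.comp (continuous_const.mul
        (h1.comp (continuous_const.mul continuous_id)))).add
        (ENNReal.continuous_ofReal.comp (continuous_const.mul h1))
    have h0 := hc.tendsto 0
    simp only [mul_zero, Real.zero_rpow h.pos.ne', ENNReal.ofReal_zero, add_zero] at h0
    have h2 := (h0.mono_left (nhdsWithin_le_nhds (s := Ioi 0))).eventually_lt_const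
      (ENNReal.half_pos hε.ne')
    obtain ⟨r, hr1, hr2⟩ := (h2.and self_mem_nhdsWithin).exists
    exact ⟨r, hr2, hr1⟩
  have hmB : MeasurableSet (Metric.closedBall P₀ r) := Metric.isClosed_closedBall.measurableSet
  -- the part away from the singularity
  have hfar : Tendsto (fun P => ∫⁻ Y in (Metric.closedBall P₀ r)ᶜ, ‖κ P Y - κ P₀ Y‖ₑ ∂μ)
      (𝓝[S] P₀) (𝓝 0) := by
    have h1 := tendsto_lintegral_filter_of_dominated_convergence
      (μ := μ.restrict (Metric.closedBall P₀ r)ᶜ) (l := 𝓝[S] P₀)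
      (F := fun P Y => ‖κ P Y - κ P₀ Y‖ₑ) (f := fun _ => 0)
      (fun _ => ENNReal.ofReal (2 * (b * (r / 2) ^ (a - d)))) ?_ ?_ ?_ ?_
    · simpa using h1
    · filter_upwards [self_mem_nhdsWithin] with P hP
      exact ((h.meas P hP).sub (h.meas P₀ hP₀)).enorm
    · filter_upwards [hball (r / 2) (by positivity)] with P hP
      refine (ae_restrict_iff' hmB.compl).2 ?_
      filter_upwards [h.abs_le_of_le hP.1 (half_pos hr), h.abs_le_of_le hP₀ (half_pos hr)]
        with Y h1 h2 hY
      rw [mem_compl_iff, Metric.mem_closedBall, dist_comm, dist_eq_norm, not_le] at hY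
      rw [Real.enorm_eq_ofReal_abs]
      refine ENNReal.ofReal_le_ofReal ?_
      have h3 : r / 2 ≤ ‖P - Y‖ := by
        have := norm_sub_norm_le (P₀ - Y) (P₀ - P)
        rw [sub_sub_sub_cancel_left, norm_sub_rev P₀ P] at this
        linarith [hP.2]
      have h4 := h1 h3
      have h5 := h2 (by linarith)
      have := abs_sub (κ P Y) (κ P₀ Y)
      linarith
    · rw [lintegral_const]
      exact ENNReal.mul_ne_top ENNReal.ofReal_ne_top (measure_ne_top _ _)
    · refine (ae_restrict_iff' hmB.compl).2 (ae_of_all _ fun Y hY => ?_)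
      have hne : Y ≠ P₀ := fun e => hY (e ▸ Metric.mem_closedBall_self hr.le)
      have h1 := ((h.cont P₀ hP₀ Y hne).tendsto.sub
        (tendsto_const_nhds (x := κ P₀ Y))).enorm
      simpa using h1
  filter_upwards [(ENNReal.tendsto_nhds_zero.1 hfar) (ε / 2) (ENNReal.half_pos hε.ne'),
    hball r hr] with P hP1 hP2
  rw [← lintegral_add_compl _ hmB, ← ENNReal.add_halves ε]
  refine add_le_add ?_ hP1
  have hsub : Metric.closedBall P₀ r ⊆ Metric.closedBall P (2 * r) := by
    intro Y hY
    rw [Metric.mem_closedBall, dist_eq_norm] at hY ⊢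
    have := norm_sub_le_norm_sub_add_norm_sub Y P₀ P
    rw [norm_sub_rev P₀ P] at this
    linarith [hP2.2]
  calc ∫⁻ Y in Metric.closedBall P₀ r, ‖κ P Y - κ P₀ Y‖ₑ ∂μ
      ≤ ∫⁻ Y in Metric.closedBall P₀ r, (‖κ P Y‖ₑ + ‖κ P₀ Y‖ₑ) ∂μ :=
        lintegral_mono fun Y => enorm_sub_le
    _ = ∫⁻ Y in Metric.closedBall P₀ r, ‖κ P Y‖ₑ ∂μ +
        ∫⁻ Y in Metric.closedBall P₀ r, ‖κ P₀ Y‖ₑ ∂μ :=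
        lintegral_add_left (h.meas P hP2.1).enorm _
    _ ≤ ∫⁻ Y in Metric.closedBall P (2 * r), ‖κ P Y‖ₑ ∂μ +
        ∫⁻ Y in Metric.closedBall P₀ r, ‖κ P₀ Y‖ₑ ∂μ := by
        gcongr
    _ ≤ _ := add_le_add (h.lintegral_closedBall_le hP2.1 (by positivity))
        (h.lintegral_closedBall_le hP₀ hr)
    _ ≤ ε / 2 := hrε.le

lemma integrable_mul (h : WeaklySingular S μ κ K d a b) [IsFiniteMeasure μ] {P : E3} (hP : P ∈ S)
    {φ : E3 → ℝ} (hφ : AEStronglyMeasurable φ μ) {B : ℝ} (hB : ∀ᵐ Y ∂μ, |φ Y| ≤ B) :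
    Integrable (fun Y => κ P Y * φ Y) μ := by
  refine (h.integrable hP).mul_bdd (c := B) hφ ?_
  simpa using hB

lemma abs_integral_le (h : WeaklySingular S μ κ K d a b) [IsFiniteMeasure μ] {P : E3} (hP : P ∈ S)
    {φ : E3 → ℝ} {B : ℝ} (hB0 : 0 ≤ B) (hB : ∀ᵐ Y ∂μ, |φ Y| ≤ B) :
    |∫ Y, κ P Y * φ Y ∂μ| ≤ totalConst μ K d a b * B := by
  have h1 : |∫ Y, κ P Y * φ Y ∂μ| ≤ ∫ Y, |κ P Y| * B ∂μ := by
    rw [← Real.norm_eq_abs]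
    refine norm_integral_le_of_norm_le ((h.integrable hP).abs.mul_const B) ?_
    filter_upwards [hB] with Y hY
    rw [norm_mul, Real.norm_eq_abs, Real.norm_eq_abs]
    gcongr
  refine h1.trans ?_
  rw [integral_mul_const]
  gcongr
  have h2 := h.lintegral_le hP
  rw [← ofReal_integral_norm_eq_lintegral_enorm (h.integrable hP)] at h2
  refine (ENNReal.ofReal_le_ofReal_iff ?_).1 h2
  exact add_nonneg h.ballConst_nonneg (mul_nonneg h.bound_nonneg measureReal_nonneg)

/-- The modulus of continuity of the integral operator. -/
lemma abs_integral_sub_le (h : WeaklySingular S μ κ K d a b) [IsFiniteMeasure μ] {P P₀ : E3}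
    (hP : P ∈ S) (hP₀ : P₀ ∈ S) {φ : E3 → ℝ} (hφ : AEStronglyMeasurable φ μ) {B : ℝ}
    (hB : ∀ᵐ Y ∂μ, |φ Y| ≤ B) :
    |∫ Y, κ P Y * φ Y ∂μ - ∫ Y, κ P₀ Y * φ Y ∂μ| ≤
      (∫⁻ Y, ‖κ P Y - κ P₀ Y‖ₑ ∂μ).toReal * B := by
  have hi : Integrable (fun Y => κ P Y - κ P₀ Y) μ := (h.integrable hP).sub (h.integrable hP₀)
  rw [← integral_sub (h.integrable_mul hP hφ hB) (h.integrable_mul hP₀ hφ hB),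
    ← integral_norm_eq_lintegral_enorm hi.aestronglyMeasurable, ← integral_mul_const]
  rw [← Real.norm_eq_abs]
  refine norm_integral_le_of_norm_le (hi.norm.mul_const B) ?_
  filter_upwards [hB] with Y hY
  rw [← sub_mul, norm_mul]
  gcongr
  exact hY

lemma continuousOn_integral (h : WeaklySingular S μ κ K d a b) [IsFiniteMeasure μ]
    {φ : E3 → ℝ} (hφ : AEStronglyMeasurable φ μ) {B : ℝ}
    (hB : ∀ᵐ Y ∂μ, |φ Y| ≤ B) : ContinuousOn (fun P => ∫ Y, κ P Y * φ Y ∂μ) S := by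
  intro P₀ hP₀
  rw [ContinuousWithinAt, tendsto_iff_norm_sub_tendsto_zero]
  have h1 : Tendsto (fun P => (∫⁻ Y, ‖κ P Y - κ P₀ Y‖ₑ ∂μ).toReal * B) (𝓝[S] P₀) (𝓝 0) := by
    have := ((ENNReal.tendsto_toReal ENNReal.zero_ne_top).comp
      (h.tendsto_lintegral_sub hP₀)).mul_const B
    simpa using this
  refine squeeze_zero' (Eventually.of_forall fun _ => norm_nonneg _) ?_ h1
  filter_upwards [self_mem_nhdsWithin] with P hP
  exact h.abs_integral_sub_le hP hP₀ hφ hB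

end WeaklySingular


/-! ### The normal derivative of the Newton potential on the boundary -/

/-- The kernel whose integral over space is independent of `η`. -/
def radialKernel (η r : ℝ) : ℝ := 3 * η ^ 2 * ((√(r ^ 2 + η ^ 2))⁻¹) ^ 5

lemma hasDerivAt_inv_sqrt {η : ℝ} (hη : 0 < η) (r : ℝ) :
    HasDerivAt (fun r : ℝ => (√(r ^ 2 + η ^ 2))⁻¹) (-r * ((√(r ^ 2 + η ^ 2))⁻¹) ^ 3) r := by
  have hp : 0 < r ^ 2 + η ^ 2 := by positivity
  have hs : 0 < √(r ^ 2 + η ^ 2) := Real.sqrt_pos.2 hp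
  have h1 : HasDerivAt (fun r : ℝ => r ^ 2 + η ^ 2) (2 * r) r := by
    simpa using (hasDerivAt_pow 2 r).add_const (η ^ 2)
  refine ((h1.sqrt hp.ne').inv hs.ne').congr_deriv ?_
  generalize √(r ^ 2 + η ^ 2) = s at *
  field_simp

/-- Up to the factor 4π the primitive is the flux of x(|x|²+η²)^(−3/2) through the sphere of radius
r, and `radialKernel` is the divergence of this field. The flux through large spheres tends to 4π
for every η. -/
lemma hasDerivAt_radial {η : ℝ} (hη : 0 < η) (r : ℝ) :
    HasDerivAt (fun r : ℝ => r ^ 3 * ((√(r ^ 2 + η ^ 2))⁻¹) ^ 3) (r ^ 2 * radialKernel η r) r := by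
  have hp : 0 < r ^ 2 + η ^ 2 := by positivity
  have hs : 0 < √(r ^ 2 + η ^ 2) := Real.sqrt_pos.2 hp
  have hsq : √(r ^ 2 + η ^ 2) ^ 2 = r ^ 2 + η ^ 2 := Real.sq_sqrt hp.le
  have h1 := (hasDerivAt_pow 3 r).mul ((hasDerivAt_inv_sqrt hη r).pow 3)
  refine h1.congr_deriv ?_
  simp only [radialKernel, Pi.pow_apply]
  generalize √(r ^ 2 + η ^ 2) = s at *
  have : η ^ 2 = s ^ 2 - r ^ 2 := by linarith
  rw [this]
  push_cast
  field_simp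
  ring

lemma radialKernel_nonneg (η r : ℝ) : 0 ≤ radialKernel η r := by
  unfold radialKernel; positivity

lemma tendsto_radial {η : ℝ} (hη : 0 < η) :
    Tendsto (fun r : ℝ => r ^ 3 * ((√(r ^ 2 + η ^ 2))⁻¹) ^ 3) atTop (𝓝 1) := by
  have h1 : Tendsto (fun r : ℝ => (√(1 + η ^ 2 / r ^ 2))⁻¹ ^ 3) atTop (𝓝 ((√(1 + 0))⁻¹ ^ 3)) := by
    have h2 : Tendsto (fun r : ℝ => 1 + η ^ 2 / r ^ 2) atTop (𝓝 (1 + 0)) :=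
      tendsto_const_nhds.add (tendsto_const_nhds.div_atTop (tendsto_pow_atTop two_ne_zero))
    exact ((Real.continuous_sqrt.tendsto _ |>.comp h2).inv₀ (by simp)).pow 3
  have h3 : (√(1 + 0 : ℝ))⁻¹ ^ 3 = 1 := by norm_num
  rw [h3] at h1
  refine h1.congr' ?_
  filter_upwards [eventually_gt_atTop 0] with r hr
  have e : r ^ 2 + η ^ 2 = r ^ 2 * (1 + η ^ 2 / r ^ 2) := by field_simp
  rw [e, Real.sqrt_mul (by positivity), Real.sqrt_sq hr.le, mul_inv, mul_pow, ← mul_assoc,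
    ← mul_pow, mul_inv_cancel₀ hr.ne', one_pow, one_mul]

lemma integrable_radialKernel {η : ℝ} (hη : 0 < η) :
    Integrable fun x : E3 => radialKernel η ‖x‖ := by
  rw [integrable_fun_norm_addHaar volume (f := radialKernel η)]
  simp only [finrank_euclideanSpace, Fintype.card_fin, smul_eq_mul]
  exact integrableOn_Ioi_deriv_of_nonneg' (fun r _ => hasDerivAt_radial hη r)
    (fun r _ => mul_nonneg (sq_nonneg r) (radialKernel_nonneg η r)) (tendsto_radial hη)

lemma integral_radialKernel {η : ℝ} (hη : 0 < η) :
    ∫ x : E3, radialKernel η ‖x‖ = 4 * Real.pi := by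
  rw [integral_fun_norm_addHaar volume (radialKernel η)]
  simp only [finrank_euclideanSpace, Fintype.card_fin, smul_eq_mul]
  have h1 : ∫ r in Ioi (0 : ℝ), r ^ (3 - 1) * radialKernel η r = 1 := by
    have := integral_Ioi_of_hasDerivAt_of_nonneg' (a := 0) (fun r _ => hasDerivAt_radial hη r)
      (fun r _ => mul_nonneg (sq_nonneg r) (radialKernel_nonneg η r)) (tendsto_radial hη)
    simpa using this
  have h2 : (volume : Measure E3).real (Metric.ball 0 1) = 4 / 3 * Real.pi := by
    rw [measureReal_def, EuclideanSpace.volume_ball_fin_three]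
    simp only [ENNReal.ofReal_one, one_pow, one_mul]
    rw [ENNReal.toReal_ofReal (by positivity)]
    ring
  rw [h1, h2, nsmul_eq_mul]
  push_cast
  ring

/-- Seen from P, the set lies in an open half space. The half space and its reflection are disjoint
and carry the same integral of a radial function, so each has at most half of 4π. -/
lemma setIntegral_radialKernel_le {η : ℝ} (hη : 0 < η) {S : Set E3}
    (P ν : E3) (hSν : ∀ X ∈ S, ⟪ν, X - P⟫ < 0) :
    ∫ X in S, radialKernel η ‖X - P‖ ≤ 2 * Real.pi := by
  set H : Set E3 := {x | ⟪ν, x⟫ < 0}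
  have hH : MeasurableSet H := measurableSet_lt (by fun_prop) measurable_const
  have hi := integrable_radialKernel hη
  have h1 : ∫ X in S, radialKernel η ‖X - P‖ ≤ ∫ X in (fun X => X - P) ⁻¹' H,
      radialKernel η ‖X - P‖ := by
    refine setIntegral_mono_set (hi.comp_sub_right P).integrableOn
      (ae_of_all _ fun X => radialKernel_nonneg _ _) (ae_of_all _ fun X hX => hSν X hX)
  have h2 : ∫ X in (fun X => X - P) ⁻¹' H, radialKernel η ‖X - P‖ =
      ∫ x in H, radialKernel η ‖x‖ :=
    (measurePreserving_sub_right volume P).setIntegral_preimage_emb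
      (measurableEmbedding_subRight P) (fun x => radialKernel η ‖x‖) H
  have h3 : ∫ x in (fun x : E3 => -x) ⁻¹' H, radialKernel η ‖x‖ = ∫ x in H, radialKernel η ‖x‖ := by
    have := (Measure.measurePreserving_neg (volume : Measure E3)).setIntegral_preimage_emb
      (MeasurableEquiv.neg E3).measurableEmbedding (fun x => radialKernel η ‖x‖) H
    simpa using this
  have hd : Disjoint H ((fun x : E3 => -x) ⁻¹' H) := by
    rw [disjoint_left]
    intro x hx hx'
    have h4 : ⟪ν, x⟫ < 0 := hx
    have h5 : ⟪ν, -x⟫ < 0 := hx'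
    rw [inner_neg_right] at h5
    linarith
  have h4 := setIntegral_union hd (measurable_neg hH) hi.integrableOn hi.integrableOn
  have h5 : ∫ x in H ∪ (fun x : E3 => -x) ⁻¹' H, radialKernel η ‖x‖ ≤
      ∫ x : E3, radialKernel η ‖x‖ :=
    setIntegral_le_integral hi (ae_of_all _ fun x => radialKernel_nonneg _ _)
  rw [integral_radialKernel hη] at h5
  linarith

namespace HolderConvex

variable {Ω : Set E3} {n : E3 → E3} {α C : ℝ}

lemma hasGrowth_surf (h : HolderConvex Ω n α C) : HasGrowth (surf Ω) (54 * Real.pi) 2 := by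
  intro x r hr
  have := h.surf_closedBall_le x r
  rwa [← Real.rpow_natCast] at this

lemma hasGrowth_volume : HasGrowth (volume.restrict (closure Ω)) (Real.pi * 4 / 3) 3 := by
  intro x r hr
  refine (Measure.restrict_apply_le _ _).trans ?_
  rw [EuclideanSpace.volume_closedBall_fin_three, ← ENNReal.ofReal_pow hr.le,
    ← ENNReal.ofReal_mul (by positivity)]
  refine ENNReal.ofReal_le_ofReal (le_of_eq ?_)
  have : r ^ (3 : ℝ) = r ^ 3 := by rw [← Real.rpow_natCast]; norm_num
  rw [this]
  ring

lemma continuousWithinAt_kern (h : HolderConvex Ω n α C) {P Y : E3} (hP : P ∈ frontier Ω)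
    (hY : Y ≠ P) : ContinuousWithinAt (fun Q => kern n Q Y) (frontier Ω) P := by
  simp only [kern_eq]
  have h0 : ‖P - Y‖ ≠ 0 := norm_ne_zero_iff.2 (sub_ne_zero.2 (Ne.symm hY))
  have h1 : ContinuousWithinAt (fun Q : E3 => Q - Y) (frontier Ω) P :=
    (continuous_id.sub continuous_const).continuousWithinAt
  refine (ContinuousWithinAt.div (h1.inner (h.continuousOn_normal P hP))
    (continuousWithinAt_const.mul (h1.norm.pow 3)) ?_).neg
  exact mul_ne_zero (by positivity) (pow_ne_zero 3 h0)

/-- The numerator is O(|P−Y|^(1+α)) on the boundary, so the kernel is O(|P−Y|^(α−2)) against a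
measure of quadratic growth. -/
lemma weaklySingular_surf (h : HolderConvex Ω n α C) :
    WeaklySingular (frontier Ω) (surf Ω) (kern n) (54 * Real.pi) 2 α (C / (4 * Real.pi)) where
  growth := h.hasGrowth_surf
  const_nonneg := by positivity
  pos := h.alpha_pos
  lt := by linarith [h.alpha_le]
  bound_nonneg := by have := h.const_nonneg; positivity
  meas := fun P _ => measurable_kern n P
  bound := fun P hP => by
    refine (ae_restrict_iff' isClosed_frontier.measurableSet).2 (ae_of_all _ fun Y hY => ?_)
    rw [kern_eq, abs_neg, abs_div, real_inner_comm]
    have h1 := h.abs_inner_self_le hP hY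
    by_cases h0 : P - Y = 0
    · rw [h0]
      have h2 := h.const_nonneg
      have h3 := Real.rpow_nonneg (norm_nonneg (0 : E3)) (α - 2)
      simp only [inner_zero_right, abs_zero, zero_div]
      positivity
    · have hr : 0 < ‖P - Y‖ := norm_pos_iff.2 h0
      have e : ‖P - Y‖ ^ (α - 2) = ‖P - Y‖ ^ α / ‖P - Y‖ ^ 2 := by
        rw [Real.rpow_sub hr, Real.rpow_two]
      rw [e, abs_of_pos (by positivity : 0 < 4 * Real.pi * ‖P - Y‖ ^ 3), div_le_iff₀ (by positivity)]
      refine h1.trans (le_of_eq ?_)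
      field_simp
  cont := fun P hP Y hY => h.continuousWithinAt_kern hP hY

lemma weaklySingular_volume (h : HolderConvex Ω n α C) :
    WeaklySingular (frontier Ω) (volume.restrict (closure Ω)) (kern n) (Real.pi * 4 / 3) 3 1
      (1 / (4 * Real.pi)) where
  growth := hasGrowth_volume
  const_nonneg := by positivity
  pos := one_pos
  lt := by norm_num
  bound_nonneg := by positivity
  meas := fun P _ => measurable_kern n P
  bound := fun P hP => ae_of_all _ fun Y => by
    rw [kern_eq, abs_neg, abs_div]
    have h1 := abs_real_inner_le_norm (P - Y) (n P)
    rw [h.unit P hP, mul_one] at h1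
    by_cases h0 : P - Y = 0
    · rw [h0]
      have h3 := Real.rpow_nonneg (norm_nonneg (0 : E3)) (1 - 3 : ℝ)
      simp only [inner_zero_left, abs_zero, zero_div]
      positivity
    · have hr : 0 < ‖P - Y‖ := norm_pos_iff.2 h0
      have e : ‖P - Y‖ ^ (1 - 3 : ℝ) = ‖P - Y‖ / ‖P - Y‖ ^ 3 := by
        rw [Real.rpow_sub hr, Real.rpow_one]
        congr 1
        rw [← Real.rpow_natCast]; norm_num
      rw [e, abs_of_pos (by positivity : 0 < 4 * Real.pi * ‖P - Y‖ ^ 3), div_le_iff₀ (by positivity)]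
      refine h1.trans (le_of_eq ?_)
      field_simp
  cont := fun P hP Y hY => h.continuousWithinAt_kern hP hY

lemma isFiniteMeasure_volume (h : HolderConvex Ω n α C) :
    IsFiniteMeasure (volume.restrict (closure Ω)) :=
  ⟨by rw [Measure.restrict_apply_univ]; exact h.bounded.isCompact_closure.measure_lt_top⟩

/-- The field `(X - P) / (|X - P|² + η²)^{3/2}` has flux at most `2π` if `P` is on the boundary. -/
lemma integral_flux_le (h : HolderConvex Ω n α C) {P : E3} (hP : P ∈ frontier Ω) {η : ℝ}
    (hη : 0 < η) :
    ∫ Q in frontier Ω, ⟪Q - P, n Q⟫ * ((√(‖Q - P‖ ^ 2 + η ^ 2))⁻¹) ^ 3 ∂μHE[2] ≤ 2 * Real.pi := by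
  -- The parameter η removes the singularity at P, so the divergence theorem applies on all of Ω.
  have hpos : ∀ X : E3, 0 < ‖X - P‖ ^ 2 + η ^ 2 := fun X => by positivity
  have hsub : ContDiff ℝ 1 fun X : E3 => X - P := contDiff_id.sub contDiff_const
  have hsm : ContDiff ℝ 1 fun X : E3 => ((√(‖X - P‖ ^ 2 + η ^ 2))⁻¹) ^ 3 :=
    ((((hsub.norm_sq ℝ).add contDiff_const).sqrt
      fun X => (hpos X).ne').inv fun X => (Real.sqrt_pos.2 (hpos X)).ne').pow 3
  have hcoord : ∀ j : Fin 3, ContDiff ℝ 1 fun X : E3 => (X - P) j := fun j =>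
    (EuclideanSpace.proj (𝕜 := ℝ) j : E3 →L[ℝ] ℝ).contDiff.comp hsub
  set F : Fin 3 → E3 → ℝ := fun j X => (X - P) j * ((√(‖X - P‖ ^ 2 + η ^ 2))⁻¹) ^ 3 with hF
  have hFc : ∀ j, ContDiff ℝ 1 (F j) := fun j => (hcoord j).mul hsm
  have hder : ∀ j X, fderiv ℝ (F j) X (basisVec j) = ((√(‖X - P‖ ^ 2 + η ^ 2))⁻¹) ^ 3 -
      3 * ((X - P) j) ^ 2 * ((√(‖X - P‖ ^ 2 + η ^ 2))⁻¹) ^ 5 := by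
    intro j X
    have h1 : HasDerivAt (fun t : ℝ => F j (X + t • basisVec j))
        (fderiv ℝ (F j) X (basisVec j)) 0 := by
      have hl : HasDerivAt (fun t : ℝ => X + t • basisVec j) (basisVec j) 0 := by
        simpa using ((hasDerivAt_id (0 : ℝ)).smul_const (basisVec j)).const_add X
      have hf : HasFDerivAt (F j) (fderiv ℝ (F j) X) (X + (0 : ℝ) • basisVec j) := by
        simpa using ((hFc j).differentiable one_ne_zero X).hasFDerivAt
      exact hf.comp_hasDerivAt (0 : ℝ) hl
    have hq : ∀ t : ℝ, ‖X + t • basisVec j - P‖ ^ 2 =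
        ((X - P) j + t) ^ 2 + ‖dropCoord j (X - P)‖ ^ 2 := by
      intro t
      have e : X + t • basisVec j - P = (X - P) + t • basisVec j := by abel
      rw [e, norm_sq_coord j, ← dropL_apply, map_add, map_smul]
      simp
    -- Along a coordinate line the other two coordinates are constant and can be absorbed into η,
    -- which reduces the derivative to the radial formula in one variable.
    have hη' : 0 < √(‖dropCoord j (X - P)‖ ^ 2 + η ^ 2) := Real.sqrt_pos.2 (by positivity)
    have hη2 : √(‖dropCoord j (X - P)‖ ^ 2 + η ^ 2) ^ 2 = ‖dropCoord j (X - P)‖ ^ 2 + η ^ 2 :=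
      Real.sq_sqrt (by positivity)
    have h2 : HasDerivAt (fun t : ℝ => F j (X + t • basisVec j))
        (1 * ((√(((X - P) j + 0) ^ 2 + √(‖dropCoord j (X - P)‖ ^ 2 + η ^ 2) ^ 2))⁻¹) ^ 3 +
          ((X - P) j + 0) *
          ((3 : ℕ) * ((√(((X - P) j + 0) ^ 2 + √(‖dropCoord j (X - P)‖ ^ 2 + η ^ 2) ^ 2))⁻¹) ^ 2 *
          (-((X - P) j + 0) *
            ((√(((X - P) j + 0) ^ 2 + √(‖dropCoord j (X - P)‖ ^ 2 + η ^ 2) ^ 2))⁻¹) ^ 3))) 0 := by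
      have hl : HasDerivAt (fun t : ℝ => (X - P) j + t) 1 0 :=
        (hasDerivAt_id' (0 : ℝ)).const_add _
      have h3 := (hasDerivAt_inv_sqrt hη' ((X - P) j + 0)).comp (0 : ℝ) hl
      rw [mul_one] at h3
      refine (hl.mul (h3.pow 3)).congr_of_eventuallyEq (Eventually.of_forall fun t => ?_)
      simp only [hF, hq t, Function.comp, hη2, Pi.mul_apply, Pi.pow_apply]
      simp only [PiLp.add_apply, PiLp.smul_apply, PiLp.sub_apply, basisVec_same, smul_eq_mul,
        mul_one, add_assoc]
      ring_nf
    have h3 := h1.unique h2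
    rw [h3, add_zero, hη2, ← add_assoc, ← norm_sq_coord]
    push_cast
    ring
  have hcont : ∀ j, ContinuousOn (fun Q => n Q j • F j Q) (frontier Ω) := fun j =>
    ((EuclideanSpace.proj (𝕜 := ℝ) j).continuous.comp_continuousOn h.continuousOn_normal).smul
      (hFc j).continuous.continuousOn
  have hfin := h.isFiniteMeasure_surf
  have hint : ∀ j, IntegrableOn (fun Q => n Q j • F j Q) (frontier Ω) (μHE[2]) := fun j => by
    obtain ⟨B, hB⟩ := h.isCompact_frontier.exists_bound_of_continuousOn (hcont j)
    exact Integrable.of_bound ((hcont j).aestronglyMeasurable_of_isCompact h.isCompact_frontier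
        isClosed_frontier.measurableSet) B
      ((ae_restrict_iff' isClosed_frontier.measurableSet).2 (ae_of_all _ hB))
  have hdcont : ∀ j, Continuous fun X => fderiv ℝ (F j) X (basisVec j) := fun j =>
    ((hFc j).continuous_fderiv one_ne_zero).clm_apply continuous_const
  have hdint : ∀ j, IntegrableOn (fun X => fderiv ℝ (F j) X (basisVec j)) Ω := fun j =>
    ((hdcont j).continuousOn.integrableOn_compact h.bounded.isCompact_closure).mono_set
      subset_closure
  have hflux : ∫ Q in frontier Ω, ⟪Q - P, n Q⟫ * ((√(‖Q - P‖ ^ 2 + η ^ 2))⁻¹) ^ 3 ∂μHE[2] =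
      ∫ X in Ω, radialKernel η ‖X - P‖ := by
    calc _ = ∫ Q in frontier Ω, ∑ j, n Q j • F j Q ∂μHE[2] := by
          refine integral_congr_ae (ae_of_all _ fun Q => ?_)
          simp only [hF, PiLp.inner_apply, RCLike.inner_apply, conj_trivial, Finset.sum_mul,
            smul_eq_mul]
          exact Finset.sum_congr rfl fun j _ => by ring
      _ = ∑ j, ∫ X in Ω, fderiv ℝ (F j) X (basisVec j) := by
          rw [integral_finsetSum _ fun j _ => hint j]
          exact Finset.sum_congr rfl fun j _ => (h.integral_fderiv_eq j (hFc j)).symm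
      _ = ∫ X in Ω, radialKernel η ‖X - P‖ := by
          rw [← integral_finsetSum _ fun j _ => hdint j]
          refine integral_congr_ae (ae_of_all _ fun X => ?_)
          simp only [hder]
          have h1 := EuclideanSpace.norm_sq_eq (X - P)
          simp only [Real.norm_eq_abs, sq_abs] at h1
          have hs : 0 < √(‖X - P‖ ^ 2 + η ^ 2) := Real.sqrt_pos.2 (hpos X)
          have hsq : √(‖X - P‖ ^ 2 + η ^ 2) ^ 2 = ‖X - P‖ ^ 2 + η ^ 2 := Real.sq_sqrt (hpos X).le
          rw [Finset.sum_sub_distrib, ← Finset.sum_mul, ← Finset.mul_sum, ← h1, radialKernel,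
            Finset.sum_const, Finset.card_univ, Fintype.card_fin, nsmul_eq_mul]
          generalize √(‖X - P‖ ^ 2 + η ^ 2) = s at *
          have : η ^ 2 = s ^ 2 - ‖X - P‖ ^ 2 := by linarith
          rw [this]
          field_simp
          push_cast
          ring
  rw [hflux]
  exact setIntegral_radialKernel_le hη P (n P) fun X hX =>
    h.inner_sub_neg hP hX

end HolderConvex


/-! ### Uniqueness for the boundary integral equation on a convex domain -/

namespace HolderConvex

variable {Ω : Set E3} {n : E3 → E3} {α C : ℝ}

lemma kern_nonpos (h : HolderConvex Ω n α C) {P Q : E3} (hQ : Q ∈ frontier Ω)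
    (hP : P ∈ closure Ω) : kern n Q P ≤ 0 := by
  have h1 := h.support Q hQ P hP
  have h2 : 0 ≤ ⟪Q - P, n Q⟫ := by
    rw [real_inner_comm, ← neg_sub P Q, inner_neg_right]; linarith
  rw [kern_eq]
  have : 0 ≤ ⟪Q - P, n Q⟫ / (4 * Real.pi * ‖Q - P‖ ^ 3) := by positivity
  linarith

lemma ae_mem_frontier : ∀ᵐ P ∂(surf Ω), P ∈ frontier Ω :=
  ae_restrict_mem isClosed_frontier.measurableSet

lemma integrable_of_continuousOn (h : HolderConvex Ω n α C) {V : Type*} [NormedAddCommGroup V]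
    [SecondCountableTopology V] {f : E3 → V} (hf : ContinuousOn f (frontier Ω)) :
    Integrable f (surf Ω) := by
  have := h.isFiniteMeasure_surf
  obtain ⟨B, hB⟩ := h.isCompact_frontier.exists_bound_of_continuousOn hf
  exact Integrable.of_bound (hf.aestronglyMeasurable isClosed_frontier.measurableSet) B
    ((ae_restrict_iff' isClosed_frontier.measurableSet).2 (ae_of_all _ hB))

/-- The double layer potential of the constant `1` has density at most `1/2`. -/
lemma lintegral_kern_left_le (h : HolderConvex Ω n α C) {P : E3} (hP : P ∈ frontier Ω) :
    ∫⁻ Q, ‖kern n Q P‖ₑ ∂(surf Ω) ≤ ENNReal.ofReal (1 / 2) := by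
  set η : ℕ → ℝ := fun k => 1 / ((k : ℝ) + 1) with hηd
  have hη : ∀ k, 0 < η k := fun k => by positivity
  have hη0 : Tendsto η atTop (𝓝 0) := tendsto_one_div_add_atTop_nhds_zero_nat
  set F : ℕ → E3 → ℝ := fun k Q =>
    ⟪Q - P, n Q⟫ * ((√(‖Q - P‖ ^ 2 + η k ^ 2))⁻¹) ^ 3 / (4 * Real.pi) with hF
  have hFc : ∀ k, ContinuousOn (F k) (frontier Ω) := by
    intro k
    have h1 : ContinuousOn (fun Q => ⟪Q - P, n Q⟫) (frontier Ω) :=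
      ContinuousOn.inner (continuous_id.sub continuous_const).continuousOn h.continuousOn_normal
    have h2 : Continuous fun Q : E3 => ((√(‖Q - P‖ ^ 2 + η k ^ 2))⁻¹) ^ 3 := by
      have : ∀ Q : E3, √(‖Q - P‖ ^ 2 + η k ^ 2) ≠ 0 := fun Q =>
        (Real.sqrt_pos.2 (by have := hη k; positivity)).ne'
      fun_prop (disch := assumption)
    exact (h1.mul h2.continuousOn).div_const _
  have hF0 : ∀ k, ∀ Q ∈ frontier Ω, 0 ≤ F k Q := by
    intro k Q hQ
    have h1 := h.support Q hQ P (frontier_subset_closure hP)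
    have h2 : 0 ≤ ⟪Q - P, n Q⟫ := by
      rw [real_inner_comm, ← neg_sub P Q, inner_neg_right]; linarith
    simp only [hF]
    positivity
  have hFi : ∀ k, ∫⁻ Q, ENNReal.ofReal (F k Q) ∂(surf Ω) ≤ ENNReal.ofReal (1 / 2) := by
    intro k
    rw [← ofReal_integral_eq_lintegral_ofReal (h.integrable_of_continuousOn (hFc k))
      (ae_mem_frontier.mono (hF0 k))]
    refine ENNReal.ofReal_le_ofReal ?_
    have h1 := h.integral_flux_le hP (hη k)
    simp only [hF]
    rw [integral_div, div_le_iff₀ (by positivity)]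
    linarith
  have hlim : ∀ Q ∈ frontier Ω, Tendsto (fun k => ENNReal.ofReal (F k Q)) atTop
      (𝓝 ‖kern n Q P‖ₑ) := by
    intro Q hQ
    have e : ‖kern n Q P‖ₑ = ENNReal.ofReal (-kern n Q P) := by
      rw [Real.enorm_eq_ofReal_abs, abs_of_nonpos (h.kern_nonpos hQ (frontier_subset_closure hP))]
    rw [e, kern_eq, neg_neg]
    refine ENNReal.tendsto_ofReal ?_
    by_cases hQP : Q - P = 0
    · simp [hF, hQP]
    · have hr : 0 < ‖Q - P‖ := norm_pos_iff.2 hQP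
      have h1 : Tendsto (fun k => √(‖Q - P‖ ^ 2 + η k ^ 2)) atTop (𝓝 ‖Q - P‖) := by
        have h2 : Tendsto (fun k => ‖Q - P‖ ^ 2 + η k ^ 2) atTop (𝓝 (‖Q - P‖ ^ 2 + 0 ^ 2)) :=
          tendsto_const_nhds.add (hη0.pow 2)
        have h3 := (Real.continuous_sqrt.tendsto _).comp h2
        have h4 : √(‖Q - P‖ ^ 2 + 0 ^ 2) = ‖Q - P‖ := by simp
        rwa [h4] at h3
      have h5 := (((h1.inv₀ hr.ne').pow 3).const_mul ⟪Q - P, n Q⟫).div_const (4 * Real.pi)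
      have h6 : ⟪Q - P, n Q⟫ * ‖Q - P‖⁻¹ ^ 3 / (4 * Real.pi) =
          ⟪Q - P, n Q⟫ / (4 * Real.pi * ‖Q - P‖ ^ 3) := by field_simp
      rwa [h6] at h5
  -- Fatou's lemma as η → 0. The regularised integrands are nonnegative by convexity, and 1/2 is the
  -- flux bound 2π divided by 4π.
  calc ∫⁻ Q, ‖kern n Q P‖ₑ ∂(surf Ω)
      = ∫⁻ Q, liminf (fun k => ENNReal.ofReal (F k Q)) atTop ∂(surf Ω) := by
        refine lintegral_congr_ae ?_
        filter_upwards [ae_mem_frontier] with Q hQ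
        exact (hlim Q hQ).liminf_eq.symm
    _ ≤ liminf (fun k => ∫⁻ Q, ENNReal.ofReal (F k Q) ∂(surf Ω)) atTop :=
        lintegral_liminf_le' fun k => ((hFc k).aemeasurable
          isClosed_frontier.measurableSet).ennreal_ofReal
    _ ≤ liminf (fun _ : ℕ => ENNReal.ofReal (1 / 2)) atTop :=
        liminf_le_liminf (Eventually.of_forall hFi)
    _ = ENNReal.ofReal (1 / 2) := by simp

/-- A function which vanishes almost everywhere on `∂Ω` vanishes where it is continuous. -/
lemma eq_zero_of_ae (h : HolderConvex Ω n α C) {f : E3 → ℝ} (hf : ∀ᵐ P ∂(surf Ω), f P = 0)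
    {Q : E3} (hQ : Q ∈ frontier Ω) (hc : ContinuousWithinAt f (frontier Ω) Q) : f Q = 0 := by
  by_contra h0
  have h1 : ∀ᶠ P in 𝓝[frontier Ω] Q, f P ≠ 0 := hc.eventually_ne h0
  obtain ⟨r, hr, hr'⟩ := Metric.mem_nhdsWithin_iff.1 h1
  have h2 := h.surf_ball_pos hQ hr
  refine h2.ne' (measure_mono_null ?_ (mem_ae_iff.1 (hf.and ae_mem_frontier)))
  intro P hP hP'
  exact hr' ⟨hP, hP'.2⟩ hP'.1

lemma inner_lt_one (h : HolderConvex Ω n α C) {P : E3} (hP : P ∈ frontier Ω) {e : E3}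
    (he : ‖e‖ = 1) (hne : n P ≠ e) : ⟪n P, e⟫ < 1 := by
  refine lt_of_le_of_ne ?_ fun h1 => hne ((inner_eq_one_iff_of_norm_eq_one (h.unit P hP) he).1 h1)
  have := real_inner_le_norm (n P) e
  rwa [h.unit P hP, he, one_mul] at this

lemma exists_mem_add (h : HolderConvex Ω n α C) {P v : E3} (hP : P ∈ frontier Ω)
    (hv : ⟪n P, v⟫ < 0) : ∃ t : ℝ, 0 < t ∧ P + t • v ∈ Ω :=
  ((eventually_mem_nhdsWithin (a := (0 : ℝ)) (s := Ioi 0)).and (h.inward P hP v hv)).exists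

/-- Otherwise Q lies on the tangent plane at P. The direction n_P − n_Q points into Ω at Q but
strictly to the outer side of that plane, which contradicts support at P. -/
lemma kern_ne_zero (h : HolderConvex Ω n α C) {P Q : E3} (hP : P ∈ frontier Ω)
    (hQ : Q ∈ frontier Ω) (hne : n P ≠ n Q) : kern n P Q ≠ 0 := by
  have h1 := h.inner_lt_one hP (h.unit Q hQ) hne
  have hPQ : P - Q ≠ 0 := fun h0 => hne (by rw [sub_eq_zero.1 h0])
  have h2 : ⟪P - Q, n P⟫ ≠ 0 := by
    intro h0
    have hv : ⟪n Q, n P - n Q⟫ < 0 := by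
      rw [inner_sub_right, real_inner_self_eq_norm_sq, h.unit Q hQ, real_inner_comm]
      linarith
    obtain ⟨t, ht, hm⟩ := h.exists_mem_add hQ hv
    have h3 := h.support P hP _ (subset_closure hm)
    rw [show Q + t • (n P - n Q) - P = t • (n P - n Q) - (P - Q) by abel, inner_sub_right,
      inner_smul_right, inner_sub_right, real_inner_self_eq_norm_sq, h.unit P hP,
      real_inner_comm (P - Q), h0] at h3
    nlinarith
  rw [kern_eq]
  have h3 : ‖P - Q‖ ≠ 0 := norm_ne_zero_iff.2 hPQ
  have := Real.pi_pos.ne'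
  exact neg_ne_zero.2 (div_ne_zero h2 (mul_ne_zero (by positivity) (pow_ne_zero 3 h3)))

/-- The Gauss map is onto. -/
lemma exists_normal_eq (h : HolderConvex Ω n α C) {e : E3} (he : ‖e‖ = 1) :
    ∃ Q ∈ frontier Ω, n Q = e := by
  obtain ⟨Q, hQ, hmax⟩ := h.bounded.isCompact_closure.exists_isMaxOn h.nonempty.closure
    (f := fun X => ⟪e, X⟫) (by fun_prop)
  have key : ∀ v : E3, 0 < ⟪e, v⟫ → ∀ t : ℝ, 0 < t → Q + t • v ∉ Ω := by
    intro v hv t ht hm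
    have h1 : ⟪e, Q + t • v⟫ ≤ ⟪e, Q⟫ := hmax (subset_closure hm)
    rw [inner_add_right, inner_smul_right] at h1
    nlinarith
  have hQf : Q ∈ frontier Ω := by
    rw [h.isOpen.frontier_eq]
    refine ⟨hQ, fun hQ' => ?_⟩
    have h1 : ∀ᶠ t : ℝ in 𝓝 0, Q + t • e ∈ Ω :=
      (IsGraphChart.tendsto_line Q e).eventually (h.isOpen.mem_nhds hQ')
    obtain ⟨t, ht, hm⟩ := ((eventually_mem_nhdsWithin (a := (0 : ℝ)) (s := Ioi 0)).and
      (nhdsWithin_le_nhds h1)).exists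
    exact key e (by rw [real_inner_self_eq_norm_sq, he]; norm_num) t ht hm
  refine ⟨Q, hQf, ?_⟩
  by_contra hne
  have h1 := h.inner_lt_one hQf he hne
  -- At the maximum point Q of ⟨e, ·⟩, the direction e − n_Q would point into Ω and increase ⟨e, ·⟩.
  have hv : ⟪n Q, e - n Q⟫ < 0 := by
    rw [inner_sub_right, real_inner_self_eq_norm_sq, h.unit Q hQf]
    linarith
  obtain ⟨t, ht, hm⟩ := h.exists_mem_add hQf hv
  refine key (e - n Q) ?_ t ht hm
  rw [inner_sub_right, real_inner_self_eq_norm_sq, he, real_inner_comm]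
  linarith

lemma aemeasurable_uncurry_kern (h : HolderConvex Ω n α C) :
    AEMeasurable (fun p : E3 × E3 => kern n p.1 p.2) ((surf Ω).prod (surf Ω)) := by
  have := h.isFiniteMeasure_surf
  have hn : AEMeasurable n (surf Ω) :=
    h.continuousOn_normal.aemeasurable isClosed_frontier.measurableSet
  have h1 : AEMeasurable (fun p : E3 × E3 => n p.1) ((surf Ω).prod (surf Ω)) :=
    hn.comp_fst
  have h2 : Measurable fun p : E3 × E3 => p.1 - p.2 := measurable_fst.sub measurable_snd
  simp only [kern_eq]
  exact ((h2.aemeasurable.inner h1).div ((h2.norm.pow_const 3).const_mul _).aemeasurable).neg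

section Injective

variable {A : E3 → ℝ}

/-- The equation gives |A| ≤ J with J = 2∫|k||A|. Integrating over P and exchanging the integrals,
the bound 1/2 on ∫|k(P,Q)| dS_P yields ∫J ≤ ∫|A|. So |A| = J almost everywhere, and everywhere by
continuity, since the surface measure charges each neighbourhood of a boundary point. -/
lemma two_mul_integral_abs (h : HolderConvex Ω n α C) (hA : ContinuousOn A (frontier Ω))
    (hsol : ∀ P ∈ frontier Ω, A P / 2 = ∫ Q, kern n P Q * A Q ∂(surf Ω)) {P : E3}
    (hP : P ∈ frontier Ω) : |A P| = 2 * ∫ Q, |kern n P Q| * |A Q| ∂(surf Ω) := by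
  have hfin := h.isFiniteMeasure_surf
  obtain ⟨B, hB⟩ := h.isCompact_frontier.exists_bound_of_continuousOn hA
  have hBae : ∀ᵐ Q ∂(surf Ω), |A Q| ≤ B := ae_mem_frontier.mono hB
  have hBae' : ∀ᵐ Q ∂(surf Ω), |(|A Q|)| ≤ B := hBae.mono fun Q hQ => by rwa [abs_abs]
  have hAm : AEStronglyMeasurable A (surf Ω) :=
    hA.aestronglyMeasurable isClosed_frontier.measurableSet
  have hAm' : AEStronglyMeasurable (fun Q => |A Q|) (surf Ω) :=
    hA.abs.aestronglyMeasurable isClosed_frontier.measurableSet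
  have W := h.weaklySingular_surf
  have hint : ∀ P ∈ frontier Ω, Integrable (fun Q => |kern n P Q| * |A Q|) (surf Ω) := by
    intro P hP
    exact (W.integrable_mul hP hAm hBae).abs.congr (ae_of_all _ fun Q => abs_mul _ _)
  set J : E3 → ℝ := fun P => 2 * ∫ Q, |kern n P Q| * |A Q| ∂(surf Ω) with hJ
  have hJc : ContinuousOn J (frontier Ω) := by
    have h1 := (W.continuousOn_integral hAm' hBae').neg.const_smul (2 : ℝ)
    refine h1.congr fun P hP => ?_
    simp only [hJ, Pi.smul_apply, Pi.neg_apply, smul_eq_mul, ← integral_neg]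
    congr 1
    refine integral_congr_ae ?_
    filter_upwards [ae_mem_frontier] with Q hQ
    rw [abs_of_nonpos (h.kern_nonpos hP (frontier_subset_closure hQ)), neg_mul]
  have hle : ∀ P ∈ frontier Ω, |A P| ≤ J P := by
    intro P hP
    have h1 : A P = 2 * ∫ Q, kern n P Q * A Q ∂(surf Ω) := by linarith [hsol P hP]
    rw [h1, abs_mul, abs_two]
    refine mul_le_mul_of_nonneg_left ?_ zero_le_two
    refine (abs_integral_le_integral_abs).trans (le_of_eq ?_)
    simp only [abs_mul]
  have hlint : ∀ P ∈ frontier Ω, ENNReal.ofReal (J P) =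
      2 * ∫⁻ Q, ‖kern n P Q‖ₑ * ‖A Q‖ₑ ∂(surf Ω) := by
    intro P hP
    rw [hJ, ENNReal.ofReal_mul zero_le_two, ofReal_integral_eq_lintegral_ofReal (hint P hP)
      (ae_of_all _ fun Q => by positivity), ENNReal.ofReal_ofNat]
    congr 1
    refine lintegral_congr fun Q => ?_
    rw [ENNReal.ofReal_mul (abs_nonneg _), Real.enorm_eq_ofReal_abs, Real.enorm_eq_ofReal_abs]
  have htot : ∫⁻ P, ENNReal.ofReal (J P) ∂(surf Ω) ≤ ∫⁻ P, ‖A P‖ₑ ∂(surf Ω) := by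
    calc ∫⁻ P, ENNReal.ofReal (J P) ∂(surf Ω)
        = ∫⁻ P, 2 * ∫⁻ Q, ‖kern n P Q‖ₑ * ‖A Q‖ₑ ∂(surf Ω) ∂(surf Ω) :=
          lintegral_congr_ae (ae_mem_frontier.mono hlint)
      _ = 2 * ∫⁻ P, ∫⁻ Q, ‖kern n P Q‖ₑ * ‖A Q‖ₑ ∂(surf Ω) ∂(surf Ω) :=
          lintegral_const_mul' _ _ (by simp)
      _ = 2 * ∫⁻ Q, ∫⁻ P, ‖kern n P Q‖ₑ * ‖A Q‖ₑ ∂(surf Ω) ∂(surf Ω) := by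
          congr 1
          refine lintegral_lintegral_swap ?_
          exact (h.aemeasurable_uncurry_kern.enorm).mul (hAm.aemeasurable.comp_snd.enorm)
      _ ≤ 2 * ∫⁻ Q, ENNReal.ofReal (1 / 2) * ‖A Q‖ₑ ∂(surf Ω) := by
          refine mul_le_mul_right ?_ _
          refine lintegral_mono_ae (ae_mem_frontier.mono fun Q hQ => ?_)
          rw [lintegral_mul_const' _ _ (by simp)]
          exact mul_le_mul_left (h.lintegral_kern_left_le hQ) _
      _ = ∫⁻ P, ‖A P‖ₑ ∂(surf Ω) := by
          have e : (2 : ℝ≥0∞) * ENNReal.ofReal (1 / 2) = 1 := by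
            rw [one_div, ENNReal.ofReal_inv_of_pos two_pos, ENNReal.ofReal_ofNat,
              ENNReal.mul_inv_cancel two_ne_zero ENNReal.ofNat_ne_top]
          rw [lintegral_const_mul' _ _ (by simp), ← mul_assoc, e, one_mul]
  have hfinA : ∫⁻ P, ‖A P‖ₑ ∂(surf Ω) ≠ ∞ := (h.integrable_of_continuousOn hA).2.ne
  have hJm : AEMeasurable (fun P => ENNReal.ofReal (J P)) (surf Ω) :=
    (hJc.aemeasurable isClosed_frontier.measurableSet).ennreal_ofReal
  have hae : (fun P => ‖A P‖ₑ) =ᵐ[surf Ω] fun P => ENNReal.ofReal (J P) := by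
    refine ae_eq_of_ae_le_of_lintegral_le ?_ hfinA hJm htot
    filter_upwards [ae_mem_frontier] with P hP
    rw [Real.enorm_eq_ofReal_abs]
    exact ENNReal.ofReal_le_ofReal (hle P hP)
  have hzero : ∀ᵐ P ∂(surf Ω), J P - |A P| = 0 := by
    filter_upwards [hae, ae_mem_frontier] with P h1 hP
    rw [Real.enorm_eq_ofReal_abs, ENNReal.ofReal_eq_ofReal_iff (abs_nonneg _)
      ((abs_nonneg _).trans (hle P hP))] at h1
    rw [h1, sub_self]
  have := h.eq_zero_of_ae hzero hP ((hJc.sub hA.abs) P hP)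
  linarith

/-- Equality in the triangle inequality at P, where A(P) = |A(P)|, means k(P,Q)A(Q) =
|k(P,Q)||A(Q)|. Since k(P,Q) < 0 when the normals differ, A(Q) cannot be positive. -/
lemma nonpos_of_nonneg (h : HolderConvex Ω n α C) (hA : ContinuousOn A (frontier Ω))
    (hsol : ∀ P ∈ frontier Ω, A P / 2 = ∫ Q, kern n P Q * A Q ∂(surf Ω)) {P Q : E3}
    (hP : P ∈ frontier Ω) (hQ : Q ∈ frontier Ω) (hne : n P ≠ n Q) (h0 : 0 ≤ A P) : A Q ≤ 0 := by
  have hfin := h.isFiniteMeasure_surf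
  have h1 := h.two_mul_integral_abs hA hsol hP
  have h2 := hsol P hP
  rw [abs_of_nonneg h0] at h1
  obtain ⟨B, hB⟩ := h.isCompact_frontier.exists_bound_of_continuousOn hA
  have hBae : ∀ᵐ Q ∂(surf Ω), |A Q| ≤ B := ae_mem_frontier.mono hB
  have hAm : AEStronglyMeasurable A (surf Ω) :=
    hA.aestronglyMeasurable isClosed_frontier.measurableSet
  have hi := h.weaklySingular_surf.integrable_mul hP hAm hBae
  have hi' : Integrable (fun Q => |kern n P Q| * |A Q|) (surf Ω) :=
    hi.abs.congr (ae_of_all _ fun Q => abs_mul _ _)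
  have h3 : ∫ Q, (|kern n P Q| * |A Q| - kern n P Q * A Q) ∂(surf Ω) = 0 := by
    rw [integral_sub hi' hi]; linarith
  have h4 := (integral_eq_zero_iff_of_nonneg (fun Q => by
    rw [Pi.zero_apply, Pi.sub_apply, ← abs_mul]; linarith [le_abs_self (kern n P Q * A Q)]) (hi'.sub hi)).1 h3
  have hPQ : Q ≠ P := fun e => hne (by rw [e])
  have hk : ContinuousWithinAt (fun Q => kern n P Q) (frontier Ω) Q := by
    simp only [kern_eq]
    have h0 : ‖P - Q‖ ≠ 0 := norm_ne_zero_iff.2 (sub_ne_zero.2 (Ne.symm hPQ))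
    have h1 : ContinuousWithinAt (fun Q : E3 => P - Q) (frontier Ω) Q :=
      (continuous_const.sub continuous_id).continuousWithinAt
    exact (ContinuousWithinAt.div (h1.inner continuousWithinAt_const)
      (continuousWithinAt_const.mul (h1.norm.pow 3))
      (mul_ne_zero (by positivity) (pow_ne_zero 3 h0))).neg
  have h5 := h.eq_zero_of_ae h4 hQ ((hk.abs.mul (hA Q hQ).abs).sub (hk.mul (hA Q hQ)))
  have h6 := h.kern_ne_zero hP hQ hne
  have h7 := h.kern_nonpos hP (frontier_subset_closure hQ)
  rw [Pi.sub_apply, abs_of_nonpos h7] at h5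
  have h8 : kern n P Q * (|A Q| + A Q) = 0 := by linarith
  have h9 := (mul_eq_zero.1 h8).resolve_left h6
  linarith [abs_nonneg (A Q)]

lemma nonneg_of_nonpos (h : HolderConvex Ω n α C) (hA : ContinuousOn A (frontier Ω))
    (hsol : ∀ P ∈ frontier Ω, A P / 2 = ∫ Q, kern n P Q * A Q ∂(surf Ω)) {P Q : E3}
    (hP : P ∈ frontier Ω) (hQ : Q ∈ frontier Ω) (hne : n P ≠ n Q) (h0 : A P ≤ 0) : 0 ≤ A Q := by
  have h1 := h.nonpos_of_nonneg (A := fun P => -A P) hA.neg (fun P hP => ?_) hP hQ hne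
    (by simpa using h0)
  · simpa using h1
  · simp only [mul_neg, integral_neg, neg_div, hsol P hP]

/-- The homogeneous integral equation has only the zero solution. -/
theorem eq_zero_of_homogeneous (h : HolderConvex Ω n α C) (hA : ContinuousOn A (frontier Ω))
    (hsol : ∀ P ∈ frontier Ω, A P / 2 = ∫ Q, kern n P Q * A Q ∂(surf Ω)) {P : E3}
    (hP : P ∈ frontier Ω) : A P = 0 := by
  choose q hq hqn using fun j : Fin 3 => h.exists_normal_eq (norm_basisVec j)
  have hinj : ∀ i j : Fin 3, i ≠ j → n (q i) ≠ n (q j) := by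
    intro i j hij e
    rw [hqn, hqn] at e
    have := congrArg (fun v : E3 => v i) e
    simp [basisVec, hij] at this
  -- Of three points with different normals at least two differ from P in normal. Going P → q_i →
  -- q_j → P reverses the sign of A three times, an odd number, so A(P) is both nonnegative and
  -- nonpositive.
  obtain ⟨i, j, hij, hi, hj⟩ : ∃ i j : Fin 3, i ≠ j ∧ n P ≠ n (q i) ∧ n P ≠ n (q j) := by
    by_cases h0 : n P = n (q 0)
    · exact ⟨1, 2, by decide, h0 ▸ hinj 0 1 (by decide), h0 ▸ hinj 0 2 (by decide)⟩
    · by_cases h1 : n P = n (q 1)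
      · exact ⟨0, 2, by decide, h0, h1 ▸ hinj 1 2 (by decide)⟩
      · exact ⟨0, 1, by decide, h0, h1⟩
  have up {P Q} := h.nonpos_of_nonneg hA hsol (P := P) (Q := Q)
  have dn {P Q} := h.nonneg_of_nonpos hA hsol (P := P) (Q := Q)
  have hij' := hinj i j hij
  rcases le_total 0 (A P) with h0 | h0
  · have h1 := up hP (hq i) hi h0
    have h2 := dn (hq i) (hq j) hij' h1
    exact le_antisymm (up (hq j) hP hj.symm h2) h0
  · have h1 := dn hP (hq i) hi h0
    have h2 := up (hq i) (hq j) hij' h1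
    exact le_antisymm h0 (dn (hq j) hP hj.symm h2)

end Injective

end HolderConvex


/-! ### The Fredholm alternative on C(∂Ω) -/

open Classical in
/-- The extension by zero of a function on a subset of space. -/
def extendZero {S : Set E3} (f : S → ℝ) (Q : E3) : ℝ := if h : Q ∈ S then f ⟨Q, h⟩ else 0

lemma extendZero_of_mem {S : Set E3} (f : S → ℝ) {Q : E3} (h : Q ∈ S) :
    extendZero f Q = f ⟨Q, h⟩ := dif_pos h

lemma continuousOn_extendZero {S : Set E3} {f : S → ℝ} (hf : Continuous f) :
    ContinuousOn (extendZero f) S := by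
  rw [continuousOn_iff_continuous_domRestrict]
  convert hf using 1
  ext x
  exact extendZero_of_mem f x.2

namespace HolderConvex

open scoped BoundedContinuousFunction

variable {Ω : Set E3} {n : E3 → E3} {α C : ℝ}

lemma aestronglyMeasurable_surf {A : E3 → ℝ} (hA : ContinuousOn A (frontier Ω)) :
    AEStronglyMeasurable A (surf Ω) :=
  hA.aestronglyMeasurable isClosed_frontier.measurableSet

lemma abs_extendZero_le (f : frontier Ω →ᵇ ℝ) : ∀ᵐ Q ∂(surf Ω), |extendZero f Q| ≤ ‖f‖ :=
  ae_mem_frontier.mono fun Q hQ => by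
    rw [extendZero_of_mem _ hQ]; exact f.norm_coe_le_norm _

/-- The bound of the boundary operator. -/
def opConst (Ω : Set E3) (α C : ℝ) : ℝ :=
  WeaklySingular.totalConst (surf Ω) (54 * Real.pi) 2 α (C / (4 * Real.pi))

lemma opConst_nonneg (h : HolderConvex Ω n α C) : 0 ≤ opConst Ω α C := by
  have := h.weaklySingular_surf
  exact add_nonneg this.ballConst_nonneg (mul_nonneg this.bound_nonneg measureReal_nonneg)

lemma continuous_boundaryFun (h : HolderConvex Ω n α C) (f : frontier Ω →ᵇ ℝ) :
    Continuous fun P : frontier Ω => ∫ Q, kern n P Q * extendZero f Q ∂(surf Ω) :=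
  haveI := h.isFiniteMeasure_surf
  continuousOn_iff_continuous_domRestrict.1 (h.weaklySingular_surf.continuousOn_integral
    (aestronglyMeasurable_surf (continuousOn_extendZero f.continuous)) (abs_extendZero_le f))

lemma norm_boundaryFun_le (h : HolderConvex Ω n α C) (f : frontier Ω →ᵇ ℝ) (P : frontier Ω) :
    ‖∫ Q, kern n P Q * extendZero f Q ∂(surf Ω)‖ ≤ opConst Ω α C * ‖f‖ :=
  haveI := h.isFiniteMeasure_surf
  h.weaklySingular_surf.abs_integral_le P.2 (norm_nonneg f) (abs_extendZero_le f)

/-- The function `P ↦ ∫ k(P, Q) f(Q) dS_Q` on `∂Ω`. -/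
def boundaryFun (h : HolderConvex Ω n α C) (f : frontier Ω →ᵇ ℝ) : frontier Ω →ᵇ ℝ :=
  BoundedContinuousFunction.ofNormedAddCommGroup _ (h.continuous_boundaryFun f) _
    (h.norm_boundaryFun_le f)

lemma boundaryFun_apply (h : HolderConvex Ω n α C) (f : frontier Ω →ᵇ ℝ) (P : frontier Ω) :
    h.boundaryFun f P = ∫ Q, kern n P Q * extendZero f Q ∂(surf Ω) := rfl

/-- The boundary operator `f ↦ ∫ k(P, Q) f(Q) dS_Q` on `C(∂Ω)`. -/
def boundaryOp (h : HolderConvex Ω n α C) : (frontier Ω →ᵇ ℝ) →L[ℝ] (frontier Ω →ᵇ ℝ) :=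
  LinearMap.mkContinuous
    { toFun := h.boundaryFun
      map_add' := fun f g => by
        have := h.isFiniteMeasure_surf
        ext P
        rw [BoundedContinuousFunction.coe_add, Pi.add_apply]
        simp only [boundaryFun_apply]
        rw [← integral_add (h.weaklySingular_surf.integrable_mul P.2
          (aestronglyMeasurable_surf (continuousOn_extendZero f.continuous)) (abs_extendZero_le f))
          (h.weaklySingular_surf.integrable_mul P.2
          (aestronglyMeasurable_surf (continuousOn_extendZero g.continuous)) (abs_extendZero_le g))]
        refine integral_congr_ae (ae_mem_frontier.mono fun Q hQ => ?_)
        simp only [extendZero_of_mem _ hQ, BoundedContinuousFunction.coe_add, Pi.add_apply,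
          mul_add]
      map_smul' := fun c f => by
        ext P
        simp only [BoundedContinuousFunction.coe_smul, RingHom.id_apply, smul_eq_mul,
          boundaryFun_apply]
        rw [← integral_const_mul]
        refine integral_congr_ae (ae_mem_frontier.mono fun Q hQ => ?_)
        simp only [extendZero_of_mem _ hQ]
        ring }
    (opConst Ω α C)
    fun f => (BoundedContinuousFunction.norm_le
      (mul_nonneg h.opConst_nonneg (norm_nonneg f))).2 (h.norm_boundaryFun_le f)

lemma boundaryOp_apply (h : HolderConvex Ω n α C) (f : frontier Ω →ᵇ ℝ) (P : frontier Ω) :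
    h.boundaryOp f P = ∫ Q, kern n P Q * extendZero f Q ∂(surf Ω) := rfl

/-- Arzelà–Ascoli: the images of the unit ball are uniformly bounded, and their common modulus of
continuity at P₀ is the L¹ distance of the kernels at P and P₀. -/
lemma isCompactOperator_boundaryOp (h : HolderConvex Ω n α C) :
    IsCompactOperator h.boundaryOp := by
  have hfin := h.isFiniteMeasure_surf
  have : CompactSpace (frontier Ω) := isCompact_iff_compactSpace.1 h.isCompact_frontier
  refine (isCompactOperator_iff_isCompact_closure_image_closedBall
    (h.boundaryOp : (frontier Ω →ᵇ ℝ) →ₗ[ℝ] (frontier Ω →ᵇ ℝ)) one_pos).2 ?_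
  refine BoundedContinuousFunction.arzela_ascoli (Metric.closedBall (0 : ℝ) (opConst Ω α C))
    (isCompact_closedBall _ _) _ ?_ ?_
  · rintro _ P ⟨f, hf, rfl⟩
    rw [mem_closedBall_zero_iff] at hf ⊢
    have h1 := h.weaklySingular_surf.abs_integral_le P.2 zero_le_one
      ((abs_extendZero_le f).mono fun Q hQ => hQ.trans hf)
    rw [mul_one] at h1
    exact h1
  · intro P₀
    rw [Metric.equicontinuousAt_iff_right]
    intro ε hε
    have h1 := (ENNReal.tendsto_toReal ENNReal.zero_ne_top).comp
      (h.weaklySingular_surf.tendsto_lintegral_sub P₀.2)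
    have h2 : Tendsto (Subtype.val : frontier Ω → E3) (𝓝 P₀) (𝓝[frontier Ω] P₀) :=
      tendsto_nhdsWithin_iff.2 ⟨continuous_subtype_val.tendsto _,
        Eventually.of_forall fun P => P.2⟩
    filter_upwards [(h1.comp h2).eventually_lt_const (u := ε) (by simpa using hε)]
      with P hP
    rintro ⟨_, f, hf, rfl⟩
    rw [mem_closedBall_zero_iff] at hf
    have h3 := h.weaklySingular_surf.abs_integral_sub_le P.2 P₀.2
      (aestronglyMeasurable_surf (continuousOn_extendZero f.continuous))
      ((abs_extendZero_le f).mono fun Q hQ => hQ.trans hf)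
    rw [mul_one] at h3
    rw [dist_comm, Real.dist_eq]
    exact h3.trans_lt hP

lemma not_hasEigenvalue_boundaryOp (h : HolderConvex Ω n α C) :
    ¬ Module.End.HasEigenvalue
      (h.boundaryOp : Module.End ℝ (frontier Ω →ᵇ ℝ)) (1 / 2 : ℝ) := by
  intro he
  obtain ⟨f, hf⟩ := he.exists_hasEigenvector
  refine hf.2 ?_
  have h1 : h.boundaryOp f = (1 / 2 : ℝ) • f := hf.apply_eq_smul
  ext P
  have h2 := h.eq_zero_of_homogeneous (A := extendZero f) (continuousOn_extendZero f.continuous)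
    (fun P hP => ?_) P.2
  · rwa [extendZero_of_mem _ P.2] at h2
  · have h3 : h.boundaryOp f ⟨P, hP⟩ = ((1 / 2 : ℝ) • f) ⟨P, hP⟩ := by rw [h1]
    rw [boundaryOp_apply] at h3
    rw [h3, extendZero_of_mem _ hP]
    simp only [BoundedContinuousFunction.coe_smul, smul_eq_mul]
    ring

/-- The integral equation of the interior problem is uniquely solvable, with a bound. -/
theorem exists_solution (h : HolderConvex Ω n α C) : ∃ K : ℝ, 0 ≤ K ∧
    (∀ r : E3 → ℝ, ContinuousOn r (frontier Ω) → ∃ A : E3 → ℝ, ContinuousOn A (frontier Ω) ∧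
      ∀ P ∈ frontier Ω, A P / 2 = ∫ Q, kern n P Q * A Q ∂(surf Ω) + r P) ∧
    ∀ A r : E3 → ℝ, ContinuousOn A (frontier Ω) → ContinuousOn r (frontier Ω) →
      (∀ P ∈ frontier Ω, A P / 2 = ∫ Q, kern n P Q * A Q ∂(surf Ω) + r P) →
      ∀ B, 0 ≤ B → (∀ P ∈ frontier Ω, |r P| ≤ B) → ∀ P ∈ frontier Ω, |A P| ≤ K * B := by
  have : CompactSpace (frontier Ω) := isCompact_iff_compactSpace.1 h.isCompact_frontier
  -- For a compact operator the nonzero number 1/2 is an eigenvalue or belongs to the resolvent set.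
  -- In the latter case the norm of the resolvent is the constant K.
  have h1 := (h.isCompactOperator_boundaryOp.hasEigenvalue_or_mem_resolventSet
    (μ := (1 / 2 : ℝ)) (by norm_num)).resolve_left h.not_hasEigenvalue_boundaryOp
  obtain ⟨u, hu⟩ := spectrum.mem_resolventSet_iff.1 h1
  have hu' : ∀ f : frontier Ω →ᵇ ℝ, (u : _ →L[ℝ] _) f = (1 / 2 : ℝ) • f - h.boundaryOp f := by
    intro f
    rw [hu, Algebra.algebraMap_eq_smul_one]
    rfl
  set R : (frontier Ω →ᵇ ℝ) →L[ℝ] (frontier Ω →ᵇ ℝ) := ↑u⁻¹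
  have hR : ∀ f, (u : _ →L[ℝ] _) (R f) = f := fun f =>
    congrArg (fun T : (frontier Ω →ᵇ ℝ) →L[ℝ] _ => T f) u.mul_inv
  have hR' : ∀ f, R ((u : _ →L[ℝ] _) f) = f := fun f =>
    congrArg (fun T : (frontier Ω →ᵇ ℝ) →L[ℝ] _ => T f) u.inv_mul
  refine ⟨‖R‖, norm_nonneg R, fun r hr => ?_, fun A r hA hr hsol B hB hrB P hP => ?_⟩
  · let ρ : frontier Ω →ᵇ ℝ := BoundedContinuousFunction.mkOfCompact
      ⟨(frontier Ω).domRestrict r, continuousOn_iff_continuous_domRestrict.1 hr⟩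
    refine ⟨extendZero (R ρ), continuousOn_extendZero (R ρ).continuous, fun P hP => ?_⟩
    have h2 := congrArg (fun f : frontier Ω →ᵇ ℝ => f ⟨P, hP⟩) ((hu' (R ρ)).symm.trans (hR ρ))
    simp only [BoundedContinuousFunction.coe_sub, BoundedContinuousFunction.coe_smul,
      Pi.sub_apply, smul_eq_mul, boundaryOp_apply] at h2
    have h3 : ρ ⟨P, hP⟩ = r P := rfl
    rw [extendZero_of_mem _ hP]
    linarith
  · let ρ : frontier Ω →ᵇ ℝ := BoundedContinuousFunction.mkOfCompact
      ⟨(frontier Ω).domRestrict r, continuousOn_iff_continuous_domRestrict.1 hr⟩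
    let a : frontier Ω →ᵇ ℝ := BoundedContinuousFunction.mkOfCompact
      ⟨(frontier Ω).domRestrict A, continuousOn_iff_continuous_domRestrict.1 hA⟩
    have h2 : (u : _ →L[ℝ] _) a = ρ := by
      rw [hu']
      ext Q
      simp only [BoundedContinuousFunction.coe_sub, BoundedContinuousFunction.coe_smul,
        Pi.sub_apply, smul_eq_mul, boundaryOp_apply]
      have h3 : ρ Q = r Q := rfl
      have h4 : a Q = A Q := rfl
      have h5 : ∫ Q', kern n Q Q' * extendZero a Q' ∂(surf Ω) =
          ∫ Q', kern n Q Q' * A Q' ∂(surf Ω) := by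
        refine integral_congr_ae (ae_mem_frontier.mono fun Q' hQ' => ?_)
        simp only [extendZero_of_mem _ hQ']
        rfl
      rw [h3, h4, h5]
      linarith [hsol Q Q.2]
    have h3 : a = R ρ := by rw [← h2, hR']
    have h4 : ‖ρ‖ ≤ B := (BoundedContinuousFunction.norm_le hB).2 fun Q => hrB Q Q.2
    calc |A P| = ‖a ⟨P, hP⟩‖ := rfl
      _ ≤ ‖a‖ := a.norm_coe_le_norm _
      _ ≤ ‖R‖ * ‖ρ‖ := by rw [h3]; exact R.le_opNorm ρ
      _ ≤ ‖R‖ * B := by gcongr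

end HolderConvex


/-- Splitting at distance r from P uses the sup bound near the singularity and the L¹ norm away from
it. The right-hand side does not depend on P, so bounded densities converging in L¹ have uniformly
converging potentials. -/
lemma WeaklySingular.abs_integral_le_add {S : Set E3} {μ : Measure E3} {κ : E3 → E3 → ℝ}
    {K d a b : ℝ} (h : WeaklySingular S μ κ K d a b) [IsFiniteMeasure μ] {P : E3} (hP : P ∈ S)
    {φ : E3 → ℝ} (hφ : AEStronglyMeasurable φ μ) {B : ℝ} (hB0 : 0 ≤ B)
    (hB : ∀ᵐ Y ∂μ, |φ Y| ≤ B) {r : ℝ} (hr : 0 < r) :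
    |∫ Y, κ P Y * φ Y ∂μ| ≤ ballConst K d a b * r ^ a * B + b * r ^ (a - d) * ∫ Y, |φ Y| ∂μ := by
  have hφi : Integrable φ μ := Integrable.of_bound hφ B hB
  have hb : MeasurableSet (Metric.closedBall P r) := Metric.isClosed_closedBall.measurableSet
  have hi := h.integrable_mul hP hφ hB
  rw [← integral_add_compl hb hi]
  refine (abs_add_le _ _).trans (add_le_add ?_ ?_)
  · rw [← Real.norm_eq_abs]
    refine (norm_integral_le_of_norm_le (g := fun Y => |κ P Y| * B)
      ((h.integrable hP).abs.mul_const B).integrableOn (ae_restrict_of_ae ?_)).trans ?_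
    · filter_upwards [hB] with Y hY
      rw [norm_mul, Real.norm_eq_abs, Real.norm_eq_abs]
      gcongr
    · rw [integral_mul_const]
      gcongr
      have h1 := h.lintegral_closedBall_le hP hr
      have h2 : ∫ Y in Metric.closedBall P r, |κ P Y| ∂μ =
          (∫⁻ Y in Metric.closedBall P r, ‖κ P Y‖ₑ ∂μ).toReal :=
        integral_norm_eq_lintegral_enorm (h.integrable hP).integrableOn.aestronglyMeasurable
      rw [h2]
      refine ENNReal.toReal_le_of_le_ofReal ?_ h1
      have := h.ballConst_nonneg
      positivity
  · rw [← Real.norm_eq_abs]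
    have h0 : 0 ≤ b * r ^ (a - d) := mul_nonneg h.bound_nonneg (by positivity)
    refine (norm_integral_le_of_norm_le (g := fun Y => b * r ^ (a - d) * |φ Y|)
      (hφi.abs.const_mul _).integrableOn ((ae_restrict_iff' hb.compl).2 ?_)).trans ?_
    · filter_upwards [h.abs_le_of_le hP hr] with Y hY hm
      rw [mem_compl_iff, Metric.mem_closedBall, dist_comm, dist_eq_norm, not_le] at hm
      rw [norm_mul, Real.norm_eq_abs, Real.norm_eq_abs]
      exact mul_le_mul_of_nonneg_right (hY hm.le) (abs_nonneg _)
    · rw [integral_const_mul]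
      exact mul_le_mul_of_nonneg_left
        (setIntegral_le_integral hφi.abs (ae_of_all _ fun Y => abs_nonneg _)) h0

/-! ### The normal derivative A₅ as a function of Z₁ -/

namespace Problem

variable {m : ℕ} {D : Problem m} {α : ℝ≥0}

lemma Standing.exists_holderConvex (hD : D.Standing α) :
    ∃ C : ℝ, HolderConvex (D.Ω : Set E3) D.nrm α C :=
  hD.boundary.holderConvex D.Ω.isOpen hD.bounded hD.connected.nonempty hD.convex
    hD.alpha_pos hD.alpha_le

/-- Measurable functions on `closure Ω` with values bounded by `M`. -/
structure Admissible (D : Problem m) (M : ℝ) (Z : E3 → Idx m → ℝ) : Prop where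
  meas : AEStronglyMeasurable Z (volume.restrict (closure (D.Ω : Set E3)))
  bound : ∀ Y ∈ closure (D.Ω : Set E3), ∀ i, |Z Y i| ≤ M

/-- The estimates are proved for the larger class because limits almost everywhere are only
measurable and satisfy only the non-strict bound. -/
lemma admissible_of_mem_OmegaM {M : ℝ} {Z : E3 → Idx m → ℝ} (hZ : Z ∈ D.OmegaM M) :
    D.Admissible M Z :=
  ⟨hZ.1.aestronglyMeasurable isClosed_closure.measurableSet, fun Y hY i => (hZ.2 Y hY i).le⟩

section Superposition

variable {Φ : (Idx m → ℝ) × E3 → ℝ}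

lemma exists_bound_superposition (hD : D.Standing α)
    (hΦ : ContinuousOn Φ (univ ×ˢ closure (D.Ω : Set E3))) (M : ℝ) :
    ∃ B, 0 ≤ B ∧ ∀ Z, D.Admissible M Z → ∀ Y ∈ closure (D.Ω : Set E3), |Φ (Z Y, Y)| ≤ B := by
  have hK : IsCompact ((univ.pi fun _ : Idx m => Icc (-M) M) ×ˢ closure (D.Ω : Set E3)) :=
    (isCompact_univ_pi fun _ => isCompact_Icc).prod hD.bounded.isCompact_closure
  obtain ⟨B, hB⟩ := hK.exists_bound_of_continuousOn
    (hΦ.mono (prod_mono (subset_univ _) Subset.rfl))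
  refine ⟨max B 0, le_max_right _ _, fun Z hZ Y hY => (hB _ ?_).trans (le_max_left _ _)⟩
  exact ⟨fun i _ => abs_le.1 (hZ.bound Y hY i), hY⟩

lemma aestronglyMeasurable_superposition
    (hΦ : ContinuousOn Φ (univ ×ˢ closure (D.Ω : Set E3))) {Z : E3 → Idx m → ℝ}
    (hZ : AEStronglyMeasurable Z (volume.restrict (closure (D.Ω : Set E3)))) :
    AEStronglyMeasurable (fun Y => Φ (Z Y, Y)) (volume.restrict (closure (D.Ω : Set E3))) := by
  classical
  have hcl : MeasurableSet (closure (D.Ω : Set E3)) := isClosed_closure.measurableSet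
  have hS : MeasurableSet ((univ : Set (Idx m → ℝ)) ×ˢ closure (D.Ω : Set E3)) :=
    MeasurableSet.univ.prod hcl
  -- Continuity is known only over the closure of Ω; extension by zero gives a Borel function on the
  -- whole product.
  have h1 : Measurable ((univ ×ˢ closure (D.Ω : Set E3)).piecewise Φ fun _ => 0) :=
    hΦ.measurable_piecewise continuousOn_const hS
  have h2 : AEMeasurable (fun Y => (Z Y, Y)) (volume.restrict (closure (D.Ω : Set E3))) :=
    hZ.aemeasurable.prodMk aemeasurable_id
  refine ((h1.comp_aemeasurable h2).congr ?_).aestronglyMeasurable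
  filter_upwards [ae_restrict_mem hcl] with Y hY
  exact piecewise_eq_of_mem _ _ _ ⟨mem_univ _, hY⟩

lemma tendsto_superposition (hΦ : ContinuousOn Φ (univ ×ˢ closure (D.Ω : Set E3))) {Y : E3}
    (hY : Y ∈ closure (D.Ω : Set E3)) {z : ℕ → Idx m → ℝ} {l : Idx m → ℝ}
    (hz : Tendsto z atTop (𝓝 l)) : Tendsto (fun k => Φ (z k, Y)) atTop (𝓝 (Φ (l, Y))) := by
  have h1 : Tendsto (fun k => (z k, Y)) atTop (𝓝[univ ×ˢ closure (D.Ω : Set E3)] (l, Y)) :=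
    tendsto_nhdsWithin_iff.2 ⟨hz.prodMk_nhds tendsto_const_nhds,
      Eventually.of_forall fun _ => ⟨mem_univ _, hY⟩⟩
  exact (hΦ (l, Y) ⟨mem_univ _, hY⟩).tendsto.comp h1

end Superposition

lemma continuousOn_f (hD : D.Standing α) (j : Fin m) :
    ContinuousOn (fun p : (Idx m → ℝ) × E3 => D.f p.1 p.2 j)
      (univ ×ˢ closure (D.Ω : Set E3)) :=
  (continuous_apply j).comp_continuousOn hD.f_cont

lemma continuousOn_jetValue (hD : D.Standing α) (q : Fin 10 × Fin m) :
    ContinuousOn (fun p : (Idx m → ℝ) × E3 => D.jetValue p.2 p.1 q)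
      (univ ×ˢ closure (D.Ω : Set E3)) := by
  unfold jetValue
  refine Fin.cases ?_ (fun l => ?_) (D.v.symm q).1
  · exact continuousOn_f hD _
  · exact ((continuous_apply _).comp continuous_fst).continuousOn

lemma continuousOn_psi₁ (hD : D.Standing α) (k : Fin m) :
    ContinuousOn (fun p : (Idx m → ℝ) × E3 => D.psi₁ p.2 p.1 k)
      (univ ×ˢ closure (D.Ω : Set E3)) :=
  (((continuousOn_jetValue hD _).add (continuousOn_jetValue hD _)).add
    (continuousOn_jetValue hD _)).neg

lemma continuousOn_psi (hD : D.Standing α) (j : Fin m) :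
    ContinuousOn (fun p : (Idx m → ℝ) × E3 => D.psi p.2 p.1 j)
      (univ ×ˢ closure (D.Ω : Set E3)) :=
  (continuousOn_f hD j).sub (Continuous.continuousOn (by fun_prop))

/-- The volume potential in the boundary integral equation. -/
def volumeTerm (D : Problem m) (Z : E3 → Idx m → ℝ) (k : Fin m) (P : E3) : ℝ :=
  ∫ Y in closure (D.Ω : Set E3), kern D.nrm P Y * D.psi₁ Y (Z Y) k

section NormalDerivative

variable {C M : ℝ}

lemma ae_abs_psi₁_le {B : ℝ} {Z : E3 → Idx m → ℝ} {k : Fin m}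
    (hB : ∀ Y ∈ closure (D.Ω : Set E3), |D.psi₁ Y (Z Y) k| ≤ B) :
    ∀ᵐ Y ∂(volume.restrict (closure (D.Ω : Set E3))), |D.psi₁ Y (Z Y) k| ≤ B :=
  (ae_restrict_mem isClosed_closure.measurableSet).mono hB

lemma continuousOn_volumeTerm (hD : D.Standing α) (h : HolderConvex (D.Ω : Set E3) D.nrm α C)
    {Z : E3 → Idx m → ℝ} (hZ : D.Admissible M Z) (k : Fin m) :
    ContinuousOn (D.volumeTerm Z k) (frontier (D.Ω : Set E3)) := by
  have := h.isFiniteMeasure_volume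
  obtain ⟨B, -, hB⟩ := exists_bound_superposition hD (continuousOn_psi₁ hD k) M
  exact h.weaklySingular_volume.continuousOn_integral
    (aestronglyMeasurable_superposition (continuousOn_psi₁ hD k) hZ.meas)
    (ae_abs_psi₁_le (hB Z hZ))

lemma exists_bound_volumeTerm (hD : D.Standing α) (h : HolderConvex (D.Ω : Set E3) D.nrm α C)
    (M : ℝ) (k : Fin m) : ∃ B, 0 ≤ B ∧ ∀ Z, D.Admissible M Z →
      ∀ P ∈ frontier (D.Ω : Set E3), |D.volumeTerm Z k P| ≤ B := by
  have := h.isFiniteMeasure_volume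
  obtain ⟨B, hB0, hB⟩ := exists_bound_superposition hD (continuousOn_psi₁ hD k) M
  have W := h.weaklySingular_volume
  refine ⟨_, mul_nonneg ?_ hB0, fun Z hZ P hP =>
    W.abs_integral_le hP hB0 (ae_abs_psi₁_le (hB Z hZ))⟩
  exact add_nonneg W.ballConst_nonneg (mul_nonneg W.bound_nonneg measureReal_nonneg)

/-- First fix r so small that the part near the singularity is at most ε/2 for all k and P. Then the
L¹ convergence of the densities, from dominated convergence, takes care of the rest uniformly in P.
-/
lemma eventually_abs_volumeTerm_sub_le (hD : D.Standing α)
    (h : HolderConvex (D.Ω : Set E3) D.nrm α C) {Z : ℕ → E3 → Idx m → ℝ} {Zs : E3 → Idx m → ℝ}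
    (hZ : ∀ k, D.Admissible M (Z k)) (hZs : D.Admissible M Zs)
    (hlim : ∀ᵐ Y ∂(volume.restrict (closure (D.Ω : Set E3))),
      Tendsto (fun k => Z k Y) atTop (𝓝 (Zs Y))) (j : Fin m) {ε : ℝ} (hε : 0 < ε) :
    ∀ᶠ k in atTop, ∀ P ∈ frontier (D.Ω : Set E3),
      |D.volumeTerm (Z k) j P - D.volumeTerm Zs j P| ≤ ε := by
  have := h.isFiniteMeasure_volume
  have W := h.weaklySingular_volume
  have hc := continuousOn_psi₁ hD j
  obtain ⟨B, hB0, hB⟩ := exists_bound_superposition hD hc M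
  have hmk := fun k => aestronglyMeasurable_superposition hc (hZ k).meas
  have hms := aestronglyMeasurable_superposition hc hZs.meas
  have hbd : ∀ k, ∀ᵐ Y ∂(volume.restrict (closure (D.Ω : Set E3))),
      |D.psi₁ Y (Z k Y) j - D.psi₁ Y (Zs Y) j| ≤ 2 * B := fun k => by
    filter_upwards [ae_abs_psi₁_le (hB _ (hZ k)), ae_abs_psi₁_le (hB _ hZs)] with Y h1 h2
    exact (abs_sub _ _).trans (by linarith)
  have hL1 : Tendsto (fun k => ∫ Y in closure (D.Ω : Set E3),
      |D.psi₁ Y (Z k Y) j - D.psi₁ Y (Zs Y) j|) atTop (𝓝 0) := by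
    rw [← integral_zero E3 ℝ (μ := volume.restrict (closure (D.Ω : Set E3)))]
    refine tendsto_integral_of_dominated_convergence (fun _ => 2 * B)
      (fun k => ((hmk k).sub hms).norm) (integrable_const _) (fun k => ?_) ?_
    · filter_upwards [hbd k] with Y hY
      rwa [Real.norm_eq_abs, abs_abs]
    · filter_upwards [hlim, ae_restrict_mem isClosed_closure.measurableSet] with Y hY hYm
      have := ((tendsto_superposition hc hYm hY).sub_const (D.psi₁ Y (Zs Y) j)).abs
      simpa using this
  obtain ⟨r, hr, hrε⟩ : ∃ r : ℝ, 0 < r ∧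
      WeaklySingular.ballConst (Real.pi * 4 / 3) 3 1 (1 / (4 * Real.pi)) * r ^ (1 : ℝ) * (2 * B)
        ≤ ε / 2 := by
    set c := WeaklySingular.ballConst (Real.pi * 4 / 3) 3 1 (1 / (4 * Real.pi))
    have hc0 : 0 ≤ c := W.ballConst_nonneg
    have hpos : 0 < c * (2 * B) + 1 := by positivity
    refine ⟨ε / 2 / (c * (2 * B) + 1), by positivity, ?_⟩
    rw [Real.rpow_one, mul_right_comm, mul_div_assoc', div_le_iff₀ hpos]
    nlinarith
  set c' := 1 / (4 * Real.pi) * r ^ (1 - 3 : ℝ)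
  have hc' : 0 < c' := by positivity
  filter_upwards [hL1.eventually_lt_const (u := ε / 2 / c') (by positivity)] with k hk P hP
  have h1 := W.abs_integral_le_add hP ((hmk k).sub hms) (by positivity) (hbd k) hr
  have h2 : D.volumeTerm (Z k) j P - D.volumeTerm Zs j P =
      ∫ Y in closure (D.Ω : Set E3), kern D.nrm P Y *
        (D.psi₁ Y (Z k Y) j - D.psi₁ Y (Zs Y) j) := by
    rw [volumeTerm, volumeTerm, ← integral_sub (W.integrable_mul hP (hmk k)
      (ae_abs_psi₁_le (hB _ (hZ k)))) (W.integrable_mul hP hms (ae_abs_psi₁_le (hB _ hZs)))]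
    simp only [mul_sub]
  rw [h2]
  refine h1.trans ?_
  rw [lt_div_iff₀ hc'] at hk
  have h3 : c' * ∫ Y in closure (D.Ω : Set E3), |D.psi₁ Y (Z k Y) j - D.psi₁ Y (Zs Y) j|
      ≤ ε / 2 := by rw [mul_comm]; exact hk.le
  exact (add_le_add hrε h3).trans (by linarith)

lemma isNormalDeriv_iff {Z : E3 → Idx m → ℝ} {A : E3 → Fin m → ℝ} :
    D.IsNormalDeriv Z A ↔ ContinuousOn A (frontier (D.Ω : Set E3)) ∧
      ∀ k, ∀ P ∈ frontier (D.Ω : Set E3), A P k / 2 =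
        ∫ Q, kern D.nrm P Q * A Q k ∂(surf (D.Ω : Set E3)) +
          (D.g02 k P + D.volumeTerm Z k P) := by
  refine and_congr Iff.rfl ⟨fun H k P hP => ?_, fun H P hP k => ?_⟩
  · rw [H P hP k, add_assoc]; rfl
  · rw [H k P hP, ← add_assoc]; rfl

lemma isNormalDeriv_A5 {Z : E3 → Idx m → ℝ} (h : ∃ A, D.IsNormalDeriv Z A) :
    D.IsNormalDeriv Z (D.A5 Z) := by
  rw [A5, dif_pos h]; exact h.choose_spec

lemma exists_isNormalDeriv (hD : D.Standing α) (h : HolderConvex (D.Ω : Set E3) D.nrm α C)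
    (hg : ∀ k, ContinuousOn (D.g02 k) (frontier (D.Ω : Set E3))) {Z : E3 → Idx m → ℝ}
    (hZ : D.Admissible M Z) : ∃ A, D.IsNormalDeriv Z A := by
  obtain ⟨K, -, hex, -⟩ := h.exists_solution
  choose A hA hsol using fun k => hex _ ((hg k).add (continuousOn_volumeTerm hD h hZ k))
  exact ⟨fun P k => A k P, isNormalDeriv_iff.2 ⟨continuousOn_pi.2 hA, hsol⟩⟩

/-- Every other term of the integral equation is continuous. Hence a single solution for a single Z
forces continuity of the fixed term. -/
lemma continuousOn_g02 (hD : D.Standing α) (h : HolderConvex (D.Ω : Set E3) D.nrm α C)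
    {Z : E3 → Idx m → ℝ} (hZ : D.Admissible M Z) {A : E3 → Fin m → ℝ}
    (hA : D.IsNormalDeriv Z A) (k : Fin m) :
    ContinuousOn (D.g02 k) (frontier (D.Ω : Set E3)) := by
  have := h.isFiniteMeasure_surf
  obtain ⟨hAc, hsol⟩ := isNormalDeriv_iff.1 hA
  have hAk : ContinuousOn (fun P => A P k) (frontier (D.Ω : Set E3)) :=
    (continuous_apply k).comp_continuousOn hAc
  obtain ⟨B, hB⟩ := h.isCompact_frontier.exists_bound_of_continuousOn hAk
  have h1 := h.weaklySingular_surf.continuousOn_integral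
    (HolderConvex.aestronglyMeasurable_surf hAk) (HolderConvex.ae_mem_frontier.mono hB)
  refine (((hAk.div_const 2).sub h1).sub (continuousOn_volumeTerm hD h hZ k)).congr
    fun P hP => ?_
  have := hsol k P hP
  simp only [Pi.sub_apply]
  linarith

/-- The normal derivative `A_5(Z₁)` is bounded uniformly for bounded `Z₁`. -/
theorem exists_bound_A5 (hD : D.Standing α) (h : HolderConvex (D.Ω : Set E3) D.nrm α C) (M : ℝ) :
    ∃ B, 0 ≤ B ∧ ∀ Z, D.Admissible M Z →
      ContinuousOn (D.A5 Z) (frontier (D.Ω : Set E3)) ∧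
      ∀ P ∈ frontier (D.Ω : Set E3), ∀ k, |D.A5 Z P k| ≤ B := by
  -- No regularity of the double layer potential is needed. If `g02` is continuous, the equation is
  -- solvable with a bound for every admissible Z; if not, it is solvable for none, and `A5` takes
  -- its default value 0 throughout.
  by_cases hg : ∀ k, ContinuousOn (D.g02 k) (frontier (D.Ω : Set E3))
  · obtain ⟨K, hK, -, hbd⟩ := h.exists_solution
    choose B₁ hB₁ using fun k => h.isCompact_frontier.exists_bound_of_continuousOn (hg k)
    choose B₂ hB₂0 hB₂ using exists_bound_volumeTerm hD h M
    have hB0 : ∀ k, 0 ≤ |B₁ k| + B₂ k := fun k => add_nonneg (abs_nonneg _) (hB₂0 k)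
    refine ⟨∑ k, K * (|B₁ k| + B₂ k), Finset.sum_nonneg fun k _ => mul_nonneg hK (hB0 k),
      fun Z hZ => ?_⟩
    obtain ⟨hc, hsol⟩ := isNormalDeriv_iff.1 (isNormalDeriv_A5 (exists_isNormalDeriv hD h hg hZ))
    refine ⟨hc, fun P hP k => ?_⟩
    have h1 := hbd (fun P => D.A5 Z P k) _ ((continuous_apply k).comp_continuousOn hc)
      ((hg k).add (continuousOn_volumeTerm hD h hZ k)) (hsol k) _ (hB0 k)
      (fun P hP => (abs_add_le _ _).trans
        (add_le_add ((hB₁ k P hP).trans (le_abs_self _)) (hB₂ k Z hZ P hP))) P hP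
    exact h1.trans (Finset.single_le_sum (f := fun k => K * (|B₁ k| + B₂ k))
      (fun k _ => mul_nonneg hK (hB0 k)) (Finset.mem_univ k))
  · refine ⟨0, le_rfl, fun Z hZ => ?_⟩
    have h0 : D.A5 Z = 0 := by
      rw [A5, dif_neg]
      rintro ⟨A, hA⟩
      exact hg (continuousOn_g02 hD h hZ hA)
    rw [h0]
    exact ⟨continuousOn_const, fun P _ k => by simp⟩

/-- The normal derivative `A_5(Z₁)` depends continuously on `Z₁`. -/
theorem tendsto_A5 (hD : D.Standing α) (h : HolderConvex (D.Ω : Set E3) D.nrm α C)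
    {Z : ℕ → E3 → Idx m → ℝ} {Zs : E3 → Idx m → ℝ} (hZ : ∀ k, D.Admissible M (Z k))
    (hZs : D.Admissible M Zs)
    (hlim : ∀ᵐ Y ∂(volume.restrict (closure (D.Ω : Set E3))),
      Tendsto (fun k => Z k Y) atTop (𝓝 (Zs Y))) {P : E3} (hP : P ∈ frontier (D.Ω : Set E3))
    (j : Fin m) : Tendsto (fun k => D.A5 (Z k) P j) atTop (𝓝 (D.A5 Zs P j)) := by
  have hfin := h.isFiniteMeasure_surf
  by_cases hg : ∀ k, ContinuousOn (D.g02 k) (frontier (D.Ω : Set E3))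
  · obtain ⟨K, hK, -, hbd⟩ := h.exists_solution
    rw [Metric.tendsto_nhds]
    intro ε hε
    have hpos : 0 < K + 1 := by linarith
    filter_upwards [eventually_abs_volumeTerm_sub_le hD h hZ hZs hlim j
      (show 0 < ε / (K + 1) by positivity)] with k hk
    obtain ⟨hc, hsol⟩ :=
      isNormalDeriv_iff.1 (isNormalDeriv_A5 (exists_isNormalDeriv hD h hg (hZ k)))
    obtain ⟨hcs, hsols⟩ :=
      isNormalDeriv_iff.1 (isNormalDeriv_A5 (exists_isNormalDeriv hD h hg hZs))
    have hc' : ContinuousOn (fun P => D.A5 (Z k) P j) (frontier (D.Ω : Set E3)) :=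
      (continuous_apply j).comp_continuousOn hc
    have hcs' : ContinuousOn (fun P => D.A5 Zs P j) (frontier (D.Ω : Set E3)) :=
      (continuous_apply j).comp_continuousOn hcs
    have hint : ∀ (A : E3 → ℝ), ContinuousOn A (frontier (D.Ω : Set E3)) →
        ∀ P ∈ frontier (D.Ω : Set E3),
          Integrable (fun Q => kern D.nrm P Q * A Q) (surf (D.Ω : Set E3)) := by
      intro A hA P hP
      obtain ⟨B, hB⟩ := h.isCompact_frontier.exists_bound_of_continuousOn hA
      exact h.weaklySingular_surf.integrable_mul hP
        (HolderConvex.aestronglyMeasurable_surf hA) (HolderConvex.ae_mem_frontier.mono hB)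
    -- The term `g02` cancels in the difference, which solves the equation with the difference of
    -- the volume potentials as right-hand side.
    have h1 := hbd (fun P => D.A5 (Z k) P j - D.A5 Zs P j)
      (fun P => D.volumeTerm (Z k) j P - D.volumeTerm Zs j P) (hc'.sub hcs')
      ((continuousOn_volumeTerm hD h (hZ k) j).sub (continuousOn_volumeTerm hD h hZs j))
      (fun P hP => by
        simp only [mul_sub]
        rw [integral_sub (hint _ hc' P hP) (hint _ hcs' P hP)]
        linarith [hsol j P hP, hsols j P hP]) _ (by positivity) hk P hP
    rw [Real.dist_eq]
    refine h1.trans_lt ?_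
    rw [mul_div_assoc', div_lt_iff₀ hpos]
    nlinarith
  · have h0 : ∀ Z, D.Admissible M Z → D.A5 Z = 0 := by
      intro Z hZ
      rw [A5, dif_neg]
      rintro ⟨A, hA⟩
      exact hg (continuousOn_g02 hD h hZ hA)
    simp only [h0 _ (hZ _), h0 _ hZs]
    exact tendsto_const_nhds

end NormalDerivative

end Problem


/-! ### Fourier integrals of functions on the domain and on its boundary -/

/-- `e^{-i X·ξ}`. -/
def char (ξ X : E3) : ℂ := Complex.exp (-Complex.I * (⟪X, ξ⟫ : ℝ))

lemma norm_char (ξ X : E3) : ‖char ξ X‖ = 1 := by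
  rw [char, show -Complex.I * ((⟪X, ξ⟫ : ℝ) : ℂ) = ((-⟪X, ξ⟫ : ℝ) : ℂ) * Complex.I by
    push_cast; ring, Complex.norm_exp_ofReal_mul_I]

lemma continuous_char : Continuous fun p : E3 × E3 => char p.1 p.2 := by
  unfold char; fun_prop

lemma continuous_char_left (X : E3) : Continuous fun ξ => char ξ X :=
  continuous_char.comp (continuous_id.prodMk continuous_const)

lemma continuous_char_right (ξ : E3) : Continuous (char ξ) :=
  continuous_char.comp (continuous_const.prodMk continuous_id)

/-- `∫ b(X) e^{-i X·ξ} dμ(X)`. -/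
def charInt (μ : Measure E3) (b : E3 → ℝ) (ξ : E3) : ℂ := ∫ X, (b X : ℂ) * char ξ X ∂μ

section CharInt

variable {μ : Measure E3}

lemma integrable_mul_char {b : E3 → ℝ} (hb : Integrable b μ) (ξ : E3) :
    Integrable (fun X => (b X : ℂ) * char ξ X) μ :=
  hb.ofReal.mul_bdd (c := 1) (continuous_char_right ξ).aestronglyMeasurable
    (ae_of_all _ fun X => (norm_char ξ X).le)

lemma norm_charInt_le (b : E3 → ℝ) (ξ : E3) : ‖charInt μ b ξ‖ ≤ ∫ X, |b X| ∂μ := by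
  refine (norm_integral_le_integral_norm _).trans (le_of_eq ?_)
  simp only [norm_mul, norm_char, mul_one, Complex.norm_real, Real.norm_eq_abs]

lemma norm_charInt_le_of_bound [IsFiniteMeasure μ] {b : E3 → ℝ} {B : ℝ}
    (hB : ∀ᵐ X ∂μ, |b X| ≤ B) (ξ : E3) : ‖charInt μ b ξ‖ ≤ B * μ.real univ := by
  refine norm_integral_le_of_norm_le_const ?_
  filter_upwards [hB] with X hX
  rwa [norm_mul, norm_char, mul_one, Complex.norm_real, Real.norm_eq_abs]

lemma continuous_charInt {b : E3 → ℝ} (hb : Integrable b μ) : Continuous (charInt μ b) := by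
  refine continuous_of_dominated (bound := fun X => |b X|)
    (fun ξ => (integrable_mul_char hb ξ).aestronglyMeasurable) (fun ξ => ae_of_all _ fun X => ?_)
    hb.abs (ae_of_all _ fun X => continuous_const.mul (continuous_char_left X))
  rw [norm_mul, norm_char, mul_one, Complex.norm_real, Real.norm_eq_abs]

lemma tendsto_charInt [IsFiniteMeasure μ] {b : ℕ → E3 → ℝ} {b' : E3 → ℝ} {B : ℝ}
    (hm : ∀ k, AEStronglyMeasurable (b k) μ) (hB : ∀ k, ∀ᵐ X ∂μ, |b k X| ≤ B)
    (hlim : ∀ᵐ X ∂μ, Tendsto (fun k => b k X) atTop (𝓝 (b' X))) (ξ : E3) :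
    Tendsto (fun k => charInt μ (b k) ξ) atTop (𝓝 (charInt μ b' ξ)) := by
  refine tendsto_integral_of_dominated_convergence (fun _ => B)
    (fun k => (Complex.continuous_ofReal.comp_aestronglyMeasurable (hm k)).mul
      (continuous_char_right ξ).aestronglyMeasurable) (integrable_const _) (fun k => ?_) ?_
  · filter_upwards [hB k] with X hX
    rwa [norm_mul, norm_char, mul_one, Complex.norm_real, Real.norm_eq_abs]
  · filter_upwards [hlim] with X hX
    exact ((Complex.continuous_ofReal.tendsto _).comp hX).mul_const _

end CharInt

lemma contDiff_char (ξ : E3) : ContDiff ℝ 1 (char ξ) := by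
  unfold char
  exact ((contDiff_const.mul (Complex.ofRealCLM.contDiff.comp
    (contDiff_id.inner ℝ contDiff_const)))).cexp

lemma inner_basisVec_left (j : Fin 3) (ξ : E3) : ⟪basisVec j, ξ⟫ = ξ j := by
  simp [basisVec, EuclideanSpace.inner_single_left]

lemma fderiv_char (ξ X : E3) (j : Fin 3) :
    fderiv ℝ (char ξ) X (basisVec j) = -Complex.I * ξ j * char ξ X := by
  have h1 : HasFDerivAt (fun X : E3 => ⟪X, ξ⟫) (innerSL ℝ ξ) X := by
    have := (innerSL ℝ ξ).hasFDerivAt (x := X)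
    refine this.congr_of_eventuallyEq (Eventually.of_forall fun Y => ?_)
    simp [real_inner_comm]
  have h2 : HasFDerivAt (char ξ) (char ξ X • (-Complex.I) •
      (Complex.ofRealCLM.comp (innerSL ℝ ξ))) X :=
    (((Complex.ofRealCLM.hasFDerivAt).comp X h1).const_mul (-Complex.I)).cexp
  rw [h2.fderiv]
  simp only [smul_apply, ContinuousLinearMap.comp_apply, innerSL_apply_apply,
    Complex.ofRealCLM_apply, smul_eq_mul]
  rw [real_inner_comm, inner_basisVec_left]
  ring

namespace HolderConvex

variable {Ω : Set E3} {n : E3 → E3} {α C : ℝ}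

lemma integrableOn_of_continuous (h : HolderConvex Ω n α C) {b : E3 → ℝ} (hb : Continuous b) :
    IntegrableOn b Ω :=
  (hb.continuousOn.integrableOn_compact h.bounded.isCompact_closure).mono_set subset_closure

lemma continuous_pderiv {b : E3 → ℝ} (hb : ContDiff ℝ 1 b) (j : Fin 3) : Continuous (pderiv j b) :=
  (hb.continuous_fderiv one_ne_zero).clm_apply continuous_const

/-- Integration by parts in the Fourier integral. -/
lemma surface_charInt (h : HolderConvex Ω n α C) {b : E3 → ℝ} (hb : ContDiff ℝ 1 b) (j : Fin 3)
    (ξ : E3) : charInt (surf Ω) (fun P => b P * n P j) ξ =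
      charInt (volume.restrict Ω) (pderiv j b) ξ -
        Complex.I * ξ j * charInt (volume.restrict Ω) b ξ := by
  have hF : ContDiff ℝ 1 fun X => (b X : ℂ) * char ξ X :=
    (Complex.ofRealCLM.contDiff.comp hb).mul (contDiff_char ξ)
  have h1 := h.integral_fderiv_eq j hF
  have h2 : ∀ X, fderiv ℝ (fun X => (b X : ℂ) * char ξ X) X (basisVec j) =
      (pderiv j b X : ℂ) * char ξ X - Complex.I * ξ j * ((b X : ℂ) * char ξ X) := by
    intro X
    have hb' : HasFDerivAt (fun X => (b X : ℂ)) (Complex.ofRealCLM.comp (fderiv ℝ b X)) X :=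
      Complex.ofRealCLM.hasFDerivAt.comp X (hb.differentiable one_ne_zero X).hasFDerivAt
    have hc := ((contDiff_char ξ).differentiable one_ne_zero X).hasFDerivAt
    have h3 : HasFDerivAt (fun X => (b X : ℂ) * char ξ X) _ X := hb'.mul hc
    rw [h3.fderiv]
    simp only [add_apply, smul_apply, fderiv_char,
      ContinuousLinearMap.comp_apply, Complex.ofRealCLM_apply, smul_eq_mul, pderiv]
    ring
  simp only [h2] at h1
  rw [integral_sub (integrable_mul_char (h.integrableOn_of_continuous (continuous_pderiv hb j)) ξ)
    ((integrable_mul_char (h.integrableOn_of_continuous hb.continuous) ξ).const_mul _),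
    integral_const_mul] at h1
  rw [charInt, charInt, charInt, h1]
  refine integral_congr_ae (ae_of_all _ fun P => ?_)
  simp only [Complex.real_smul]
  push_cast
  ring

end HolderConvex

/-! ### The matrix B and jets -/

namespace Problem

variable {m : ℕ} {D : Problem m} {α : ℝ≥0} {C M : ℝ}

/-- The symbols at the frequency `ξ`. -/
def symbAt (ξ : E3) (l : Fin 9) : ℂ :=
  MvPolynomial.eval (fun j => Complex.I * (ξ j : ℂ)) (symb l)

lemma atFreq_B₁ (ξ : E3) (r i : Idx m) :
    atFreq D.B₁ ξ r i = symbAt ξ r.1 * D.jetZ (0, r.2) i - D.jetZ (r.1.succ, r.2) i := by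
  simp [atFreq, B₁, symbAt]

lemma atFreq_B₂ (ξ : E3) (r : Idx m) (j : Fin m) :
    atFreq D.B₂ ξ r j = -(symbAt ξ r.1 * D.jetS (0, r.2) j - D.jetS (r.1.succ, r.2) j) := by
  simp [atFreq, B₂, symbAt]

/-- The values of `Z₁` for the jet `J`. -/
def ofJetZ (D : Problem m) (J : Fin 10 × Fin m → ℂ) (i : Idx m) : ℂ := J (D.v (i.1.succ, i.2))

/-- The values of `S` for the jet `J`. -/
def ofJetS (D : Problem m) (J : Fin 10 × Fin m → ℂ) (j : Fin m) : ℂ :=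
  J (D.v (0, j)) - ∑ i, (D.c j i : ℂ) * D.ofJetZ J i

lemma jet_eq (J : Fin 10 × Fin m → ℂ) (q : Fin 10 × Fin m) :
    ∑ i, (D.jetZ q i : ℂ) * D.ofJetZ J i + ∑ j, (D.jetS q j : ℂ) * D.ofJetS J j = J q := by
  obtain ⟨⟨p, k⟩, rfl⟩ := D.v.surjective q
  unfold jetZ jetS
  rw [Equiv.symm_apply_apply]
  refine Fin.cases ?_ (fun l => ?_) p
  · simp [Pi.single_apply, ofJetS, ofJetZ, apply_ite Complex.ofReal]
  · simp [Pi.single_apply, ofJetZ, apply_ite Complex.ofReal]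

/-- For an arbitrary jet, B measures the failure of its entries to be symbols times the zero-order
entry. Any jet with prescribed defect thus gives a preimage under B. -/
lemma mulVec_jet (ξ : E3) (J : Fin 10 × Fin m → ℂ) (r : Idx m) :
    (atFreq D.B₁ ξ).mulVec (D.ofJetZ J) r - (atFreq D.B₂ ξ).mulVec (D.ofJetS J) r =
      symbAt ξ r.1 * J (0, r.2) - J (r.1.succ, r.2) := by
  rw [← jet_eq (D := D) J (0, r.2), ← jet_eq (D := D) J (r.1.succ, r.2)]
  simp only [Matrix.mulVec, dotProduct, atFreq_B₁, atFreq_B₂, mul_add, Finset.mul_sum, sub_mul,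
    neg_mul, Finset.sum_sub_distrib, Finset.sum_neg_distrib, mul_assoc]
  ring

/-- `B_1⁻¹` applied to the symbol of the jet of `G` is controlled by `B_1⁻¹B_2`. -/
lemma norm_B₁inv_symb_le (D : Problem m) : ∃ K : ℝ, 0 ≤ K ∧ ∀ (ξ : E3) (G : Fin m → ℂ) (R : ℝ),
    (∀ k, ‖G k‖ ≤ R) → ∀ i, ‖(D.B₁inv ξ).mulVec (fun r => symbAt ξ r.1 * G r.2) i‖ ≤
      R * (K * (1 + ∑ j, ‖D.B₁invB₂ ξ i j‖)) := by
  refine ⟨1 + ∑ j, ∑ i, |D.c j i|, by positivity, fun ξ G R hG i => ?_⟩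
  set K : ℝ := 1 + ∑ j, ∑ i, |D.c j i|
  have hK : 1 ≤ K := le_add_of_nonneg_right (by positivity)
  rcases isEmpty_or_nonempty (Fin m) with hm | hm
  · exact (IsEmpty.false i.2).elim
  have hR : 0 ≤ R := (norm_nonneg _).trans (hG hm.some)
  -- The defect of this jet is exactly the symbol vector, while its coordinates Z and S are bounded
  -- independently of ξ. Applying B₁⁻¹ gives Z − B₁⁻¹B₂S, with no growing factor left.
  set J : Fin 10 × Fin m → ℂ := fun q => if q.1 = 0 then G q.2 else 0
  have hJ : ∀ q, ‖J q‖ ≤ R := by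
    intro q
    by_cases h : q.1 = 0
    · simpa [J, h] using hG q.2
    · simpa [J, h] using hR
  have hZ : ∀ i, ‖D.ofJetZ J i‖ ≤ R := fun i => hJ _
  have hS : ∀ j, ‖D.ofJetS J j‖ ≤ R * K := by
    intro j
    refine (norm_sub_le _ _).trans ?_
    have h1 : ‖∑ i, (D.c j i : ℂ) * D.ofJetZ J i‖ ≤ ∑ i, |D.c j i| * R := by
      refine (norm_sum_le _ _).trans (Finset.sum_le_sum fun i _ => ?_)
      rw [norm_mul, Complex.norm_real, Real.norm_eq_abs]
      exact mul_le_mul_of_nonneg_left (hZ i) (abs_nonneg _)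
    have h2 : ∑ i, |D.c j i| ≤ ∑ j, ∑ i, |D.c j i| :=
      Finset.single_le_sum (f := fun j => ∑ i, |D.c j i|) (fun j _ => by positivity)
        (Finset.mem_univ j)
    rw [← Finset.sum_mul] at h1
    have h3 := mul_le_mul_of_nonneg_right h2 hR
    have h4 := hJ (D.v (0, j))
    simp only [K]
    nlinarith
  have hσ : (fun r : Idx m => symbAt ξ r.1 * G r.2) =
      (atFreq D.B₁ ξ).mulVec (D.ofJetZ J) - (atFreq D.B₂ ξ).mulVec (D.ofJetS J) := by
    ext r
    rw [Pi.sub_apply, mulVec_jet]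
    simp [J, Fin.succ_ne_zero]
  by_cases hdet : IsUnit (atFreq D.B₁ ξ).det
  · have h1 : (D.B₁inv ξ).mulVec (fun r => symbAt ξ r.1 * G r.2) i =
        D.ofJetZ J i - (D.B₁invB₂ ξ).mulVec (D.ofJetS J) i := by
      rw [hσ, Matrix.mulVec_sub, Matrix.mulVec_mulVec, Matrix.mulVec_mulVec, B₁inv,
        Matrix.nonsing_inv_mul _ hdet, Matrix.one_mulVec]
      rfl
    rw [h1]
    refine (norm_sub_le _ _).trans ?_
    have h2 : ‖(D.B₁invB₂ ξ).mulVec (D.ofJetS J) i‖ ≤ ∑ j, ‖D.B₁invB₂ ξ i j‖ * (R * K) := by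
      change ‖∑ j, D.B₁invB₂ ξ i j * D.ofJetS J j‖ ≤ _
      refine (norm_sum_le _ _).trans (Finset.sum_le_sum fun j _ => ?_)
      rw [norm_mul]
      exact mul_le_mul_of_nonneg_left (hS j) (norm_nonneg _)
    rw [← Finset.sum_mul] at h2
    have h3 := hZ i
    have h4 : R * 1 ≤ R * K := mul_le_mul_of_nonneg_left hK hR
    linarith
  -- Where B₁(ξ) is singular, the inverse is 0 by convention and the estimate is trivial.
  · have h1 : D.B₁inv ξ = 0 := Matrix.nonsing_inv_apply_not_isUnit _ hdet
    rw [h1, Matrix.zero_mulVec, Pi.zero_apply, norm_zero]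
    positivity

end Problem


/-! ### Bounds and limits of the boundary vector β₁ -/

namespace Problem

variable {m : ℕ} {D : Problem m} {α : ℝ≥0} {C M : ℝ}

lemma contDiff_data (hD : D.Standing α) (k : Fin m) : ContDiff ℝ 2 fun X => D.A X k :=
  (contDiff_apply ℝ ℝ k).comp hD.data

lemma contDiff_pderiv_data (hD : D.Standing α) (j : Fin 3) (k : Fin m) :
    ContDiff ℝ 1 (pderiv j fun X => D.A X k) :=
  ((contDiff_data hD k).fderiv_right (m := 1) (by norm_num)).clm_apply contDiff_const

lemma continuousOn_coord_nrm (h : HolderConvex (D.Ω : Set E3) D.nrm α C) (j : Fin 3) :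
    ContinuousOn (fun P => D.nrm P j) (frontier (D.Ω : Set E3)) :=
  (EuclideanSpace.proj (𝕜 := ℝ) j).continuous.comp_continuousOn h.continuousOn_normal

lemma continuousOn_normal_deriv_data (hD : D.Standing α)
    (h : HolderConvex (D.Ω : Set E3) D.nrm α C) (k : Fin m) :
    ContinuousOn (fun P => fderiv ℝ (fun X => D.A X k) P (D.nrm P))
      (frontier (D.Ω : Set E3)) :=
  ((contDiff_data hD k).continuous_fderiv two_ne_zero).continuousOn.clm_apply h.continuousOn_normal

lemma continuousOn_gradTrace (hD : D.Standing α) (h : HolderConvex (D.Ω : Set E3) D.nrm α C)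
    {Z : E3 → Idx m → ℝ} (hZ : D.Admissible M Z) (j : Fin 3) (k : Fin m) :
    ContinuousOn (D.gradTrace Z j k) (frontier (D.Ω : Set E3)) := by
  obtain ⟨B, -, hB⟩ := exists_bound_A5 hD h M
  exact (contDiff_pderiv_data hD j k).continuous.continuousOn.add
    ((((continuous_apply k).comp_continuousOn (hB Z hZ).1).sub
      (continuousOn_normal_deriv_data hD h k)).mul (continuousOn_coord_nrm h j))

lemma exists_bound_gradTrace (hD : D.Standing α) (h : HolderConvex (D.Ω : Set E3) D.nrm α C)
    (M : ℝ) : ∃ B, 0 ≤ B ∧ ∀ Z, D.Admissible M Z → ∀ P ∈ frontier (D.Ω : Set E3),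
      ∀ j k, |D.gradTrace Z j k P| ≤ B := by
  obtain ⟨B, hB0, hB⟩ := exists_bound_A5 hD h M
  choose S hS using fun p : Fin 3 × Fin m => h.isCompact_frontier.exists_bound_of_continuousOn
    (contDiff_pderiv_data hD p.1 p.2).continuous.continuousOn
  choose T hT using fun k => h.isCompact_frontier.exists_bound_of_continuousOn
    (continuousOn_normal_deriv_data hD h k)
  refine ⟨∑ p, |S p| + (B + ∑ k, |T k|), by positivity, fun Z hZ P hP j k => ?_⟩
  have h1 : |pderiv j (fun X => D.A X k) P| ≤ ∑ p, |S p| :=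
    ((hS (j, k) P hP).trans (le_abs_self _)).trans
      (Finset.single_le_sum (f := fun p => |S p|) (fun p _ => abs_nonneg _)
        (Finset.mem_univ (j, k)))
  have h2 : |fderiv ℝ (fun X => D.A X k) P (D.nrm P)| ≤ ∑ k, |T k| :=
    ((hT k P hP).trans (le_abs_self _)).trans
      (Finset.single_le_sum (f := fun k => |T k|) (fun p _ => abs_nonneg _) (Finset.mem_univ k))
  have h3 := (hB Z hZ).2 P hP k
  have h4 := h.abs_coord_normal_le hP j
  refine (abs_add_le _ _).trans (add_le_add h1 ?_)
  rw [abs_mul]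
  refine (mul_le_of_le_one_right (abs_nonneg _) h4).trans ?_
  exact (abs_sub _ _).trans (add_le_add h3 h2)

lemma continuousOn_traceMul (hD : D.Standing α) (h : HolderConvex (D.Ω : Set E3) D.nrm α C)
    {Z : E3 → Idx m → ℝ} (hZ : D.Admissible M Z) (p q : Fin 3) (k : Fin m) :
    ContinuousOn (fun P => D.gradTrace Z p k P * D.nrm P q) (frontier (D.Ω : Set E3)) :=
  (continuousOn_gradTrace hD h hZ p k).mul (continuousOn_coord_nrm h q)

lemma continuous_gg (hD : D.Standing α) (h : HolderConvex (D.Ω : Set E3) D.nrm α C)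
    {Z : E3 → Idx m → ℝ} (hZ : D.Admissible M Z) (p q : Fin 3) (k : Fin m) :
    Continuous (D.gg Z p q k) :=
  continuous_charInt (h.integrable_of_continuousOn (continuousOn_traceMul hD h hZ p q k))

lemma continuous_g (hD : D.Standing α) (h : HolderConvex (D.Ω : Set E3) D.nrm α C)
    (j : Fin 3) (k : Fin m) : Continuous (D.g j k) :=
  continuous_charInt (h.integrable_of_continuousOn
    ((contDiff_data hD k).continuous.continuousOn.mul (continuousOn_coord_nrm h j)))

lemma abs_traceMul_le (h : HolderConvex (D.Ω : Set E3) D.nrm α C) {Z : E3 → Idx m → ℝ} {B : ℝ}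
    (hB : ∀ P ∈ frontier (D.Ω : Set E3), ∀ j k, |D.gradTrace Z j k P| ≤ B) (p q : Fin 3)
    (k : Fin m) : ∀ᵐ P ∂(surf (D.Ω : Set E3)), |D.gradTrace Z p k P * D.nrm P q| ≤ B := by
  filter_upwards [HolderConvex.ae_mem_frontier] with P hP
  rw [abs_mul]
  exact (mul_le_of_le_one_right (abs_nonneg _) (h.abs_coord_normal_le hP q)).trans (hB P hP p k)

lemma exists_bound_gg (hD : D.Standing α) (h : HolderConvex (D.Ω : Set E3) D.nrm α C)
    (M : ℝ) : ∃ B, 0 ≤ B ∧ ∀ Z, D.Admissible M Z → ∀ p q k ξ, ‖D.gg Z p q k ξ‖ ≤ B := by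
  have := h.isFiniteMeasure_surf
  obtain ⟨B, hB0, hB⟩ := exists_bound_gradTrace hD h M
  exact ⟨B * (surf (D.Ω : Set E3)).real univ, mul_nonneg hB0 measureReal_nonneg,
    fun Z hZ p q k ξ => norm_charInt_le_of_bound (abs_traceMul_le h (hB Z hZ) p q k) ξ⟩

/-- Convergence almost everywhere on `closure Ω`. -/
def AeTendsto (D : Problem m) (Z : ℕ → E3 → Idx m → ℝ) (Zs : E3 → Idx m → ℝ) : Prop :=
  ∀ᵐ Y ∂(volume.restrict (closure (D.Ω : Set E3))), Tendsto (fun k => Z k Y) atTop (𝓝 (Zs Y))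

lemma tendsto_gg (hD : D.Standing α) (h : HolderConvex (D.Ω : Set E3) D.nrm α C)
    {Z : ℕ → E3 → Idx m → ℝ} {Zs : E3 → Idx m → ℝ} (hZ : ∀ k, D.Admissible M (Z k))
    (hZs : D.Admissible M Zs) (hlim : D.AeTendsto Z Zs) (p q : Fin 3) (k : Fin m) (ξ : E3) :
    Tendsto (fun i => D.gg (Z i) p q k ξ) atTop (𝓝 (D.gg Zs p q k ξ)) := by
  have := h.isFiniteMeasure_surf
  obtain ⟨B, hB0, hB⟩ := exists_bound_gradTrace hD h M
  refine tendsto_charInt (fun i => HolderConvex.aestronglyMeasurable_surf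
    (continuousOn_traceMul hD h (hZ i) p q k))
    (fun i => abs_traceMul_le h (hB _ (hZ i)) p q k) ?_ ξ
  filter_upwards [HolderConvex.ae_mem_frontier] with P hP
  exact ((((tendsto_A5 hD h hZ hZs hlim hP k).sub_const _).mul_const _).const_add _).mul_const _

/-- The Fourier transform of the data on `Ω`. -/
def dataFourier (D : Problem m) (k : Fin m) (ξ : E3) : ℂ :=
  charInt (volume.restrict (D.Ω : Set E3)) (fun X => D.A X k) ξ

/-- Integration by parts writes −g_j as iξ_j Â − ∫_Ω ∂_jA e^{-iX·ξ}, where is the transform of A₁ on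
Ω. In the second-order rows, multiplying by iξ_q leaves the growing term iξ_q ∫_Ω ∂_pA e^{-iX·ξ}. A
second integration by parts turns it into a boundary integral and an integral of second derivatives,
both bounded since the data are C². -/
lemma norm_beta_sub_le (hD : D.Standing α) (h : HolderConvex (D.Ω : Set E3) D.nrm α C) (M : ℝ) :
    ∃ R, 0 ≤ R ∧ ∀ Z, D.Admissible M Z → ∀ ξ r,
      ‖D.beta Z ξ r - symbAt ξ r.1 * D.dataFourier r.2 ξ‖ ≤ R := by
  obtain ⟨B, hB0, hB⟩ := exists_bound_gg hD h M
  set a : Fin m → E3 → ℝ := fun k X => D.A X k with ha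
  set μ := volume.restrict (D.Ω : Set E3)
  set S₁ : ℝ := ∑ p : Fin 3 × Fin m, ∫ X, |pderiv p.1 (a p.2) X| ∂μ
  set S₂ : ℝ := ∑ p : Fin 3 × Fin 3 × Fin m, ∫ X, |pderiv p.1 (pderiv p.2.1 (a p.2.2)) X| ∂μ
  set S₃ : ℝ := ∑ p : Fin 3 × Fin 3 × Fin m,
    ∫ P, |pderiv p.1 (a p.2.2) P * D.nrm P p.2.1| ∂(surf (D.Ω : Set E3))
  have hS₁ : ∀ j k ξ, ‖charInt μ (pderiv j (a k)) ξ‖ ≤ S₁ := fun j k ξ =>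
    (norm_charInt_le _ ξ).trans (Finset.single_le_sum
      (f := fun p : Fin 3 × Fin m => ∫ X, |pderiv p.1 (a p.2) X| ∂μ)
      (fun p _ => by positivity) (Finset.mem_univ (j, k)))
  have hS₂ : ∀ i j k ξ, ‖charInt μ (pderiv i (pderiv j (a k))) ξ‖ ≤ S₂ := fun i j k ξ =>
    (norm_charInt_le _ ξ).trans (Finset.single_le_sum
      (f := fun p : Fin 3 × Fin 3 × Fin m => ∫ X, |pderiv p.1 (pderiv p.2.1 (a p.2.2)) X| ∂μ)
      (fun p _ => by positivity) (Finset.mem_univ (i, j, k)))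
  have hS₃ : ∀ i j k ξ, ‖charInt (surf (D.Ω : Set E3))
      (fun P => pderiv i (a k) P * D.nrm P j) ξ‖ ≤ S₃ := fun i j k ξ =>
    (norm_charInt_le _ ξ).trans (Finset.single_le_sum
      (f := fun p : Fin 3 × Fin 3 × Fin m =>
        ∫ P, |pderiv p.1 (a p.2.2) P * D.nrm P p.2.1| ∂(surf (D.Ω : Set E3)))
      (fun p _ => by positivity) (Finset.mem_univ (i, j, k)))
  have h₁0 : 0 ≤ S₁ := Finset.sum_nonneg fun p _ => by positivity
  have h₂0 : 0 ≤ S₂ := Finset.sum_nonneg fun p _ => by positivity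
  have h₃0 : 0 ≤ S₃ := Finset.sum_nonneg fun p _ => by positivity
  have hg : ∀ j k ξ, D.g j k ξ = charInt μ (pderiv j (a k)) ξ -
      Complex.I * ξ j * D.dataFourier k ξ := fun j k ξ =>
    h.surface_charInt ((contDiff_data hD k).of_le (by norm_num)) j ξ
  refine ⟨S₁ + (B + S₂ + S₃), by positivity, fun Z hZ ξ r => ?_⟩
  have h1 : ∀ j k, ‖-D.g j k ξ - Complex.I * ξ j * D.dataFourier k ξ‖ ≤ S₁ + (B + S₂ + S₃) := by
    intro j k
    have e : -D.g j k ξ - Complex.I * ξ j * D.dataFourier k ξ = -charInt μ (pderiv j (a k)) ξ := by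
      rw [hg]; ring
    rw [e, norm_neg]
    linarith [hS₁ j k ξ]
  have h2 : ∀ p q k, ‖-D.gg Z p q k ξ - Complex.I * ξ q * D.g p k ξ -
      Complex.I * ξ q * (Complex.I * ξ p) * D.dataFourier k ξ‖ ≤ S₁ + (B + S₂ + S₃) := by
    intro p q k
    have e : -D.gg Z p q k ξ - Complex.I * ξ q * D.g p k ξ -
        Complex.I * ξ q * (Complex.I * ξ p) * D.dataFourier k ξ =
        -D.gg Z p q k ξ - charInt μ (pderiv q (pderiv p (a k))) ξ +
          charInt (surf (D.Ω : Set E3)) (fun P => pderiv p (a k) P * D.nrm P q) ξ := by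
      rw [hg, h.surface_charInt (contDiff_pderiv_data hD p k) q ξ]
      ring
    rw [e]
    refine (norm_add_le _ _).trans ?_
    have h3 := norm_sub_le (-D.gg Z p q k ξ) (charInt μ (pderiv q (pderiv p (a k))) ξ)
    rw [norm_neg] at h3
    linarith [hB Z hZ p q k ξ, hS₂ q p k ξ, hS₃ p q k ξ]
  obtain ⟨l, k⟩ := r
  fin_cases l
  · simpa [beta, symbAt, symb] using h1 0 k
  · simpa [beta, symbAt, symb] using h1 1 k
  · simpa [beta, symbAt, symb] using h1 2 k
  · simpa [beta, symbAt, symb] using h2 0 0 k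
  · simpa [beta, symbAt, symb] using h2 1 0 k
  · simpa [beta, symbAt, symb] using h2 2 0 k
  · simpa [beta, symbAt, symb] using h2 1 1 k
  · simpa [beta, symbAt, symb] using h2 2 1 k
  · simpa [beta, symbAt, symb] using h2 2 2 k

lemma continuous_beta (hD : D.Standing α) (h : HolderConvex (D.Ω : Set E3) D.nrm α C)
    {Z : E3 → Idx m → ℝ} (hZ : D.Admissible M Z) (r : Idx m) :
    Continuous fun ξ => D.beta Z ξ r := by
  have hc : ∀ j : Fin 3, Continuous fun ξ : E3 => Complex.I * (ξ j : ℂ) := fun j => by fun_prop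
  have h1 : ∀ j k, Continuous fun ξ => -D.g j k ξ := fun j k => (continuous_g hD h j k).neg
  have h2 : ∀ p q k, Continuous fun ξ => -D.gg Z p q k ξ - Complex.I * ξ q * D.g p k ξ :=
    fun p q k => (continuous_gg hD h hZ p q k).neg.sub ((hc q).mul (continuous_g hD h p k))
  obtain ⟨l, k⟩ := r
  fin_cases l
  exacts [h1 0 k, h1 1 k, h1 2 k, h2 0 0 k, h2 1 0 k, h2 2 0 k, h2 1 1 k, h2 2 1 k, h2 2 2 k]

lemma tendsto_beta (hD : D.Standing α) (h : HolderConvex (D.Ω : Set E3) D.nrm α C)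
    {Z : ℕ → E3 → Idx m → ℝ} {Zs : E3 → Idx m → ℝ} (hZ : ∀ k, D.Admissible M (Z k))
    (hZs : D.Admissible M Zs) (hlim : D.AeTendsto Z Zs) (ξ : E3) (r : Idx m) :
    Tendsto (fun i => D.beta (Z i) ξ r) atTop (𝓝 (D.beta Zs ξ r)) := by
  have h2 : ∀ p q k, Tendsto (fun i => -D.gg (Z i) p q k ξ - Complex.I * ξ q * D.g p k ξ) atTop
      (𝓝 (-D.gg Zs p q k ξ - Complex.I * ξ q * D.g p k ξ)) :=
    fun p q k => (tendsto_gg hD h hZ hZs hlim p q k ξ).neg.sub_const _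
  obtain ⟨l, k⟩ := r
  fin_cases l
  exacts [tendsto_const_nhds, tendsto_const_nhds, tendsto_const_nhds, h2 0 0 k, h2 1 0 k,
    h2 2 0 k, h2 1 1 k, h2 2 1 k, h2 2 2 k]

lemma FIpsi_eq (Z : E3 → Idx m → ℝ) (ξ : E3) (j : Fin m) :
    D.FIpsi Z ξ j = charInt (volume.restrict (closure (D.Ω : Set E3)))
      (fun Y => D.psi Y (Z Y) j) ξ := by
  rw [FIpsi, fourier, charInt, ← integral_indicator isClosed_closure.measurableSet]
  refine integral_congr_ae (ae_of_all _ fun Y => ?_)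
  by_cases hY : Y ∈ closure (D.Ω : Set E3) <;> simp [hY, char]

lemma integrable_psi (hD : D.Standing α) (h : HolderConvex (D.Ω : Set E3) D.nrm α C)
    {Z : E3 → Idx m → ℝ} (hZ : D.Admissible M Z) (j : Fin m) :
    Integrable (fun Y => D.psi Y (Z Y) j) (volume.restrict (closure (D.Ω : Set E3))) := by
  have := h.isFiniteMeasure_volume
  obtain ⟨B, -, hB⟩ := exists_bound_superposition hD (continuousOn_psi hD j) M
  exact Integrable.of_bound
    (aestronglyMeasurable_superposition (continuousOn_psi hD j) hZ.meas) B
    ((ae_restrict_mem isClosed_closure.measurableSet).mono (hB Z hZ))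


end Problem


/-! ### The Fourier transform of T₀(Z₁) and its integrable majorant -/

namespace Problem

variable {m : ℕ} {D : Problem m} {α : ℝ≥0} {C M : ℝ}

lemma exists_bound_FIpsi (hD : D.Standing α) (h : HolderConvex (D.Ω : Set E3) D.nrm α C)
    (M : ℝ) : ∃ B, 0 ≤ B ∧ ∀ Z, D.Admissible M Z → ∀ ξ j, ‖D.FIpsi Z ξ j‖ ≤ B := by
  have := h.isFiniteMeasure_volume
  choose B hB0 hB using fun j => exists_bound_superposition hD (continuousOn_psi hD j) M
  refine ⟨∑ j, B j * (volume.restrict (closure (D.Ω : Set E3))).real univ,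
    Finset.sum_nonneg fun j _ => mul_nonneg (hB0 j) measureReal_nonneg, fun Z hZ ξ j => ?_⟩
  rw [FIpsi_eq]
  refine (norm_charInt_le_of_bound
    ((ae_restrict_mem isClosed_closure.measurableSet).mono (hB j Z hZ)) ξ).trans ?_
  exact Finset.single_le_sum
    (f := fun j => B j * (volume.restrict (closure (D.Ω : Set E3))).real univ)
    (fun j _ => mul_nonneg (hB0 j) measureReal_nonneg) (Finset.mem_univ j)

lemma continuous_FIpsi (hD : D.Standing α) (h : HolderConvex (D.Ω : Set E3) D.nrm α C)
    {Z : E3 → Idx m → ℝ} (hZ : D.Admissible M Z) (j : Fin m) :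
    Continuous fun ξ => D.FIpsi Z ξ j := by
  simp only [FIpsi_eq]
  exact continuous_charInt (integrable_psi hD h hZ j)

lemma tendsto_FIpsi (hD : D.Standing α) (h : HolderConvex (D.Ω : Set E3) D.nrm α C)
    {Z : ℕ → E3 → Idx m → ℝ} {Zs : E3 → Idx m → ℝ} (hZ : ∀ k, D.Admissible M (Z k))
    (hlim : D.AeTendsto Z Zs) (ξ : E3) (j : Fin m) :
    Tendsto (fun i => D.FIpsi (Z i) ξ j) atTop (𝓝 (D.FIpsi Zs ξ j)) := by
  have := h.isFiniteMeasure_volume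
  simp only [FIpsi_eq]
  have hc := continuousOn_psi hD j
  obtain ⟨B, -, hB⟩ := exists_bound_superposition hD hc M
  refine tendsto_charInt (fun k => aestronglyMeasurable_superposition hc (hZ k).meas)
    (fun k => (ae_restrict_mem isClosed_closure.measurableSet).mono (hB _ (hZ k))) ?_ ξ
  filter_upwards [hlim, ae_restrict_mem isClosed_closure.measurableSet] with Y hY hYm
  exact tendsto_superposition hc hYm hY

/-- The Fourier transform `B_1⁻¹ β_1 + B_1⁻¹ B_2 FI(ψ(Z₁))` of `T_0(Z₁)`. -/
def transform (D : Problem m) (Z : E3 → Idx m → ℝ) (i : Idx m) (ξ : E3) : ℂ :=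
  (D.B₁inv ξ).mulVec (D.beta Z ξ) i + (D.B₁invB₂ ξ).mulVec (D.FIpsi Z ξ) i

/-- A bound of the matrices `B_1⁻¹` and `B_1⁻¹ B_2`. -/
def majorant (D : Problem m) (ξ : E3) : ℝ :=
  1 + ∑ i, ∑ r, ‖D.B₁inv ξ i r‖ + ∑ i, ∑ j, ‖D.B₁invB₂ ξ i j‖

lemma row_le_sum {ι κ : Type*} [Fintype ι] [Fintype κ] (Q : Matrix ι κ ℂ) (i : ι) :
    ∑ j, ‖Q i j‖ ≤ ∑ i, ∑ j, ‖Q i j‖ :=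
  Finset.single_le_sum (f := fun i => ∑ j, ‖Q i j‖) (fun i _ => by positivity) (Finset.mem_univ i)

lemma norm_mulVec_le {ι κ : Type*} [Fintype κ] (Q : Matrix ι κ ℂ) (v : κ → ℂ) {R : ℝ}
    (hv : ∀ j, ‖v j‖ ≤ R) (i : ι) : ‖Q.mulVec v i‖ ≤ R * ∑ j, ‖Q i j‖ := by
  change ‖∑ j, Q i j * v j‖ ≤ _
  refine (norm_sum_le _ _).trans ?_
  rw [Finset.mul_sum]
  refine Finset.sum_le_sum fun j _ => ?_
  rw [norm_mul, mul_comm]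
  exact mul_le_mul_of_nonneg_right (hv j) (norm_nonneg _)

lemma one_le_majorant (ξ : E3) : 1 ≤ D.majorant ξ := by
  unfold majorant
  have h1 : 0 ≤ ∑ i, ∑ r, ‖D.B₁inv ξ i r‖ := by positivity
  have h2 : 0 ≤ ∑ i, ∑ j, ‖D.B₁invB₂ ξ i j‖ := by positivity
  linarith

/-- The transforms are bounded uniformly by the matrices; the growth of the boundary terms cancels
because the highest order terms are the symbol of a jet. -/
theorem exists_bound_transform (hD : D.Standing α) (h : HolderConvex (D.Ω : Set E3) D.nrm α C)
    (M : ℝ) : ∃ K, 0 ≤ K ∧ ∀ Z, D.Admissible M Z → ∀ i ξ,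
      ‖D.transform Z i ξ‖ ≤ K * D.majorant ξ := by
  obtain ⟨R, hR0, hR⟩ := norm_beta_sub_le hD h M
  obtain ⟨B, hB0, hB⟩ := exists_bound_FIpsi hD h M
  obtain ⟨K, hK0, hK⟩ := norm_B₁inv_symb_le D
  set G : ℝ := ∑ k, ∫ X in (D.Ω : Set E3), |D.A X k| with hGd
  have hG0 : 0 ≤ G := Finset.sum_nonneg fun k _ => by positivity
  have hG : ∀ ξ k, ‖D.dataFourier k ξ‖ ≤ G := fun ξ k => (norm_charInt_le _ ξ).trans
    (Finset.single_le_sum (f := fun k => ∫ X in (D.Ω : Set E3), |D.A X k|)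
      (fun k _ => by positivity) (Finset.mem_univ k))
  refine ⟨G * K + R + B, by positivity, fun Z hZ i ξ => ?_⟩
  have e : D.beta Z ξ = (fun r => symbAt ξ r.1 * D.dataFourier r.2 ξ) +
      fun r => D.beta Z ξ r - symbAt ξ r.1 * D.dataFourier r.2 ξ := by
    ext r; simp
  have h1 := hK ξ (fun k => D.dataFourier k ξ) G (hG ξ) i
  have h2 := norm_mulVec_le (D.B₁inv ξ) _ (hR Z hZ ξ) i
  have h3 := norm_mulVec_le (D.B₁invB₂ ξ) _ (hB Z hZ ξ) i
  rw [transform, e, Matrix.mulVec_add, Pi.add_apply]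
  have h4 := row_le_sum (D.B₁inv ξ) i
  have h5 := row_le_sum (D.B₁invB₂ ξ) i
  have h6 : ∑ j, ‖D.B₁inv ξ i j‖ ≤ D.majorant ξ := by
    unfold majorant
    have : 0 ≤ ∑ i, ∑ j, ‖D.B₁invB₂ ξ i j‖ := by positivity
    linarith
  have h7 : 1 + ∑ j, ‖D.B₁invB₂ ξ i j‖ ≤ D.majorant ξ := by
    unfold majorant
    have : 0 ≤ ∑ i, ∑ j, ‖D.B₁inv ξ i j‖ := by positivity
    linarith
  have h8 : G * (K * (1 + ∑ j, ‖D.B₁invB₂ ξ i j‖)) ≤ G * (K * D.majorant ξ) := by gcongr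
  have h9 : R * ∑ j, ‖D.B₁inv ξ i j‖ ≤ R * D.majorant ξ := by gcongr
  have h10 : B * ∑ j, ‖D.B₁invB₂ ξ i j‖ ≤ B * D.majorant ξ := by
    gcongr
    linarith
  refine (norm_add₃_le).trans ?_
  linarith

lemma tendsto_transform (hD : D.Standing α) (h : HolderConvex (D.Ω : Set E3) D.nrm α C)
    {Z : ℕ → E3 → Idx m → ℝ} {Zs : E3 → Idx m → ℝ} (hZ : ∀ k, D.Admissible M (Z k))
    (hZs : D.Admissible M Zs) (hlim : D.AeTendsto Z Zs) (i : Idx m) (ξ : E3) :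
    Tendsto (fun k => D.transform (Z k) i ξ) atTop (𝓝 (D.transform Zs i ξ)) := by
  simp only [transform, Matrix.mulVec, dotProduct]
  exact (tendsto_finsetSum _ fun r _ => (tendsto_beta hD h hZ hZs hlim ξ r).const_mul _).add
    (tendsto_finsetSum _ fun j _ => (tendsto_FIpsi hD h hZ hlim ξ j).const_mul _)

section Parameters

variable {a₁ : MvPolynomial (Fin 3) ℂ} {P : Matrix (Idx m) (Idx m) (MvPolynomial (Fin 3) ℂ)}

/-- The weight `(1 + |ξ|²)^{-N}`. -/
def weight (N : ℕ) (ξ : E3) : ℝ := ((1 + ‖ξ‖ ^ 2) ^ N)⁻¹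

lemma weight_pos (N : ℕ) (ξ : E3) : 0 < weight N ξ := by unfold weight; positivity

lemma continuous_weight (N : ℕ) : Continuous (weight N) := by
  unfold weight
  exact Continuous.inv₀ (by fun_prop) fun ξ => by positivity

lemma integrable_weight {N : ℕ} (hN : 2 ≤ N) : Integrable (weight N) := by
  have h1 := integrable_rpow_neg_one_add_norm_sq (E := E3) (μ := volume) (r := 2 * N) (by
    simp only [finrank_euclideanSpace, Fintype.card_fin]
    have : (2 : ℝ) ≤ N := by exact_mod_cast hN
    push_cast
    linarith)
  refine h1.congr (ae_of_all _ fun ξ => ?_)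
  simp only [weight]
  rw [show -(2 * (N : ℝ)) / 2 = -(N : ℝ) by ring, Real.rpow_neg (by positivity), Real.rpow_natCast]

/-- The integrability hypotheses contain measurability of the weighted entries; multiplying by the
inverse weight, which is continuous, recovers that of the entries. -/
lemma aestronglyMeasurable_of_weight {N : ℕ} {q : E3 → ℂ}
    (hq : Integrable fun ξ : E3 => ((weight N ξ : ℝ) : ℂ) * q ξ) :
    AEStronglyMeasurable q volume := by
  have h1 : AEStronglyMeasurable (fun ξ : E3 => ((1 + ‖ξ‖ ^ 2 : ℝ) : ℂ) ^ N) volume :=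
    Continuous.aestronglyMeasurable (by fun_prop)
  refine (h1.mul hq.aestronglyMeasurable).congr (ae_of_all _ fun ξ => ?_)
  have h2 : ((1 + ‖ξ‖ ^ 2 : ℝ) : ℂ) ^ N ≠ 0 :=
    pow_ne_zero _ (Complex.ofReal_ne_zero.2 (by positivity))
  simp only [weight, Pi.mul_apply]
  rw [Complex.ofReal_inv, Complex.ofReal_pow, mul_inv_cancel_left₀ h2]

lemma aestronglyMeasurable_transform (hP : D.Parameters a₁ P) (hD : D.Standing α)
    (h : HolderConvex (D.Ω : Set E3) D.nrm α C) {Z : E3 → Idx m → ℝ} (hZ : D.Admissible M Z)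
    (i : Idx m) : AEStronglyMeasurable (D.transform Z i) volume := by
  have h1 := fun r => (aestronglyMeasurable_of_weight (hP.integrable_inv i r)).mul
    (continuous_beta hD h hZ r).aestronglyMeasurable
  have h2 := fun j => (aestronglyMeasurable_of_weight (hP.integrable_invB₂ i j)).mul
    (continuous_FIpsi hD h hZ j).aestronglyMeasurable
  unfold transform
  simp only [Matrix.mulVec, dotProduct]
  exact (Finset.aestronglyMeasurable_fun_sum _ fun r _ => h1 r).add
    (Finset.aestronglyMeasurable_fun_sum _ fun j _ => h2 j)

/-- The weighted majorant. -/
def dominant (D : Problem m) (P : Matrix (Idx m) (Idx m) (MvPolynomial (Fin 3) ℂ)) (ξ : E3) : ℝ :=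
  weight (D.deg P + 3) ξ * D.majorant ξ

lemma integrable_dominant (hP : D.Parameters a₁ P) : Integrable (D.dominant P) := by
  have h0 : Integrable (weight (D.deg P + 3)) := integrable_weight (by omega)
  have h1 : ∀ i r, Integrable fun ξ => weight (D.deg P + 3) ξ * ‖D.B₁inv ξ i r‖ := fun i r => by
    refine (hP.integrable_inv i r).norm.congr (ae_of_all _ fun ξ => ?_)
    simp only [norm_mul, Complex.norm_real, Real.norm_eq_abs]
    rw [abs_of_pos (by positivity : 0 < ((1 + ‖ξ‖ ^ 2) ^ (D.deg P + 3))⁻¹)]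
    rfl
  have h2 : ∀ i j, Integrable fun ξ => weight (D.deg P + 3) ξ * ‖D.B₁invB₂ ξ i j‖ := fun i j => by
    refine (hP.integrable_invB₂ i j).norm.congr (ae_of_all _ fun ξ => ?_)
    simp only [norm_mul, Complex.norm_real, Real.norm_eq_abs]
    rw [abs_of_pos (by positivity : 0 < ((1 + ‖ξ‖ ^ 2) ^ (D.deg P + 3))⁻¹)]
    rfl
  have h3 : D.dominant P = fun ξ => weight (D.deg P + 3) ξ +
      ∑ i, ∑ r, weight (D.deg P + 3) ξ * ‖D.B₁inv ξ i r‖ +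
      ∑ i, ∑ j, weight (D.deg P + 3) ξ * ‖D.B₁invB₂ ξ i j‖ := by
    ext ξ
    simp only [dominant, majorant, mul_add, mul_one, Finset.mul_sum]
  rw [h3]
  exact (h0.add (integrable_finsetSum _ fun i _ => integrable_finsetSum _ fun r _ => h1 i r)).add
    (integrable_finsetSum _ fun i _ => integrable_finsetSum _ fun j _ => h2 i j)

lemma dominant_nonneg (ξ : E3) : 0 ≤ D.dominant P ξ :=
  mul_nonneg (weight_pos _ _).le (zero_le_one.trans (one_le_majorant ξ))

end Parameters

end Problem


/-! ### Fourier transforms of test functions -/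

/-- Smooth functions with support in `Ω`. -/
structure SmoothIn (Ω : Set E3) (b : E3 → ℝ) : Prop where
  contDiff : ContDiff ℝ (⊤ : ℕ∞) b
  tsupport_subset : tsupport b ⊆ Ω

namespace SmoothIn

variable {Ω : Set E3} {b : E3 → ℝ}

lemma eq_zero (hb : SmoothIn Ω b) {X : E3} (hX : X ∉ Ω) : b X = 0 :=
  image_eq_zero_of_notMem_tsupport fun h => hX (hb.tsupport_subset h)

lemma pderiv (hb : SmoothIn Ω b) (j : Fin 3) : SmoothIn Ω (pderiv j b) :=
  ⟨(hb.contDiff.fderiv_right (m := (⊤ : ℕ∞)) (by simp)).clm_apply contDiff_const,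
    (tsupport_fderiv_apply_subset ℝ _).trans hb.tsupport_subset⟩

lemma iterate_pderiv (hb : SmoothIn Ω b) (j : Fin 3) (p : ℕ) :
    SmoothIn Ω ((DirichletSystem.pderiv j)^[p] b) := by
  induction p with
  | zero => exact hb
  | succ p ih => rw [Function.iterate_succ_apply']; exact ih.pderiv j

lemma multiDeriv (hb : SmoothIn Ω b) (γ : Fin 3 → ℕ) : SmoothIn Ω (multiDeriv γ b) :=
  ((hb.iterate_pderiv 2 _).iterate_pderiv 1 _).iterate_pderiv 0 _

lemma contDiff_one (hb : SmoothIn Ω b) : ContDiff ℝ 1 b := hb.contDiff.of_le (by simp)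

lemma setIntegral_eq {V : Type*} [NormedAddCommGroup V] [NormedSpace ℝ V] (hb : SmoothIn Ω b)
    {f : E3 → V} (hf : ∀ X, b X = 0 → f X = 0) : ∫ X in Ω, f X = ∫ X, f X :=
  setIntegral_eq_integral_of_forall_compl_eq_zero fun X hX => hf X (hb.eq_zero hX)

variable {n : E3 → E3} {α C : ℝ}

lemma charInt_pderiv (hb : SmoothIn Ω b) (h : HolderConvex Ω n α C) (j : Fin 3) (ξ : E3) :
    charInt (volume.restrict Ω) (DirichletSystem.pderiv j b) ξ =
      Complex.I * ξ j * charInt (volume.restrict Ω) b ξ := by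
  have h1 := h.surface_charInt hb.contDiff_one j ξ
  have h2 : charInt (surf Ω) (fun P => b P * n P j) ξ = 0 := by
    rw [charInt]
    refine integral_eq_zero_of_ae ?_
    filter_upwards [HolderConvex.ae_mem_frontier] with P hP
    have : P ∉ Ω := by
      rw [h.isOpen.frontier_eq] at hP; exact hP.2
    simp [hb.eq_zero this]
  rw [h2] at h1
  exact (sub_eq_zero.1 h1.symm)

lemma charInt_iterate (hb : SmoothIn Ω b) (h : HolderConvex Ω n α C) (j : Fin 3) (p : ℕ) (ξ : E3) :
    charInt (volume.restrict Ω) ((DirichletSystem.pderiv j)^[p] b) ξ =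
      (Complex.I * ξ j) ^ p * charInt (volume.restrict Ω) b ξ := by
  induction p with
  | zero => simp
  | succ p ih =>
    rw [Function.iterate_succ_apply', (hb.iterate_pderiv j p).charInt_pderiv h, ih]
    ring

lemma integrableOn_sq (hb : SmoothIn Ω b) (h : HolderConvex Ω n α C) :
    IntegrableOn (fun X => |b X| ^ 2) Ω :=
  h.integrableOn_of_continuous (hb.contDiff.continuous.abs.pow 2)

lemma norm_charInt_le_sqrt (hb : SmoothIn Ω b) (h : HolderConvex Ω n α C) (ξ : E3) :
    ‖charInt (volume.restrict Ω) b ξ‖ ≤ √(volume.real Ω) * √(∫ X in Ω, |b X| ^ 2) := by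
  refine (norm_charInt_le b ξ).trans ?_
  have hfin : IsFiniteMeasure (volume.restrict Ω) :=
    ⟨by rw [Measure.restrict_apply_univ]; exact h.bounded.measure_lt_top⟩
  have h1 : MemLp (fun X => |b X|) (ENNReal.ofReal 2) (volume.restrict Ω) := by
    rw [ENNReal.ofReal_ofNat]
    exact (memLp_two_iff_integrable_sq hb.contDiff.continuous.abs.aestronglyMeasurable).2
      (hb.integrableOn_sq h)
  have h2 : MemLp (fun _ : E3 => (1 : ℝ)) (ENNReal.ofReal 2) (volume.restrict Ω) := memLp_const _
  have h3 := integral_mul_le_Lp_mul_Lq_of_nonneg Real.HolderConjugate.two_two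
    (ae_of_all _ fun X => zero_le_one) (ae_of_all _ fun X => abs_nonneg (b X)) h2 h1
  simpa [Real.sqrt_eq_rpow, measureReal_restrict_apply_univ] using h3

end SmoothIn

lemma smoothIn_testFunction {Ω : TopologicalSpace.Opens E3} (φ : 𝓓(Ω, ℝ)) :
    SmoothIn (Ω : Set E3) φ := ⟨φ.contDiff, φ.tsupport_subset⟩

lemma multiDeriv_single (j : Fin 3) (p : ℕ) (b : E3 → ℝ) :
    multiDeriv (Pi.single j p) b = (pderiv j)^[p] b := by
  fin_cases j <;> simp [multiDeriv]

lemma sqrt_le_sobolevNorm {Ω : TopologicalSpace.Opens E3} {n : E3 → E3} {α C : ℝ}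
    (h : HolderConvex (Ω : Set E3) n α C) (φ : 𝓓(Ω, ℝ)) {N : ℕ} {γ : Fin 3 → ℕ}
    (hγ : ∑ j, γ j ≤ N) :
    √(∫ X in (Ω : Set E3), |multiDeriv γ φ X| ^ 2) ≤ sobolevNorm Ω N φ := by
  refine Real.sqrt_le_sqrt ?_
  have hi : ∀ γ : Fin 3 → ℕ, IntegrableOn (fun X => |multiDeriv γ φ X| ^ 2) (Ω : Set E3) :=
    fun γ => ((smoothIn_testFunction φ).multiDeriv γ).integrableOn_sq h
  refine integral_mono (hi γ)
    (integrable_finsetSum _ fun k _ => integrable_finsetSum _ fun γ _ => hi γ) fun X => ?_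
  refine (Finset.single_le_sum (f := fun γ => |multiDeriv γ φ X| ^ 2)
    (s := Finset.piAntidiag Finset.univ (∑ j, γ j)) (fun _ _ => by positivity) (a := γ) ?_).trans
    (Finset.single_le_sum (f := fun k => ∑ γ ∈ Finset.piAntidiag Finset.univ k,
      |multiDeriv γ φ X| ^ 2) (fun _ _ => by positivity) (Finset.mem_range.2 (by omega)))
  simp

/-- One of the four summands 1, ξ_0², ξ_1², ξ_2² is at least a quarter of the sum. -/
lemma exists_coord_le (ξ : E3) : 1 + ‖ξ‖ ^ 2 ≤ 4 ∨ ∃ j, 1 + ‖ξ‖ ^ 2 ≤ 4 * ξ j ^ 2 := by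
  by_contra! H
  have h0 := H.2 0
  have h1 := H.2 1
  have h2 := H.2 2
  have e : ‖ξ‖ ^ 2 = ξ 0 ^ 2 + ξ 1 ^ 2 + ξ 2 ^ 2 := by
    rw [EuclideanSpace.norm_sq_eq, Fin.sum_univ_three]
    simp
  linarith [H.1]

lemma fourierInv_eq_charInt {Ω : TopologicalSpace.Opens E3} (φ : 𝓓(Ω, ℝ)) (ξ : E3) :
    fourierInv (fun X => (φ X : ℂ)) ξ =
      (((2 * Real.pi) ^ 3 : ℝ)⁻¹ : ℝ) * charInt (volume.restrict (Ω : Set E3)) φ (-ξ) := by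
  rw [fourierInv, charInt, (smoothIn_testFunction φ).setIntegral_eq fun X hX => by simp [hX]]
  congr 1
  refine integral_congr_ae (ae_of_all _ fun X => ?_)
  simp only [char, inner_neg_right, real_inner_comm ξ X]
  congr 2
  push_cast
  ring

/-- Fourier transforms of test functions decay. -/
theorem exists_norm_fourierInv_le {Ω : TopologicalSpace.Opens E3} {n : E3 → E3} {α C : ℝ}
    (h : HolderConvex (Ω : Set E3) n α C) (N : ℕ) : ∃ K, 0 ≤ K ∧ ∀ (φ : 𝓓(Ω, ℝ)) (ξ : E3),
      ‖fourierInv (fun X => (φ X : ℂ)) ξ‖ ≤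
        K * sobolevNorm Ω (2 * N) φ * Problem.weight N ξ := by
  set V := √(volume.real (Ω : Set E3))
  set c : ℝ := ((2 * Real.pi) ^ 3)⁻¹
  have hc : 0 ≤ c := by positivity
  refine ⟨c * (4 ^ N * V), by positivity, fun φ ξ => ?_⟩
  set S := sobolevNorm Ω (2 * N) φ
  have hS : 0 ≤ S := Real.sqrt_nonneg _
  have hφ := smoothIn_testFunction φ
  set q := ‖charInt (volume.restrict (Ω : Set E3)) φ (-ξ)‖ with hq
  have h0 : q ≤ V * S := by
    refine (hφ.norm_charInt_le_sqrt h _).trans (mul_le_mul_of_nonneg_left ?_ (Real.sqrt_nonneg _))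
    exact sqrt_le_sobolevNorm h φ (γ := 0) (by simp)
  -- Pure derivatives of order 2N in one coordinate suffice, since for each ξ either ξ is bounded or
  -- one coordinate controls 1 + |ξ|².
  have hj : ∀ j, (ξ j ^ 2) ^ N * q ≤ V * S := by
    intro j
    have h1 := (hφ.iterate_pderiv j (2 * N)).norm_charInt_le_sqrt h (-ξ)
    rw [hφ.charInt_iterate h, norm_mul, norm_pow, norm_mul, Complex.norm_I, one_mul,
      Complex.norm_real, Real.norm_eq_abs, pow_mul, sq_abs, PiLp.neg_apply, neg_sq] at h1
    refine h1.trans (mul_le_mul_of_nonneg_left ?_ (Real.sqrt_nonneg _))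
    have h2 := sqrt_le_sobolevNorm h φ (N := 2 * N) (γ := Pi.single j (2 * N)) (by simp)
    rwa [multiDeriv_single] at h2
  have key : (1 + ‖ξ‖ ^ 2) ^ N * q ≤ 4 ^ N * (V * S) := by
    rcases exists_coord_le ξ with h1 | ⟨j, h1⟩
    · calc (1 + ‖ξ‖ ^ 2) ^ N * q ≤ 4 ^ N * q := by gcongr
        _ ≤ _ := by gcongr
    · calc (1 + ‖ξ‖ ^ 2) ^ N * q ≤ (4 * ξ j ^ 2) ^ N * q := by gcongr
        _ = 4 ^ N * ((ξ j ^ 2) ^ N * q) := by rw [mul_pow]; ring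
        _ ≤ _ := mul_le_mul_of_nonneg_left (hj j) (by positivity)
  rw [fourierInv_eq_charInt, norm_mul, Complex.norm_real, Real.norm_eq_abs, abs_of_nonneg hc,
    Problem.weight, ← div_eq_mul_inv, le_div_iff₀ (by positivity)]
  calc c * q * (1 + ‖ξ‖ ^ 2) ^ N = c * ((1 + ‖ξ‖ ^ 2) ^ N * q) := by ring
    _ ≤ c * (4 ^ N * (V * S)) := by gcongr
    _ = _ := by ring


lemma char_neg (ξ X : E3) : char (-ξ) X = Complex.exp (Complex.I * (⟪X, ξ⟫ : ℝ)) := by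
  rw [char, inner_neg_right]
  congr 1
  push_cast
  ring

/-- Fubini's theorem for Fourier integrals. -/
lemma integral_mul_char_swap {μ : Measure E3} [SFinite μ] {b : E3 → ℝ} (hb : Integrable b μ)
    {G : E3 → ℂ} (hG : Integrable G) {σ : E3 → E3} (hσ : Continuous σ) :
    ∫ X, (b X : ℂ) * (∫ ξ, G ξ * char (σ ξ) X) ∂μ = ∫ ξ, G ξ * charInt μ b (σ ξ) := by
  have h1 : Integrable (fun p : E3 × E3 => (b p.1 : ℂ) * G p.2 * char (σ p.2) p.1)
      (μ.prod volume) :=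
    (hb.ofReal.mul_prod hG).mul_bdd (c := 1)
      (continuous_char.comp ((hσ.comp continuous_snd).prodMk continuous_fst)).aestronglyMeasurable
      (ae_of_all _ fun p => (norm_char _ _).le)
  have h2 := integral_integral_swap (f := fun X ξ => (b X : ℂ) * G ξ * char (σ ξ) X) h1
  calc ∫ X, (b X : ℂ) * (∫ ξ, G ξ * char (σ ξ) X) ∂μ
      = ∫ X, (∫ ξ, (b X : ℂ) * G ξ * char (σ ξ) X) ∂μ := by
        refine integral_congr_ae (ae_of_all _ fun X => ?_)
        simp only [mul_assoc]
        rw [integral_const_mul]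
    _ = ∫ ξ, (∫ X, (b X : ℂ) * G ξ * char (σ ξ) X ∂μ) := h2
    _ = _ := by
        refine integral_congr_ae (ae_of_all _ fun ξ => ?_)
        simp only [charInt]
        rw [← integral_const_mul]
        refine integral_congr_ae (ae_of_all _ fun X => ?_)
        simp only
        ring

/-! ### Fourier inversion and Parseval's identity for test functions -/

section Inversion

variable {Ω : TopologicalSpace.Opens E3} {n : E3 → E3} {α C : ℝ}

lemma integrable_testFunction (h : HolderConvex (Ω : Set E3) n α C) (φ : 𝓓(Ω, ℝ)) :
    IntegrableOn φ (Ω : Set E3) := h.integrableOn_of_continuous φ.continuous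

lemma continuous_fourierInv (h : HolderConvex (Ω : Set E3) n α C) (φ : 𝓓(Ω, ℝ)) :
    Continuous (fourierInv fun X => (φ X : ℂ)) := by
  have : (fourierInv fun X => (φ X : ℂ)) = fun ξ => _ := funext fun ξ => fourierInv_eq_charInt φ ξ
  rw [this]
  exact continuous_const.mul
    ((continuous_charInt (integrable_testFunction h φ)).comp continuous_neg)

lemma integrable_fourierInv (h : HolderConvex (Ω : Set E3) n α C) (φ : 𝓓(Ω, ℝ)) :
    Integrable (fourierInv fun X => (φ X : ℂ)) := by
  obtain ⟨K, -, hK⟩ := exists_norm_fourierInv_le h 2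
  exact ((Problem.integrable_weight le_rfl).const_mul (K * sobolevNorm Ω (2 * 2) φ)).mono'
    (continuous_fourierInv h φ).aestronglyMeasurable (ae_of_all _ (hK φ))

-- This is the inversion theorem for the kernel e^{-2πi⟨w, X⟩}, rescaled by ξ = 2πw with Jacobian
-- (2π)³. The transform is integrable by the decay for N = 2.
open FourierTransform in
lemma integral_fourierInv_mul_char (h : HolderConvex (Ω : Set E3) n α C) (φ : 𝓓(Ω, ℝ)) (X : E3) :
    ∫ ξ, fourierInv (fun X => (φ X : ℂ)) ξ * char ξ X = (φ X : ℂ) := by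
  set f : E3 → ℂ := fun X => (φ X : ℂ) with hf
  have hfc : Continuous f := Complex.continuous_ofReal.comp φ.continuous
  have hfi : Integrable f := (φ.continuous.integrable_of_hasCompactSupport
    φ.hasCompactSupport).ofReal
  have hpi : (0 : ℝ) < (2 * Real.pi) ^ 3 := by positivity
  have hinv : ∀ w : E3, 𝓕⁻ f w = ((2 * Real.pi) ^ 3 : ℝ) * fourierInv f ((2 * Real.pi) • w) := by
    intro w
    rw [Real.fourierInv_eq', fourierInv, ← mul_assoc, ← Complex.ofReal_mul,
      mul_inv_cancel₀ hpi.ne', Complex.ofReal_one, one_mul]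
    refine integral_congr_ae (ae_of_all _ fun v => ?_)
    simp only [smul_eq_mul, inner_smul_left, real_inner_comm w v, conj_trivial]
    rw [mul_comm]
    congr 2
    push_cast
    ring
  have hFi : Integrable (𝓕 f) := by
    have h1 : 𝓕 f = fun w => ((2 * Real.pi) ^ 3 : ℝ) * fourierInv f ((-(2 * Real.pi)) • w) := by
      ext w
      have := hinv (-w)
      rw [Real.fourierInv_eq_fourier_neg, neg_neg] at this
      rw [this, smul_neg, neg_smul]
    rw [h1]
    exact ((integrable_fourierInv h φ).comp_smul (neg_ne_zero.2 (by positivity))).const_mul _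
  have h2 := hfi.fourier_fourierInv_eq hFi (hfc.continuousAt (x := X))
  rw [Real.fourier_eq'] at h2
  simp only [hinv] at h2
  have h3 := Measure.integral_comp_smul (volume : Measure E3)
    (fun ξ => fourierInv f ξ * char ξ X) (2 * Real.pi)
  rw [finrank_euclideanSpace, Fintype.card_fin, abs_of_pos (inv_pos.2 hpi)] at h3
  have h4 : ∫ ξ, fourierInv f ξ * char ξ X =
      ((2 * Real.pi) ^ 3 : ℝ) • ∫ w : E3, fourierInv f ((2 * Real.pi) • w) *
        char ((2 * Real.pi) • w) X := by
    rw [h3, smul_smul, mul_inv_cancel₀ hpi.ne', one_smul]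
  rw [h4, ← integral_smul]
  refine Eq.trans ?_ h2
  refine integral_congr_ae (ae_of_all _ fun w => ?_)
  simp only [smul_eq_mul, Complex.real_smul, char, inner_smul_right, real_inner_comm w X]
  have e : -Complex.I * ((2 * Real.pi * ⟪w, X⟫ : ℝ) : ℂ) =
      ((-2 * Real.pi * ⟪w, X⟫ : ℝ) : ℂ) * Complex.I := by push_cast; ring
  rw [e]
  ring

/-- Parseval's identity. -/
lemma integral_mul_testFunction (h : HolderConvex (Ω : Set E3) n α C) {z : E3 → ℝ}
    (hz : IntegrableOn z (Ω : Set E3)) (φ : 𝓓(Ω, ℝ)) :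
    ((∫ X in (Ω : Set E3), z X * φ X : ℝ) : ℂ) =
      ∫ ξ, charInt (volume.restrict (Ω : Set E3)) z ξ * fourierInv (fun X => (φ X : ℂ)) ξ := by
  rw [← integral_complex_ofReal]
  have h1 := integral_mul_char_swap hz (integrable_fourierInv h φ) continuous_id
  simp only [integral_fourierInv_mul_char h, id] at h1
  simp only [Complex.ofReal_mul]
  rw [h1]
  simp only [mul_comm]

lemma integral_fourierInv_mul (h : HolderConvex (Ω : Set E3) n α C) {G : E3 → ℂ}
    (hG : Integrable G) (φ : 𝓓(Ω, ℝ)) :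
    ∫ X in (Ω : Set E3), fourierInv G X * (φ X : ℂ) =
      ∫ ξ, G ξ * fourierInv (fun X => (φ X : ℂ)) ξ := by
  have h1 := integral_mul_char_swap (integrable_testFunction h φ) hG continuous_neg
  simp only [char_neg] at h1
  simp only [fourierInv_eq_charInt]
  set c : ℂ := ((((2 * Real.pi) ^ 3 : ℝ)⁻¹ : ℝ) : ℂ)
  calc _ = c * ∫ X in (Ω : Set E3), (φ X : ℂ) *
          ∫ ξ, G ξ * Complex.exp (Complex.I * (⟪X, ξ⟫ : ℝ)) := by
        rw [← integral_const_mul]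
        refine integral_congr_ae (ae_of_all _ fun X => ?_)
        simp only [fourierInv, c]
        push_cast
        ring
    _ = _ := by
        rw [h1, ← integral_const_mul]
        refine integral_congr_ae (ae_of_all _ fun ξ => ?_)
        simp only
        ring

end Inversion

/-! ### The mollified operators on the Fourier side -/

lemma fourier_gaussian {ε : ℝ} (hε : 0 < ε) (ξ : E3) :
    fourier (fun X => (gaussian ε X : ℂ)) ξ = (Real.exp (-(ε * ‖ξ‖ ^ 2 / 4)) : ℝ) := by
  have hb : 0 < ((ε⁻¹ : ℝ) : ℂ).re := by simpa using hε
  have h1 := GaussianFourier.integral_cexp_neg_mul_sq_norm_add hb (-Complex.I) ξ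
  have hs : 0 < √(Real.pi * ε) := Real.sqrt_pos.2 (by positivity)
  have h2 : ((Real.pi : ℂ) / ((ε⁻¹ : ℝ) : ℂ)) ^ ((Module.finrank ℝ E3 : ℂ) / 2) =
      ((√(Real.pi * ε) ^ 3 : ℝ) : ℂ) := by
    rw [← Complex.ofReal_div, div_inv_eq_mul, finrank_euclideanSpace, Fintype.card_fin,
      show (((3 : ℕ) : ℂ) / 2) = ((3 / 2 : ℝ) : ℂ) by push_cast; ring,
      ← Complex.ofReal_cpow (by positivity)]
    congr 1
    rw [Real.sqrt_eq_rpow, ← Real.rpow_natCast, ← Real.rpow_mul (by positivity)]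
    norm_num
  rw [h2] at h1
  have h3 : fourier (fun X => (gaussian ε X : ℂ)) ξ = ((1 / √(Real.pi * ε) ^ 3 : ℝ) : ℂ) *
      ∫ v : E3, Complex.exp (-((ε⁻¹ : ℝ) : ℂ) * (‖v‖ : ℂ) ^ 2 + -Complex.I * (⟪ξ, v⟫ : ℝ)) := by
    rw [fourier, ← integral_const_mul]
    refine integral_congr_ae (ae_of_all _ fun v => ?_)
    simp only [gaussian, Complex.exp_add, real_inner_comm ξ v]
    push_cast
    rw [mul_assoc]
    congr 3
    field_simp
  rw [h3, h1, ← mul_assoc, ← Complex.ofReal_mul, one_div, inv_mul_cancel₀ (by positivity),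
    Complex.ofReal_one, one_mul]
  push_cast
  congr 1
  rw [neg_sq, Complex.I_sq]
  have : (ε : ℂ) ≠ 0 := Complex.ofReal_ne_zero.2 hε.ne'
  field_simp

/-- From x^N / N! ≤ e^x with x = ε(1+|ξ|²)/4; the factor e^{ε/4} compensates the 1 in 1 + |ξ|². -/
lemma exists_exp_le_weight {ε : ℝ} (hε : 0 < ε) (N : ℕ) :
    ∃ K, 0 ≤ K ∧ ∀ ξ : E3, Real.exp (-(ε * ‖ξ‖ ^ 2 / 4)) ≤ K * Problem.weight N ξ := by
  refine ⟨Real.exp (ε / 4) * N.factorial * (4 / ε) ^ N, by positivity, fun ξ => ?_⟩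
  have h1 := Real.pow_div_factorial_le_exp (ε / 4 * (1 + ‖ξ‖ ^ 2)) (by positivity) N
  rw [Problem.weight, ← div_eq_mul_inv, le_div_iff₀ (by positivity)]
  rw [div_le_iff₀ (by positivity), mul_pow] at h1
  have h2 : Real.exp (ε / 4 * (1 + ‖ξ‖ ^ 2)) * Real.exp (-(ε * ‖ξ‖ ^ 2 / 4)) =
      Real.exp (ε / 4) := by
    rw [← Real.exp_add]; congr 1; ring
  have h3 : (4 / ε) ^ N * (ε / 4) ^ N = 1 := by
    rw [← mul_pow]; field_simp; simp
  have hE := Real.exp_pos (-(ε * ‖ξ‖ ^ 2 / 4))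
  calc Real.exp (-(ε * ‖ξ‖ ^ 2 / 4)) * (1 + ‖ξ‖ ^ 2) ^ N
      = Real.exp (-(ε * ‖ξ‖ ^ 2 / 4)) * ((4 / ε) ^ N *
          ((ε / 4) ^ N * (1 + ‖ξ‖ ^ 2) ^ N)) := by rw [← mul_assoc ((4 / ε) ^ N), h3, one_mul]
    _ ≤ Real.exp (-(ε * ‖ξ‖ ^ 2 / 4)) * ((4 / ε) ^ N *
          (Real.exp (ε / 4 * (1 + ‖ξ‖ ^ 2)) * N.factorial)) := by gcongr
    _ = (Real.exp (ε / 4 * (1 + ‖ξ‖ ^ 2)) * Real.exp (-(ε * ‖ξ‖ ^ 2 / 4))) * N.factorial *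
          (4 / ε) ^ N := by ring
    _ = _ := by rw [h2]

namespace Problem

variable {m : ℕ} {D : Problem m} {α : ℝ≥0} {C M : ℝ}
  {a₁ : MvPolynomial (Fin 3) ℂ} {P : Matrix (Idx m) (Idx m) (MvPolynomial (Fin 3) ℂ)}

lemma integrable_exp_mul {ε : ℝ} (hε : 0 < ε) {N : ℕ} {q : E3 → ℂ}
    (hq : Integrable fun ξ : E3 => ((weight N ξ : ℝ) : ℂ) * q ξ) :
    Integrable fun ξ : E3 => ((Real.exp (-(ε * ‖ξ‖ ^ 2 / 4)) : ℝ) : ℂ) * q ξ := by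
  obtain ⟨K, hK0, hK⟩ := exists_exp_le_weight hε N
  refine (hq.norm.const_mul K).mono' ?_ (ae_of_all _ fun ξ => ?_)
  · exact (Continuous.aestronglyMeasurable (by fun_prop)).mul (aestronglyMeasurable_of_weight hq)
  · rw [norm_mul, norm_mul, Complex.norm_real, Complex.norm_real, Real.norm_eq_abs,
      Real.norm_eq_abs, abs_of_pos (weight_pos N ξ), abs_of_pos (Real.exp_pos _), ← mul_assoc]
    exact mul_le_mul_of_nonneg_right (hK ξ) (norm_nonneg _)

lemma integrable_weight_mul_transform (hP : D.Parameters a₁ P) (hD : D.Standing α)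
    (h : HolderConvex (D.Ω : Set E3) D.nrm α C) {Z : E3 → Idx m → ℝ} (hZ : D.Admissible M Z)
    (i : Idx m) :
    Integrable fun ξ : E3 => ((weight (D.deg P + 3) ξ : ℝ) : ℂ) * D.transform Z i ξ := by
  obtain ⟨K, hK0, hK⟩ := exists_bound_transform hD h M
  refine ((integrable_dominant hP).const_mul K).mono' ?_ (ae_of_all _ fun ξ => ?_)
  · exact (Complex.continuous_ofReal.comp (continuous_weight _)).aestronglyMeasurable.mul
      (aestronglyMeasurable_transform hP hD h hZ i)
  · rw [norm_mul, Complex.norm_real, Real.norm_eq_abs, abs_of_pos (weight_pos _ ξ), dominant]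
    calc _ ≤ weight (D.deg P + 3) ξ * (K * D.majorant ξ) :=
          mul_le_mul_of_nonneg_left (hK Z hZ i ξ) (weight_pos _ ξ).le
      _ = _ := by ring

/-- `T_{0ε}` is the mollified inverse Fourier transform. -/
theorem T0eps_eq (hP : D.Parameters a₁ P) (hD : D.Standing α)
    (h : HolderConvex (D.Ω : Set E3) D.nrm α C) {Z : E3 → Idx m → ℝ} (hZ : D.Admissible M Z)
    {ε : ℝ} (hε : 0 < ε) (i : Idx m) (X : E3) :
    D.T0eps ε Z X i = fourierInv
      (fun ξ => ((Real.exp (-(ε * ‖ξ‖ ^ 2 / 4)) : ℝ) : ℂ) * D.transform Z i ξ) X := by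
  set mol : E3 → ℂ := fun ξ => ((Real.exp (-(ε * ‖ξ‖ ^ 2 / 4)) : ℝ) : ℂ) with hmol
  obtain ⟨B, hB0, hB⟩ := exists_bound_FIpsi hD h M
  have hpos : ∀ (q : E3 → ℂ), Integrable q →
      Integrable fun ξ => q ξ * Complex.exp (Complex.I * (⟪X, ξ⟫ : ℝ)) := by
    intro q hq
    refine hq.mul_bdd (c := 1) (Continuous.aestronglyMeasurable (by fun_prop))
      (ae_of_all _ fun ξ => ?_)
    rw [← char_neg, norm_char]
  have hb₂ : ∀ j, Integrable fun ξ => mol ξ * D.B₁invB₂ ξ i j := fun j =>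
    integrable_exp_mul hε (hP.integrable_invB₂ i j)
  have hfi : ∀ j, Integrable fun ξ => mol ξ * D.B₁invB₂ ξ i j * D.FIpsi Z ξ j := fun j =>
    (hb₂ j).mul_bdd (c := B) (continuous_FIpsi hD h hZ j).aestronglyMeasurable
      (ae_of_all _ fun ξ => hB Z hZ ξ j)
  have htr : Integrable fun ξ => mol ξ * D.transform Z i ξ :=
    integrable_exp_mul hε (integrable_weight_mul_transform hP hD h hZ i)
  have hsplit : ∀ ξ, mol ξ * D.transform Z i ξ = mol ξ * (D.B₁inv ξ).mulVec (D.beta Z ξ) i +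
      ∑ j, mol ξ * D.B₁invB₂ ξ i j * D.FIpsi Z ξ j := by
    intro ξ
    rw [transform, mul_add]
    congr 1
    simp only [Matrix.mulVec, dotProduct, Finset.mul_sum, mul_assoc]
  -- Since β₁ itself grows, integrability of this summand is obtained by subtraction from that of
  -- the whole transform.
  have hbt : Integrable fun ξ => mol ξ * (D.B₁inv ξ).mulVec (D.beta Z ξ) i := by
    refine (htr.sub (integrable_finsetSum Finset.univ fun j _ => hfi j)).congr
      (ae_of_all _ fun ξ => ?_)
    simp only [Pi.sub_apply, hsplit, add_sub_cancel_right]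
  have hw2 : ∀ j, ∫ Y in closure (D.Ω : Set E3),
      D.w2eps ε i j (X - Y) * (D.psi Y (Z Y) j : ℂ) =
      fourierInv (fun ξ => mol ξ * D.B₁invB₂ ξ i j * D.FIpsi Z ξ j) X := by
    intro j
    -- The exponential at X − Y splits into e^{iX·ξ}, absorbed into the ξ-integrand, and e^{-iY·ξ},
    -- which after Fubini produces `FIpsi`.
    have h1 := integral_mul_char_swap (integrable_psi hD h hZ j) (hpos _ (hb₂ j)) continuous_id
    have h2 : ∀ Y, D.w2eps ε i j (X - Y) * (D.psi Y (Z Y) j : ℂ) =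
        ((((2 * Real.pi) ^ 3 : ℝ)⁻¹ : ℝ) : ℂ) * ((D.psi Y (Z Y) j : ℂ) *
          ∫ ξ, mol ξ * D.B₁invB₂ ξ i j * Complex.exp (Complex.I * (⟪X, ξ⟫ : ℝ)) *
            char (id ξ) Y) := by
      intro Y
      rw [w2eps, fourierInv, mul_comm, mul_left_comm]
      congr 2
      refine integral_congr_ae (ae_of_all _ fun ξ => ?_)
      simp only [fourier_gaussian hε, id, char, inner_sub_left, hmol]
      rw [mul_assoc _ (Complex.exp _) (Complex.exp _), ← Complex.exp_add]
      congr 2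
      push_cast
      ring
    simp only [h2]
    rw [integral_const_mul, h1, fourierInv]
    congr 1
    refine integral_congr_ae (ae_of_all _ fun ξ => ?_)
    simp only [id, FIpsi_eq]
    ring
  rw [T0eps]
  simp only [hw2]
  have e : (fun ξ => fourier (fun X => (gaussian ε X : ℂ)) ξ *
      (D.B₁inv ξ).mulVec (D.beta Z ξ) i) =
      fun ξ => mol ξ * (D.B₁inv ξ).mulVec (D.beta Z ξ) i := by
    ext ξ; rw [fourier_gaussian hε]
  have e' : (fun ξ => mol ξ * D.transform Z i ξ) = _ := funext hsplit
  rw [w1eps, e, e']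
  simp only [fourierInv, add_mul, Finset.sum_mul]
  rw [integral_add (hpos _ hbt) (integrable_finsetSum _ fun j _ => hpos _ (hfi j)),
    integral_finsetSum _ fun j _ => hpos _ (hfi j), mul_add, Finset.mul_sum]

/-- The weak form of the fixed point equation. -/
theorem pairing_of_isFixed (hP : D.Parameters a₁ P) (hD : D.Standing α)
    (h : HolderConvex (D.Ω : Set E3) D.nrm α C) {Z : E3 → Idx m → ℝ} (hZ : D.Admissible M Z)
    {ε : ℝ} (hε : 0 < ε) (hfix : D.IsFixed ε Z) (i : Idx m) (φ : 𝓓(D.Ω, ℝ)) :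
    ((pairing D.Ω (fun X => Z X i) φ : ℝ) : ℂ) =
      ∫ ξ : E3, ((Real.exp (-(ε * ‖ξ‖ ^ 2 / 4)) : ℝ) : ℂ) * D.transform Z i ξ *
        fourierInv (fun X => (φ X : ℂ)) ξ := by
  rw [← integral_fourierInv_mul h
    (integrable_exp_mul hε (integrable_weight_mul_transform hP hD h hZ i)) φ, pairing,
    ← integral_complex_ofReal]
  refine setIntegral_congr_fun D.Ω.isOpen.measurableSet fun X hX => ?_
  simp only [Complex.ofReal_mul]
  rw [← T0eps_eq hP hD h hZ hε, hfix X (subset_closure hX) i]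

end Problem


/-! ### Weak limits of bounded sequences -/

section WeakLimit

variable {ι : Type*} [Fintype ι] {μ : Measure E3} [IsFiniteMeasure μ]

lemma norm_toLp_le {v : ι → ℝ} {M : ℝ} (hv : ∀ i, |v i| ≤ M) :
    ‖WithLp.toLp 2 v‖ ≤ √(∑ _i : ι, M ^ 2) := by
  rw [EuclideanSpace.norm_eq]
  refine Real.sqrt_le_sqrt (Finset.sum_le_sum fun i _ => ?_)
  exact pow_le_pow_left₀ (norm_nonneg _) (hv i) 2

/-- Bounded sequences of functions have weakly convergent subsequences. -/
theorem exists_weak_limit {b : ℕ → E3 → ι → ℝ} {M : ℝ}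
    (hm : ∀ k, AEStronglyMeasurable (b k) μ) (hB : ∀ k, ∀ᵐ X ∂μ, ∀ i, |b k X i| ≤ M) :
    ∃ n : ℕ → ℕ, StrictMono n ∧ ∃ z : E3 → ι → ℝ, (∀ i, Integrable (fun X => z X i) μ) ∧
      (∀ i, ∀ᵐ X ∂μ, |z X i| ≤ M) ∧
      ∀ i, ∀ g : E3 → ℝ, AEStronglyMeasurable g μ → (∃ B, ∀ᵐ X ∂μ, |g X| ≤ B) →
        Tendsto (fun k => ∫ X, b (n k) X i * g X ∂μ) atTop (𝓝 (∫ X, z X i * g X ∂μ)) := by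
  classical
  have hLm : ∀ {c : E3 → ι → ℝ}, AEStronglyMeasurable c μ →
      AEStronglyMeasurable (fun X => WithLp.toLp 2 (c X) : E3 → EuclideanSpace ℝ ι) μ :=
    fun hc => (PiLp.continuous_toLp 2 _).comp_aestronglyMeasurable hc
  -- All components are placed in one Hilbert space of vector-valued functions, so that one
  -- subsequence serves all of them.
  have hMem : ∀ k, MemLp (fun X => WithLp.toLp 2 (b k X) : E3 → EuclideanSpace ℝ ι) 2 μ :=
    fun k => MemLp.of_bound (hLm (hm k)) _ ((hB k).mono fun X hX => norm_toLp_le hX)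
  set F : ℕ → Lp (EuclideanSpace ℝ ι) 2 μ := fun k => (hMem k).toLp _ with hF
  set R : ℝ := measureUnivNNReal μ ^ (2 : ℝ≥0∞).toReal⁻¹ * √(∑ _i : ι, M ^ 2)
  have hFR : ∀ k, ‖F k‖ ≤ R := fun k => by
    refine Lp.norm_le_of_ae_bound (Real.sqrt_nonneg _) ?_
    filter_upwards [(hMem k).coeFn_toLp, hB k] with X h1 h2
    rw [hF, h1]
    exact norm_toLp_le h2
  set L : ℕ → WeakDual ℝ (Lp (EuclideanSpace ℝ ι) 2 μ) := fun k =>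
    StrongDual.toWeakDual (InnerProductSpace.toDual ℝ _ (F k))
  have hL : ∀ k, L k ∈ WeakDual.toStrongDual ⁻¹' Metric.closedBall
      (0 : StrongDual ℝ (Lp (EuclideanSpace ℝ ι) 2 μ)) R := fun k => by
    rw [mem_preimage, mem_closedBall_zero_iff]
    change ‖InnerProductSpace.toDual ℝ _ (F k)‖ ≤ R
    rw [LinearIsometryEquiv.norm_map]
    exact hFR k
  have : Fact ((2 : ℝ≥0∞) ≠ ∞) := ⟨by simp⟩
  have : SecondCountableTopology (Lp (EuclideanSpace ℝ ι) 2 μ) :=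
    Lp.SecondCountableTopology
  -- Sequential Banach–Alaoglu, available because L² is separable; Riesz representation brings the
  -- limit functional back to L².
  obtain ⟨a, -, n, hn, hlim⟩ := WeakDual.isSeqCompact_closedBall ℝ _ 0 R hL
  set G : Lp (EuclideanSpace ℝ ι) 2 μ :=
    (InnerProductSpace.toDual ℝ _).symm (WeakDual.toStrongDual a) with hG
  have hconv : ∀ f : Lp (EuclideanSpace ℝ ι) 2 μ,
      Tendsto (fun k => ∫ X, ⟪F (n k) X, f X⟫ ∂μ) atTop (𝓝 (∫ X, ⟪G X, f X⟫ ∂μ)) := by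
    intro f
    have h1 := ((WeakDual.eval_continuous f).tendsto a).comp hlim
    have h2 : a f = ∫ X, ⟪G X, f X⟫ ∂μ := by
      rw [← L2.inner_def, hG, InnerProductSpace.toDual_symm_apply]
      rfl
    rw [← h2]
    exact h1
  have hGi : ∀ i, Integrable (fun X => G X i) μ := fun i =>
    ((EuclideanSpace.proj (𝕜 := ℝ) i).integrable_comp
      ((Lp.memLp G).integrable (by norm_num)))
  have hweak : ∀ i, ∀ g : E3 → ℝ, AEStronglyMeasurable g μ → (∃ B, ∀ᵐ X ∂μ, |g X| ≤ B) →
      Tendsto (fun k => ∫ X, b (n k) X i * g X ∂μ) atTop (𝓝 (∫ X, G X i * g X ∂μ)) := by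
    rintro i g hg ⟨B, hgB⟩
    have hfm : MemLp (fun X => EuclideanSpace.single i (g X) : E3 → EuclideanSpace ℝ ι) 2 μ := by
      have h1 : (fun X => EuclideanSpace.single i (g X) : E3 → EuclideanSpace ℝ ι) =
          fun X => g X • EuclideanSpace.single i (1 : ℝ) := by
        ext X j
        simp
      refine MemLp.of_bound ?_ B (hgB.mono fun X hX => ?_)
      · rw [h1]; exact hg.smul_const _
      · simpa using hX
    have h2 := hconv (hfm.toLp _)
    have h3 : ∫ X, ⟪G X, (hfm.toLp _ : Lp (EuclideanSpace ℝ ι) 2 μ) X⟫ ∂μ =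
        ∫ X, G X i * g X ∂μ := by
      refine integral_congr_ae ?_
      filter_upwards [hfm.coeFn_toLp] with X hX
      rw [hX, EuclideanSpace.inner_single_right]
      simp [mul_comm]
    rw [h3] at h2
    refine h2.congr fun k => integral_congr_ae ?_
    filter_upwards [hfm.coeFn_toLp, (hMem (n k)).coeFn_toLp] with X hX hX'
    rw [hX, hF, hX', EuclideanSpace.inner_single_right]
    simp [mul_comm]
  have hbi : ∀ k i, Integrable (fun X => b k X i) μ := fun k i =>
    Integrable.of_bound ((continuous_apply i).comp_aestronglyMeasurable (hm k)) M
      ((hB k).mono fun X hX => hX i)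
  have hset : ∀ i s, MeasurableSet s →
      Tendsto (fun k => ∫ X in s, b (n k) X i ∂μ) atTop (𝓝 (∫ X in s, G X i ∂μ)) := by
    intro i s hs
    have h1 := hweak i (s.indicator 1) (stronglyMeasurable_one.indicator hs).aestronglyMeasurable
      ⟨1, ae_of_all _ fun X => by by_cases hX : X ∈ s <;> simp [hX]⟩
    have h2 : ∀ f : E3 → ℝ, ∫ X, f X * s.indicator 1 X ∂μ = ∫ X in s, f X ∂μ := fun f => by
      rw [← integral_indicator hs]
      refine integral_congr_ae (ae_of_all _ fun X => ?_)
      by_cases hX : X ∈ s <;> simp [hX]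
    simpa only [h2] using h1
  refine ⟨n, hn, fun X i => G X i, hGi, fun i => ?_, hweak⟩
  -- Testing with indicators carries the bounds ±M on averages over sets to the weak limit.
  have hup : (fun X => G X i) ≤ᵐ[μ] fun _ => M := by
    refine ae_le_of_forall_setIntegral_le (hGi i) (integrable_const _) fun s hs _ => ?_
    refine le_of_tendsto (hset i s hs) (Eventually.of_forall fun k => ?_)
    exact integral_mono_ae (hbi _ i).integrableOn (integrable_const _)
      (ae_restrict_of_ae ((hB (n k)).mono fun X hX => (abs_le.1 (hX i)).2))
  have hlo : (fun _ => -M) ≤ᵐ[μ] fun X => G X i := by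
    refine ae_le_of_forall_setIntegral_le (integrable_const _) (hGi i) fun s hs _ => ?_
    refine ge_of_tendsto (hset i s hs) (Eventually.of_forall fun k => ?_)
    exact integral_mono_ae (integrable_const _) (hbi _ i).integrableOn
      (ae_restrict_of_ae ((hB (n k)).mono fun X hX => (abs_le.1 (hX i)).1))
  filter_upwards [hup, hlo] with X h1 h2
  exact abs_le.2 ⟨h2, h1⟩

end WeakLimit

/-- Weak convergence is available against real bounded functions, so the character is split into two
such functions. -/
lemma charInt_eq_cos_sin {μ : Measure E3} {b : E3 → ℝ} (hb : Integrable b μ) (ξ : E3) :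
    charInt μ b ξ = ((∫ X, b X * Real.cos ⟪X, ξ⟫ ∂μ : ℝ) : ℂ) -
      Complex.I * ((∫ X, b X * Real.sin ⟪X, ξ⟫ ∂μ : ℝ) : ℂ) := by
  have hc : Integrable (fun X => b X * Real.cos ⟪X, ξ⟫) μ :=
    hb.mul_bdd (c := 1) (Continuous.aestronglyMeasurable (by fun_prop))
      (ae_of_all _ fun X => Real.abs_cos_le_one _)
  have hs : Integrable (fun X => b X * Real.sin ⟪X, ξ⟫) μ :=
    hb.mul_bdd (c := 1) (Continuous.aestronglyMeasurable (by fun_prop))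
      (ae_of_all _ fun X => Real.abs_sin_le_one _)
  rw [← integral_complex_ofReal, ← integral_complex_ofReal, ← integral_const_mul,
    ← integral_sub hc.ofReal (hs.ofReal.const_mul _), charInt]
  refine integral_congr_ae (ae_of_all _ fun X => ?_)
  simp only [char]
  rw [show -Complex.I * ((⟪X, ξ⟫ : ℝ) : ℂ) = ((-⟪X, ξ⟫ : ℝ) : ℂ) * Complex.I by push_cast; ring,
    Complex.exp_mul_I, ← Complex.ofReal_cos, ← Complex.ofReal_sin, Real.cos_neg, Real.sin_neg]
  push_cast
  ring


/-! ### Convergence in negative norms -/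

section NegNorm

variable {F : Type*} [NormedAddCommGroup F] {Ω : TopologicalSpace.Opens E3}

lemma sobolevNorm_nonneg (n : ℕ) (φ : 𝓓(Ω, ℝ)) : 0 ≤ sobolevNorm Ω n φ := Real.sqrt_nonneg _

lemma negNorm_le {n : ℕ} {L : 𝓓(Ω, ℝ) → F} {c : ℝ} (hc : 0 ≤ c)
    (hL : ∀ φ, ‖L φ‖ ≤ c * sobolevNorm Ω n φ) : negNorm Ω n L ≤ ENNReal.ofReal c := by
  refine iSup_le fun φ => ENNReal.div_le_of_le_mul ?_
  rw [← ENNReal.ofReal_mul hc, ← ofReal_norm]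
  exact ENNReal.ofReal_le_ofReal (hL φ)

lemma tendsto_vecNegNorm {ι : Type*} {n : ℕ} {L : ℕ → ι → 𝓓(Ω, ℝ) → F} {c : ℕ → ℝ}
    (hc : ∀ k, 0 ≤ c k) (hL : ∀ k i φ, ‖L k i φ‖ ≤ c k * sobolevNorm Ω n φ)
    (hlim : Tendsto c atTop (𝓝 0)) :
    Tendsto (fun k => vecNegNorm Ω n (L k)) atTop (𝓝 0) := by
  have h := (ENNReal.continuous_ofReal.tendsto 0).comp hlim
  rw [ENNReal.ofReal_zero] at h
  exact tendsto_of_tendsto_of_tendsto_of_le_of_le tendsto_const_nhds h (fun _ => zero_le)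
    fun k => iSup_le fun i => negNorm_le (hc k) (hL k i)

/-- The transform of φ pays for the weight, so a functional given by G on the Fourier side has
negative norm controlled by the weighted L¹ norm of G. Estimates in the negative norm thereby reduce
to dominated convergence of an integral independent of φ. -/
lemma norm_integral_fourierInv_le {K : ℝ} {N : ℕ} {φ : 𝓓(Ω, ℝ)}
    (hK0 : 0 ≤ K) (hK : ∀ ξ, ‖fourierInv (fun X => (φ X : ℂ)) ξ‖ ≤
      K * sobolevNorm Ω (2 * N) φ * Problem.weight N ξ)
    {G : E3 → ℂ} {g : E3 → ℝ} (hg : Integrable g) (hG : ∀ ξ, ‖G ξ‖ * Problem.weight N ξ ≤ g ξ) :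
    ‖∫ ξ, G ξ * fourierInv (fun X => (φ X : ℂ)) ξ‖ ≤
      K * (∫ ξ, g ξ) * sobolevNorm Ω (2 * N) φ := by
  calc _ ≤ ∫ ξ, K * sobolevNorm Ω (2 * N) φ * g ξ := by
        refine norm_integral_le_of_norm_le (hg.const_mul _) (ae_of_all _ fun ξ => ?_)
        rw [norm_mul]
        calc _ ≤ ‖G ξ‖ * (K * sobolevNorm Ω (2 * N) φ * Problem.weight N ξ) :=
              mul_le_mul_of_nonneg_left (hK ξ) (norm_nonneg _)
          _ = K * sobolevNorm Ω (2 * N) φ * (‖G ξ‖ * Problem.weight N ξ) := by ring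
          _ ≤ _ := mul_le_mul_of_nonneg_left (hG ξ) (mul_nonneg hK0 (sobolevNorm_nonneg _ _))
    _ = _ := by rw [integral_const_mul]; ring

end NegNorm

/-! ### Approximate fixed points: defect, limits almost everywhere, weak limits -/

namespace Problem

variable {m : ℕ} {D : Problem m} {α : ℝ≥0} {C M : ℝ} {a₁ : MvPolynomial (Fin 3) ℂ}
  {P : Matrix (Idx m) (Idx m) (MvPolynomial (Fin 3) ℂ)}

lemma norm_transform_mul_fourierInv_le {K K' : ℝ} (hK0 : 0 ≤ K)
    {Z : E3 → Idx m → ℝ} {i : Idx m} {φ : 𝓓(D.Ω, ℝ)} {N : ℕ} {ξ : E3}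
    (hK : ‖D.transform Z i ξ‖ ≤ K * D.majorant ξ)
    (hK' : ‖fourierInv (fun X => (φ X : ℂ)) ξ‖ ≤
      K' * sobolevNorm D.Ω N φ * weight (D.deg P + 3) ξ) :
    ‖D.transform Z i ξ * fourierInv (fun X => (φ X : ℂ)) ξ‖ ≤
      K * K' * sobolevNorm D.Ω N φ * D.dominant P ξ := by
  rw [norm_mul, dominant]
  calc _ ≤ (K * D.majorant ξ) * (K' * sobolevNorm D.Ω N φ * weight (D.deg P + 3) ξ) :=
        mul_le_mul hK hK' (norm_nonneg _)
          (mul_nonneg hK0 (zero_le_one.trans (one_le_majorant ξ)))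
    _ = _ := by ring

lemma exists_bound_transform_mul (hD : D.Standing α)
    (h : HolderConvex (D.Ω : Set E3) D.nrm α C) (M : ℝ) (φ : 𝓓(D.Ω, ℝ))
    (P : Matrix (Idx m) (Idx m) (MvPolynomial (Fin 3) ℂ)) :
    ∃ B, ∀ Z, D.Admissible M Z → ∀ i ξ,
      ‖D.transform Z i ξ * fourierInv (fun X => (φ X : ℂ)) ξ‖ ≤ B * D.dominant P ξ := by
  obtain ⟨K, hK0, hK⟩ := exists_bound_transform hD h M
  obtain ⟨K', -, hK'⟩ := exists_norm_fourierInv_le h (D.deg P + 3)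
  exact ⟨_, fun Z hZ i ξ => norm_transform_mul_fourierInv_le hK0 (hK Z hZ i ξ) (hK' φ ξ)⟩

lemma aestronglyMeasurable_transform_mul (hP : D.Parameters a₁ P) (hD : D.Standing α)
    (h : HolderConvex (D.Ω : Set E3) D.nrm α C) {Z : E3 → Idx m → ℝ} (hZ : D.Admissible M Z)
    (i : Idx m) (φ : 𝓓(D.Ω, ℝ)) :
    AEStronglyMeasurable
      (fun ξ => D.transform Z i ξ * fourierInv (fun X => (φ X : ℂ)) ξ) volume :=
  (aestronglyMeasurable_transform hP hD h hZ i).mul (continuous_fourierInv h φ).aestronglyMeasurable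

lemma integrable_transform_mul (hP : D.Parameters a₁ P) (hD : D.Standing α)
    (h : HolderConvex (D.Ω : Set E3) D.nrm α C) {Z : E3 → Idx m → ℝ} (hZ : D.Admissible M Z)
    (i : Idx m) (φ : 𝓓(D.Ω, ℝ)) :
    Integrable fun ξ => D.transform Z i ξ * fourierInv (fun X => (φ X : ℂ)) ξ := by
  obtain ⟨B, hB⟩ := exists_bound_transform_mul hD h M φ P
  exact ((integrable_dominant hP).const_mul B).mono'
    (aestronglyMeasurable_transform_mul hP hD h hZ i φ) (ae_of_all _ (hB Z hZ i))

/-- The Fourier transform of the mollifier `δ_ε`. -/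
def damping (ε : ℝ) (ξ : E3) : ℝ := Real.exp (-(ε * ‖ξ‖ ^ 2 / 4))

lemma continuous_damping (ε : ℝ) : Continuous (damping ε) := by unfold damping; fun_prop

lemma damping_pos (ε : ℝ) (ξ : E3) : 0 < damping ε ξ := Real.exp_pos _

lemma damping_le_one {ε : ℝ} (hε : 0 ≤ ε) (ξ : E3) : damping ε ξ ≤ 1 :=
  Real.exp_le_one_iff.2 (by have : 0 ≤ ε * ‖ξ‖ ^ 2 / 4 := by positivity
                            linarith)

lemma tendsto_damping {ε : ℕ → ℝ} (hlim : Tendsto ε atTop (𝓝 0)) (ξ : E3) :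
    Tendsto (fun k => damping (ε k) ξ) atTop (𝓝 1) := by
  have h : Continuous fun t : ℝ => damping t ξ := by unfold damping; fun_prop
  have h1 := (h.tendsto 0).comp hlim
  simpa [damping, Function.comp_def] using h1

/-- The defect of approximate solutions, in negative norm. -/
theorem tendsto_defect (hP : D.Parameters a₁ P) (hD : D.Standing α)
    (h : HolderConvex (D.Ω : Set E3) D.nrm α C) {ε : ℕ → ℝ} {Z : ℕ → E3 → Idx m → ℝ}
    (hε : ∀ k, 0 < ε k) (hlim : Tendsto ε atTop (𝓝 0)) (hZ : ∀ k, D.Admissible M (Z k))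
    (hfix : ∀ k, D.IsFixed (ε k) (Z k)) :
    Tendsto (fun k => vecNegNorm D.Ω (D.m₁ P) fun i φ =>
      ((pairing D.Ω (fun X => Z k X i) φ : ℝ) : ℂ) - D.T0 (Z k) i φ) atTop (𝓝 0) := by
  obtain ⟨K, hK0, hK⟩ := exists_bound_transform hD h M
  obtain ⟨K', hK'0, hK'⟩ := exists_norm_fourierInv_le h (D.deg P + 3)
  have hm : D.m₁ P = 2 * (D.deg P + 3) := by unfold m₁; ring
  rw [hm]
  -- The bound of `transform` is uniform along the sequence, so k enters only through the Gaussian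
  -- factor, which tends to 1. No convergence of Z_k is needed.
  set g : ℕ → E3 → ℝ := fun k ξ => (1 - damping (ε k) ξ) * (K * D.dominant P ξ) with hg
  have hd0 : ∀ k ξ, 0 ≤ 1 - damping (ε k) ξ :=
    fun k ξ => sub_nonneg.2 (damping_le_one (hε k).le ξ)
  have hdom := (integrable_dominant hP).const_mul K
  have hgm : ∀ k, AEStronglyMeasurable (g k) volume := fun k =>
    (continuous_const.sub (continuous_damping _)).aestronglyMeasurable.mul hdom.1
  have hgle : ∀ k ξ, ‖g k ξ‖ ≤ K * D.dominant P ξ := fun k ξ => by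
    have h0 : 0 ≤ K * D.dominant P ξ := mul_nonneg hK0 (dominant_nonneg ξ)
    rw [hg, Real.norm_of_nonneg (mul_nonneg (hd0 k ξ) h0)]
    exact mul_le_of_le_one_left h0 (by linarith [damping_pos (ε k) ξ])
  have hgi : ∀ k, Integrable (g k) := fun k => hdom.mono' (hgm k) (ae_of_all _ (hgle k))
  have hg0 : Tendsto (fun k => ∫ ξ, g k ξ) atTop (𝓝 0) := by
    have h1 := tendsto_integral_of_dominated_convergence (f := fun _ : E3 => (0 : ℝ)) _ hgm hdom
      (fun k => ae_of_all _ (hgle k)) (ae_of_all _ fun ξ => by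
        simpa [hg] using
          ((tendsto_const_nhds (x := (1 : ℝ))).sub (tendsto_damping hlim ξ)).mul_const
            (K * D.dominant P ξ))
    simpa using h1
  refine tendsto_vecNegNorm (c := fun k => K' * ∫ ξ, g k ξ) (fun k => mul_nonneg hK'0
    (integral_nonneg fun ξ => mul_nonneg (hd0 k ξ) (mul_nonneg hK0 (dominant_nonneg ξ))))
    (fun k i φ => ?_) (by simpa using hg0.const_mul K')
  have hT := integrable_transform_mul hP hD h (hZ k) i φ
  have hTe : Integrable fun ξ => ((damping (ε k) ξ : ℝ) : ℂ) * D.transform (Z k) i ξ *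
      fourierInv (fun X => (φ X : ℂ)) ξ := by
    simp only [mul_assoc]
    refine hT.bdd_mul (c := 1)
      (Complex.continuous_ofReal.comp (continuous_damping _)).aestronglyMeasurable
      (ae_of_all _ fun ξ => ?_)
    rw [Complex.norm_real, Real.norm_of_nonneg (damping_pos _ ξ).le]
    exact damping_le_one (hε k).le ξ
  have e1 : ((pairing D.Ω (fun X => Z k X i) φ : ℝ) : ℂ) - D.T0 (Z k) i φ =
      ∫ ξ, (((damping (ε k) ξ : ℝ) : ℂ) - 1) * D.transform (Z k) i ξ *
        fourierInv (fun X => (φ X : ℂ)) ξ := by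
    rw [pairing_of_isFixed hP hD h (hZ k) (hε k) (hfix k)]
    refine (integral_sub hTe hT).symm.trans (integral_congr_ae (ae_of_all _ fun ξ => ?_))
    simp only
    ring
  rw [e1]
  refine norm_integral_fourierInv_le hK'0 (hK' φ) (hgi k) fun ξ => ?_
  have e2 : ‖((damping (ε k) ξ : ℝ) : ℂ) - 1‖ = 1 - damping (ε k) ξ := by
    rw [← Complex.ofReal_one, ← Complex.ofReal_sub, Complex.norm_real, Real.norm_eq_abs,
      abs_sub_comm, abs_of_nonneg (hd0 k ξ)]
  rw [norm_mul, e2]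
  calc _ ≤ (1 - damping (ε k) ξ) * (K * D.majorant ξ) * weight (D.deg P + 3) ξ :=
        mul_le_mul_of_nonneg_right (mul_le_mul_of_nonneg_left (hK _ (hZ k) i ξ) (hd0 k ξ))
          (weight_pos _ _).le
    _ = _ := by simp only [hg, dominant]; ring

lemma volume_restrict_finite (h : HolderConvex (D.Ω : Set E3) D.nrm α C) :
    IsFiniteMeasure (volume.restrict (D.Ω : Set E3)) := by
  have := h.isFiniteMeasure_volume
  exact isFiniteMeasure_of_le _ (Measure.restrict_mono_set _ subset_closure)

lemma Admissible.meas_restrict {Z : E3 → Idx m → ℝ} (hZ : D.Admissible M Z) :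
    AEStronglyMeasurable Z (volume.restrict (D.Ω : Set E3)) :=
  hZ.meas.mono_measure (Measure.restrict_mono_set _ subset_closure)

lemma Admissible.ae_bound {Z : E3 → Idx m → ℝ} (hZ : D.Admissible M Z) :
    ∀ᵐ X ∂volume.restrict (D.Ω : Set E3), ∀ i, |Z X i| ≤ M := by
  filter_upwards [ae_restrict_mem D.Ω.isOpen.measurableSet] with X hX i
  exact hZ.bound X (subset_closure hX) i

/-- Limits of approximate solutions almost everywhere are fixed points of `T_0`. -/
theorem pairing_eq_T0_of_tendsto (hP : D.Parameters a₁ P) (hD : D.Standing α)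
    (h : HolderConvex (D.Ω : Set E3) D.nrm α C) {ε : ℕ → ℝ} {Z : ℕ → E3 → Idx m → ℝ}
    {Zs : E3 → Idx m → ℝ} (hε : ∀ k, 0 < ε k) (hlim : Tendsto ε atTop (𝓝 0))
    (hZ : ∀ k, D.Admissible M (Z k)) (hZs : D.Admissible M Zs)
    (hfix : ∀ k, D.IsFixed (ε k) (Z k)) (hae : D.AeTendsto Z Zs) (i : Idx m) (φ : 𝓓(D.Ω, ℝ)) :
    ((pairing D.Ω (fun X => Zs X i) φ : ℝ) : ℂ) = D.T0 Zs i φ := by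
  have hl : Tendsto (fun k => pairing D.Ω (fun X => Z k X i) φ) atTop
      (𝓝 (pairing D.Ω (fun X => Zs X i) φ)) := by
    refine tendsto_integral_of_dominated_convergence (fun X => M * ‖φ X‖) (fun k =>
      ((continuous_apply i).comp_aestronglyMeasurable (hZ k).meas_restrict).mul
        φ.continuous.aestronglyMeasurable) ((integrable_testFunction h φ).norm.const_mul M)
      (fun k => (hZ k).ae_bound.mono fun X hX => ?_) ?_
    · rw [norm_mul]
      exact mul_le_mul_of_nonneg_right (hX i) (norm_nonneg _)
    · filter_upwards [ae_mono (Measure.restrict_mono_set volume subset_closure) hae] with X hX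
      exact ((tendsto_pi_nhds.1 hX) i).mul_const _
  obtain ⟨B, hB⟩ := exists_bound_transform_mul hD h M φ P
  have hr : Tendsto (fun k => ∫ ξ, ((damping (ε k) ξ : ℝ) : ℂ) * D.transform (Z k) i ξ *
      fourierInv (fun X => (φ X : ℂ)) ξ) atTop (𝓝 (D.T0 Zs i φ)) := by
    refine tendsto_integral_of_dominated_convergence (fun ξ => B * D.dominant P ξ) (fun k => ?_)
      ((integrable_dominant hP).const_mul B) (fun k => ae_of_all _ fun ξ => ?_)
      (ae_of_all _ fun ξ => ?_)
    · simp only [mul_assoc]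
      exact (Complex.continuous_ofReal.comp (continuous_damping _)).aestronglyMeasurable.mul
        (aestronglyMeasurable_transform_mul hP hD h (hZ k) i φ)
    · rw [mul_assoc, norm_mul, Complex.norm_real, Real.norm_of_nonneg (damping_pos _ ξ).le]
      exact (mul_le_of_le_one_left (norm_nonneg _) (damping_le_one (hε k).le ξ)).trans
        (hB _ (hZ k) i ξ)
    · have h1 := (Complex.continuous_ofReal.tendsto 1).comp (tendsto_damping hlim ξ)
      have h2 := (h1.mul (tendsto_transform hD h hZ hZs hae i ξ)).mul_const
        (fourierInv (fun X => (φ X : ℂ)) ξ)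
      rw [Complex.ofReal_one, one_mul] at h2
      exact h2
  refine tendsto_nhds_unique ((Complex.continuous_ofReal.tendsto _).comp hl) (hr.congr fun k => ?_)
  exact (pairing_of_isFixed hP hD h (hZ k) (hε k) (hfix k) i φ).symm

open Classical in
lemma exists_admissible_limit {Z : ℕ → E3 → Idx m → ℝ} (hM : 0 ≤ M)
    (hZ : ∀ k, D.Admissible M (Z k))
    (hae : ∀ᵐ X ∂(volume.restrict (closure (D.Ω : Set E3))),
      ∃ l : Idx m → ℝ, Tendsto (fun k => Z k X) atTop (𝓝 l)) :
    ∃ Zs, D.AeTendsto Z Zs ∧ D.Admissible M Zs := by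
  -- Where there is no limit the value 0 keeps the bound valid at every point; this is where 0 ≤ M
  -- is used.
  set Zs : E3 → Idx m → ℝ := fun X =>
    if hX : ∃ l : Idx m → ℝ, Tendsto (fun k => Z k X) atTop (𝓝 l) then hX.choose else 0 with hZs
  have ht : ∀ X, (∃ l : Idx m → ℝ, Tendsto (fun k => Z k X) atTop (𝓝 l)) →
      Tendsto (fun k => Z k X) atTop (𝓝 (Zs X)) := fun X hX => by
    simp only [hZs, dif_pos hX]
    exact hX.choose_spec
  have hlim : D.AeTendsto Z Zs := hae.mono ht
  refine ⟨Zs, hlim, aestronglyMeasurable_of_tendsto_ae atTop (fun k => (hZ k).meas) hlim,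
    fun Y hY i => ?_⟩
  by_cases hX : ∃ l : Idx m → ℝ, Tendsto (fun k => Z k Y) atTop (𝓝 l)
  · exact le_of_tendsto ((tendsto_pi_nhds.1 (ht Y hX)) i).abs
      (Eventually.of_forall fun k => (hZ k).bound Y hY i)
  · simpa only [hZs, dif_neg hX, Pi.zero_apply, abs_zero] using hM

lemma Admissible.memLp {Z : E3 → Idx m → ℝ} (hZ : D.Admissible M Z) (i : Idx m) :
    MemLp (fun X => Z X i) ∞ (volume.restrict (closure (D.Ω : Set E3))) ∧
      eLpNorm (fun X => Z X i) ∞ (volume.restrict (closure (D.Ω : Set E3))) ≤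
        ENNReal.ofReal M := by
  have hb : ∀ᵐ X ∂volume.restrict (closure (D.Ω : Set E3)), ‖Z X i‖ ≤ M := by
    filter_upwards [ae_restrict_mem isClosed_closure.measurableSet] with X hX
    exact hZ.bound X hX i
  refine ⟨memLp_top_of_bound ((continuous_apply i).comp_aestronglyMeasurable hZ.meas) M hb, ?_⟩
  rw [eLpNorm_exponent_top]
  exact eLpNormEssSup_le_of_ae_bound hb

/-- Weak convergence of bounded sequences implies convergence in negative norm. -/
theorem tendsto_vecNegNorm_of_weak (h : HolderConvex (D.Ω : Set E3) D.nrm α C) {N : ℕ}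
    (hN : 2 ≤ N) {b : ℕ → E3 → Idx m → ℝ} {z : E3 → Idx m → ℝ}
    (hb : ∀ k i, Integrable (fun X => b k X i) (volume.restrict (D.Ω : Set E3)))
    (hz : ∀ i, Integrable (fun X => z X i) (volume.restrict (D.Ω : Set E3)))
    (hbM : ∀ k, ∀ᵐ X ∂volume.restrict (D.Ω : Set E3), ∀ i, |b k X i| ≤ M)
    (hzM : ∀ i, ∀ᵐ X ∂volume.restrict (D.Ω : Set E3), |z X i| ≤ M)
    (hweak : ∀ i, ∀ g : E3 → ℝ, AEStronglyMeasurable g (volume.restrict (D.Ω : Set E3)) →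
      (∃ B, ∀ᵐ X ∂volume.restrict (D.Ω : Set E3), |g X| ≤ B) →
      Tendsto (fun k => ∫ X in (D.Ω : Set E3), b k X i * g X) atTop
        (𝓝 (∫ X in (D.Ω : Set E3), z X i * g X))) :
    Tendsto (fun k => vecNegNorm D.Ω (2 * N) fun i φ =>
      pairing D.Ω (fun X => b k X i) φ - pairing D.Ω (fun X => z X i) φ) atTop (𝓝 0) := by
  have := volume_restrict_finite h
  set μ := volume.restrict (D.Ω : Set E3)
  obtain ⟨K, hK0, hK⟩ := exists_norm_fourierInv_le h N
  set q : ℕ → Idx m → E3 → ℂ := fun k i ξ =>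
    charInt μ (fun X => b k X i) ξ - charInt μ (fun X => z X i) ξ with hq
  have hqc : ∀ k i, Continuous (q k i) := fun k i =>
    (continuous_charInt (hb k i)).sub (continuous_charInt (hz i))
  have hqb : ∀ k i ξ, ‖q k i ξ‖ ≤ 2 * (M * μ.real univ) := fun k i ξ => by
    refine (norm_sub_le _ _).trans ?_
    rw [two_mul]
    exact add_le_add (norm_charInt_le_of_bound ((hbM k).mono fun X hX => hX i) ξ)
      (norm_charInt_le_of_bound (hzM i) ξ)
  -- On the bounded set Ω the functions cos⟨X, ξ⟩ and sin⟨X, ξ⟩ are admissible weak test functions,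
  -- so weak convergence gives pointwise convergence of the transforms.
  have hq0 : ∀ i ξ, Tendsto (fun k => q k i ξ) atTop (𝓝 0) := fun i ξ => by
    have h1 := hweak i (fun X => Real.cos ⟪X, ξ⟫) (Continuous.aestronglyMeasurable (by fun_prop))
      ⟨1, ae_of_all _ fun X => Real.abs_cos_le_one _⟩
    have h2 := hweak i (fun X => Real.sin ⟪X, ξ⟫) (Continuous.aestronglyMeasurable (by fun_prop))
      ⟨1, ae_of_all _ fun X => Real.abs_sin_le_one _⟩
    have h3 := ((Complex.continuous_ofReal.tendsto _).comp h1).sub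
      (((Complex.continuous_ofReal.tendsto _).comp h2).const_mul Complex.I)
    rw [← charInt_eq_cos_sin (hz i)] at h3
    have h4 := h3.sub_const (charInt μ (fun X => z X i) ξ)
    rw [sub_self] at h4
    refine h4.congr fun k => ?_
    simp only [hq, Function.comp_apply]
    rw [charInt_eq_cos_sin (hb k i)]
  set g : ℕ → Idx m → E3 → ℝ := fun k i ξ => ‖q k i ξ‖ * weight N ξ with hg
  have hdom := (integrable_weight hN).const_mul (2 * (M * μ.real univ))
  have hgm : ∀ k i, AEStronglyMeasurable (g k i) volume := fun k i =>
    ((hqc k i).norm.mul (continuous_weight N)).aestronglyMeasurable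
  have hg0 : ∀ k i ξ, 0 ≤ g k i ξ := fun k i ξ => mul_nonneg (norm_nonneg _) (weight_pos N ξ).le
  have hgle : ∀ k i ξ, ‖g k i ξ‖ ≤ 2 * (M * μ.real univ) * weight N ξ := fun k i ξ => by
    rw [Real.norm_of_nonneg (hg0 k i ξ)]
    exact mul_le_mul_of_nonneg_right (hqb k i ξ) (weight_pos N ξ).le
  have hgi : ∀ k i, Integrable (g k i) := fun k i =>
    hdom.mono' (hgm k i) (ae_of_all _ (hgle k i))
  have hglim : ∀ i, Tendsto (fun k => ∫ ξ, g k i ξ) atTop (𝓝 0) := fun i => by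
    have h1 := tendsto_integral_of_dominated_convergence (f := fun _ : E3 => (0 : ℝ)) _
      (fun k => hgm k i) hdom (fun k => ae_of_all _ (hgle k i)) (ae_of_all _ fun ξ => by
        simpa [hg] using (hq0 i ξ).norm.mul_const (weight N ξ))
    simpa using h1
  have hgn : ∀ k i, 0 ≤ ∫ ξ, g k i ξ := fun k i => integral_nonneg (hg0 k i)
  -- The sum over the finitely many components dominates the maximum.
  refine tendsto_vecNegNorm (c := fun k => ∑ i, K * ∫ ξ, g k i ξ)
    (fun k => Finset.sum_nonneg fun i _ => mul_nonneg hK0 (hgn k i)) (fun k i φ => ?_) ?_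
  · have e : ((pairing D.Ω (fun X => b k X i) φ - pairing D.Ω (fun X => z X i) φ : ℝ) : ℂ) =
        ∫ ξ, q k i ξ * fourierInv (fun X => (φ X : ℂ)) ξ := by
      rw [Complex.ofReal_sub, pairing, pairing, integral_mul_testFunction h (hb k i),
        integral_mul_testFunction h (hz i)]
      have hint : ∀ {c : E3 → ℝ}, Integrable c μ → Integrable fun ξ =>
          charInt μ c ξ * fourierInv (fun X => (φ X : ℂ)) ξ := fun {c} hc =>
        (integrable_fourierInv h φ).bdd_mul (continuous_charInt hc).aestronglyMeasurable
          (ae_of_all _ (norm_charInt_le c))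
      rw [← integral_sub (hint (hb k i)) (hint (hz i))]
      simp only [hq, sub_mul]
    rw [← Complex.norm_real, e]
    refine (norm_integral_fourierInv_le hK0 (hK φ) (hgi k i) fun ξ => le_rfl).trans ?_
    exact mul_le_mul_of_nonneg_right (Finset.single_le_sum (f := fun i => K * ∫ ξ, g k i ξ)
      (fun i _ => mul_nonneg hK0 (hgn k i)) (Finset.mem_univ i)) (sobolevNorm_nonneg _ _)
  · have h1 := tendsto_finsetSum Finset.univ fun i _ => (hglim i).const_mul K
    simpa using h1

lemma negNorm_pairing_lt_top (h : HolderConvex (D.Ω : Set E3) D.nrm α C) {N : ℕ} (hN : 2 ≤ N)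
    {z : E3 → ℝ} (hz : Integrable z (volume.restrict (D.Ω : Set E3))) :
    negNorm D.Ω (2 * N) (pairing D.Ω z) < ∞ := by
  obtain ⟨K, hK0, hK⟩ := exists_norm_fourierInv_le h N
  set μ := volume.restrict (D.Ω : Set E3)
  have hg := (integrable_weight hN).const_mul (∫ X, |z X| ∂μ)
  refine (negNorm_le (c := K * ∫ ξ, (∫ X, |z X| ∂μ) * weight N ξ) ?_ fun φ => ?_).trans_lt
    ENNReal.ofReal_lt_top
  · exact mul_nonneg hK0 (integral_nonneg fun ξ =>
      mul_nonneg (integral_nonneg fun X => abs_nonneg _) (weight_pos N ξ).le)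
  · rw [← Complex.norm_real, pairing, integral_mul_testFunction h hz]
    exact norm_integral_fourierInv_le hK0 (hK φ) hg fun ξ =>
      mul_le_mul_of_nonneg_right (norm_charInt_le z ξ) (weight_pos N ξ).le

end Problem

/-! ### Distributions given by locally integrable functions -/

section Distributions

variable {Ω : TopologicalSpace.Opens E3}

/-- The distribution defined by a function. -/
def toDistribution (Ω : TopologicalSpace.Opens E3) (z : E3 → ℝ) : 𝓓'(Ω, ℝ) :=
  TestFunction.integralAgainstBilinCLM (ContinuousLinearMap.mul ℝ ℝ) volume z

lemma toDistribution_apply {z : E3 → ℝ} (hz : LocallyIntegrableOn z (Ω : Set E3)) (φ : 𝓓(Ω, ℝ)) :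
    toDistribution Ω z φ = pairing Ω z φ := by
  have h1 := TestFunction.integralAgainstBilinCLM_eq_integral
    (B := ContinuousLinearMap.mul ℝ ℝ) hz (f := φ)
  refine h1.trans ?_
  rw [pairing, (smoothIn_testFunction φ).setIntegral_eq fun X hX => by rw [hX, mul_zero]]
  simp only [ContinuousLinearMap.mul_apply', mul_comm]

/-- Locally integrable functions are determined by their distributions. -/
lemma ae_eq_of_pairing_eq {z w : E3 → ℝ} (hz : LocallyIntegrableOn z (Ω : Set E3))
    (hw : LocallyIntegrableOn w (Ω : Set E3)) (h : ∀ φ : 𝓓(Ω, ℝ), pairing Ω z φ = pairing Ω w φ) :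
    ∀ᵐ X ∂volume.restrict (Ω : Set E3), z X = w X := by
  rw [ae_restrict_iff' Ω.isOpen.measurableSet]
  have h1 := Ω.isOpen.ae_eq_zero_of_integral_contDiff_smul_eq_zero (hz.sub hw) fun g hg hc hs => ?_
  · filter_upwards [h1] with X hX hXΩ
    exact sub_eq_zero.1 (hX hXΩ)
  · set φ : 𝓓(Ω, ℝ) := ⟨g, hg, hc, hs⟩
    have hφ := h φ
    have e : ∀ u : E3 → ℝ, pairing Ω u φ = ∫ X, g X * u X := fun u => by
      rw [pairing, (smoothIn_testFunction φ).setIntegral_eq fun X hX => by rw [hX, mul_zero]]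
      exact integral_congr_ae (ae_of_all _ fun X => mul_comm _ _)
    rw [e, e] at hφ
    have i1 : Integrable fun X => g X * z X :=
      TestFunction.integrable_bilin (ContinuousLinearMap.mul ℝ ℝ) hz φ
    have i2 : Integrable fun X => g X * w X :=
      TestFunction.integrable_bilin (ContinuousLinearMap.mul ℝ ℝ) hw φ
    simp only [smul_eq_mul, Pi.sub_apply, mul_sub]
    rw [integral_sub i1 i2, hφ, sub_self]

end Distributions

end DirichletSystem

end

/-! ### Assembly of the two limit statements -/

theorem theorem4p2 {m : ℕ} (D : DirichletSystem.Problem m) (α : ℝ≥0) (hD : D.Standing α)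
    (a₁ : MvPolynomial (Fin 3) ℂ)
    (P : Matrix (DirichletSystem.Idx m) (DirichletSystem.Idx m) (MvPolynomial (Fin 3) ℂ))
    (hP : D.Parameters a₁ P) (M : ℝ) (hM : 0 < M) :
    -- (1) strong solution
    (∀ (ε : ℕ → ℝ) (Z : ℕ → DirichletSystem.E3 → DirichletSystem.Idx m → ℝ),
      (∀ k, 0 < ε k) → Tendsto ε atTop (𝓝 0) →
      (∀ k, Z k ∈ D.OmegaM M) → (∀ k, D.IsFixed (ε k) (Z k)) →
      ∃ n : ℕ → ℕ, StrictMono n ∧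
      ∃ Zs : DirichletSystem.Idx m → 𝓓'(D.Ω, ℝ),
        (∀ i, Zs i ∈ DirichletSystem.HNeg D.Ω (D.m₁ P)) ∧
        Tendsto (fun k => DirichletSystem.vecNegNorm D.Ω (D.m₁ P) fun i φ =>
          DirichletSystem.pairing D.Ω (fun X => Z (n k) X i) φ - Zs i φ) atTop (𝓝 0) ∧
        Tendsto (fun k => DirichletSystem.vecNegNorm D.Ω (D.m₁ P) fun i φ =>
          ((DirichletSystem.pairing D.Ω (fun X => Z (n k) X i) φ : ℝ) : ℂ) - D.T0 (Z (n k)) i φ)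
          atTop (𝓝 0) ∧
        ∀ (i : DirichletSystem.Idx m) (z : DirichletSystem.E3 → ℝ),
          LocallyIntegrableOn z (D.Ω : Set DirichletSystem.E3) →
          (∀ φ, Zs i φ = DirichletSystem.pairing D.Ω z φ) →
          eLpNorm z ∞ (volume.restrict (D.Ω : Set DirichletSystem.E3)) ≤ ENNReal.ofReal M) ∧
    -- (2) essentially bounded solution
    (∀ (ε : ℕ → ℝ) (Z : ℕ → DirichletSystem.E3 → DirichletSystem.Idx m → ℝ),
      (∀ k, 0 < ε k) → Tendsto ε atTop (𝓝 0) →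
      (∀ k, Z k ∈ D.OmegaM M) → (∀ k, D.IsFixed (ε k) (Z k)) →
      (∀ᵐ X ∂(volume.restrict (closure (D.Ω : Set DirichletSystem.E3))),
        ∃ l : DirichletSystem.Idx m → ℝ, Tendsto (fun k => Z k X) atTop (𝓝 l)) →
      ∃ Zs : DirichletSystem.E3 → DirichletSystem.Idx m → ℝ,
        (∀ᵐ X ∂(volume.restrict (closure (D.Ω : Set DirichletSystem.E3))),
          Tendsto (fun k => Z k X) atTop (𝓝 (Zs X))) ∧
        (∀ i, MemLp (fun X => Zs X i) ∞
            (volume.restrict (closure (D.Ω : Set DirichletSystem.E3))) ∧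
          eLpNorm (fun X => Zs X i) ∞
            (volume.restrict (closure (D.Ω : Set DirichletSystem.E3))) ≤ ENNReal.ofReal M) ∧
        ∀ i φ, ((DirichletSystem.pairing D.Ω (fun X => Zs X i) φ : ℝ) : ℂ) = D.T0 Zs i φ) := by
  obtain ⟨C, h⟩ := hD.exists_holderConvex
  have hm : D.m₁ P = 2 * (D.deg P + 3) := by unfold DirichletSystem.Problem.m₁; ring
  refine ⟨fun ε Z hε hlim hZ hfix => ?_, fun ε Z hε hlim hZ hfix hae => ?_⟩
  · have hA := fun k => DirichletSystem.Problem.admissible_of_mem_OmegaM (hZ k)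
    have := DirichletSystem.Problem.volume_restrict_finite h
    obtain ⟨n, hn, z, hzi, hzM, hweak⟩ := DirichletSystem.exists_weak_limit
      (fun k => (hA k).meas_restrict) (fun k => (hA k).ae_bound)
    have hloc : ∀ i, LocallyIntegrableOn (fun X => z X i) (D.Ω : Set DirichletSystem.E3) :=
      fun i => IntegrableOn.locallyIntegrableOn (hzi i)
    refine ⟨n, hn, fun i => DirichletSystem.toDistribution D.Ω fun X => z X i, fun i => ?_, ?_, ?_,
      fun i w hw hzw => ?_⟩
    · simp only [DirichletSystem.HNeg, mem_ofPred_eq, hm,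
        DirichletSystem.toDistribution_apply (hloc i)]
      exact DirichletSystem.Problem.negNorm_pairing_lt_top h (by omega) (hzi i)
    · simp only [hm, DirichletSystem.toDistribution_apply (hloc _)]
      refine DirichletSystem.Problem.tendsto_vecNegNorm_of_weak h (by omega) (fun k i => ?_) hzi
        (fun k => (hA (n k)).ae_bound) hzM hweak
      exact Integrable.of_bound
        ((continuous_apply i).comp_aestronglyMeasurable (hA (n k)).meas_restrict) M
        ((hA (n k)).ae_bound.mono fun X hX => hX i)
    · exact DirichletSystem.Problem.tendsto_defect hP hD h (fun k => hε (n k))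
        (hlim.comp hn.tendsto_atTop) (fun k => hA (n k)) fun k => hfix (n k)
    · rw [eLpNorm_exponent_top]
      refine eLpNormEssSup_le_of_ae_bound ?_
      -- Any locally integrable representative of the limit distribution agrees almost everywhere
      -- with the weak limit, which is bounded by M.
      filter_upwards [DirichletSystem.ae_eq_of_pairing_eq hw (hloc i) fun φ => by
        rw [← hzw, DirichletSystem.toDistribution_apply (hloc i)], hzM i] with X h1 h2
      rw [h1]
      exact h2
  · have hA := fun k => DirichletSystem.Problem.admissible_of_mem_OmegaM (hZ k)
    obtain ⟨Zs, hZs, hAs⟩ := DirichletSystem.Problem.exists_admissible_limit hM.le hA hae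
    exact ⟨Zs, hZs, hAs.memLp, DirichletSystem.Problem.pairing_eq_T0_of_tendsto hP hD h hε hlim hA
      hAs hfix hZs⟩
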